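/- **Theorem 1.5 (h-embedding).** Let $\lambda\in\mathbb R$. A *gradient Ricci flow spacetime* $(\mathcal M, g, \phi, t, \partial_t,\lambda)$ consists of a smooth $(n+1)$-manifold with boundary $\mathcal M$; a smooth submersion $t:\mathcal M\to I$ to a time interval $I\subset\mathbb R$ with $\partial\mathcal M=t^{-1}(\partial I)$; a smooth vector field $\partial_t$ with $\partial_t t\equiv 1$; a smooth inner product $g$ on the spatial bundle $\ker dt\subset T\mathcal M$; and $\phi\in C^\infty(\mathcal M)$, such that $$\mathcal L_{\partial_t}g=-2(\mathrm{Ric}+\nabla^2\phi-\lambda g),\qquad \mathcal L_{\partial_t}\phi=-(R+\Delta\phi-n\lambda),$$ where $\mathrm{Ric},\nabla^2\phi,R,\Delta\phi$ are those of the time slices. (For $\lambda=0$ this is $\mathcal L_{\partial_t}g=-2(\mathrm{Ric}+\nabla^2\phi)$, $\mathcal L_{\partial_t}\phi=-(R+\Delta\phi)$.) Let $R_\phi=R+2\Delta\phi-|\nabla\phi|^2+2\lambda(\phi-n)$ be the weighted scalar curvature of the slices. Fix $t_0\in\mathbb R$ and let $u$ be the function of $t$ with $du/dt=-(1-\lambda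 u)$ (i.e. $\partial_t=-(1-\lambda u)\partial_u$) and $u=0$ at $t=t_0$; let $v$ be the coordinate on $\mathbb R$. Extend $g$ to a form on $T\mathcal M$, written $g_u$, by $g(\partial_t,\cdot)=0$, and write $\phi_u$ for $\phi$. On $\mathcal M\times\mathbb R$ put $$\widetilde g=2\,du\,dv+g_u-(1-\lambda u)^{-2}R_\phi\,du^2,\qquad \widetilde\phi=\phi_u-v+\lambda uv.$$ Then $(\mathcal M\times\mathbb R,\widetilde g,\widetilde\phi,\lambda)$ is a global weighted ambient half-space over the slice $t=t_0$. That is: $u\le 0$ exactly where $t\ge t_0$; $\widetilde g$ is a smooth metric of signature $(n+1,1)$ and $\widetilde\phi$ is smooth; $\widetilde g$ is invariant under the translations in $v$, and $\delta_s^*\widetilde\phi=\widetilde\phi+s$ for the dilations $\delta_s(m,v)=(m,v+(\lambda u-1)^{-1}s)$ (which for $\lambda=0$ are the translations $v\mapsto v-s$); on the hypersurface $u=0$ one has $\widetilde g=g$ on vectors tangent to it, $\widetilde\phi=\phi-v$, and $\nabla_{\partial_v}\partial_v=0$; and everywhere on $\mathcal M\times\mathbb R$ $$\widetilde P_\phi:=\mathrm{Ric}_{\widetilde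 g}+\widetilde\nabla^2\widetilde\phi-\lambda\widetilde g=0,\qquad \widetilde F_\phi:=\widetilde\Delta\widetilde\phi-|\widetilde\nabla\widetilde\phi|^2+2\lambda\widetilde\phi-(n+2)\lambda=0 .$$ -/

import Mathlib

open scoped Manifold ContDiff Topology
open VectorField

noncomputable section

namespace RicciAmbient

section Frames

variable {E : Type*} [NormedAddCommGroup E] [NormedSpace ℝ E]
  {H : Type*} [TopologicalSpace H] (I : ModelWithCorners ℝ E H)
  {N : Type*} [TopologicalSpace N] [ChartedSpace H N]

/-- A (not necessarily smooth) vector field on `N`. -/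
abbrev VField (I : ModelWithCorners ℝ E H) (N : Type*) [TopologicalSpace N] [ChartedSpace H N] :=
  (x : N) → TangentSpace I x

/-- A field of bilinear forms on the tangent spaces of `N`. -/
abbrev FormField (I : ModelWithCorners ℝ E H) (N : Type*) [TopologicalSpace N]
    [ChartedSpace H N] :=
  (x : N) → LinearMap.BilinForm ℝ (TangentSpace I x)

/-- `X` is a smooth vector field on the set `U`. -/
def SmoothFieldOn [IsManifold I ∞ N] (X : VField I N) (U : Set N) : Prop :=
  ContMDiffOn I I.tangent ∞ (fun x => (⟨x, X x⟩ : TangentBundle I N)) U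

/-- Smoothness of a field of bilinear forms: it takes smooth local vector fields to smooth
functions. -/
def SmoothForm [IsManifold I ∞ N] (g : FormField I N) : Prop :=
  ∀ (U : Set N) (X Y : VField I N), IsOpen U → SmoothFieldOn I X U → SmoothFieldOn I Y U →
    ContMDiffOn I 𝓘(ℝ, ℝ) ∞ (fun x => g x (X x) (Y x)) U

/-- The derivative `X f` of a function along a vector field. -/
def along (X : VField I N) (f : N → ℝ) (x : N) : ℝ := mvfderiv I f x (X x)

/-- The Lie derivative `(L_V g)(X, Y)`. -/
def lieDerivForm (V : VField I N) (g : FormField I N) (X Y : VField I N) (x : N) : ℝ :=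
  along I V (fun y => g y (X y) (Y y)) x - g x (mlieBracket I V X x) (Y x)
    - g x (X x) (mlieBracket I V Y x)

/-- The right-hand side of the Koszul formula, i.e. `g(∇_X Y, Z)` for the Levi-Civita
connection of `g`. -/
def koszul (g : FormField I N) (X Y Z : VField I N) (x : N) : ℝ :=
  (1 / 2) * (along I X (fun y => g y (Y y) (Z y)) x + along I Y (fun y => g y (X y) (Z y)) x
    - along I Z (fun y => g y (X y) (Y y)) x
    + g x (mlieBracket I X Y x) (Z x) - g x (mlieBracket I X Z x) (Y x)
    - g x (mlieBracket I Y Z x) (X x))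

/-- `e` is a smooth local frame, on the open set `U`, of the distribution `D ⊆ TN`. -/
structure IsFrameOn [IsManifold I ∞ N] {ι : Type*} (D : (x : N) → Submodule ℝ (TangentSpace I x))
    (e : ι → VField I N) (U : Set N) : Prop where
  isOpen : IsOpen U
  smooth : ∀ a, SmoothFieldOn I (e a) U
  linearIndependent : ∀ x ∈ U, LinearIndependent ℝ (fun a => e a x)
  span_eq : ∀ x ∈ U, Submodule.span ℝ (Set.range fun a => e a x) = D x

variable {ι : Type*} [Fintype ι] [DecidableEq ι]

/-! Components, in a local frame `e` of an involutive distribution `D`, of the leafwise geometry of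
a field of forms `g` that is non-degenerate on `D`. For `D = ⊤` this is the usual
pseudo-Riemannian geometry of `(N, g)`. -/

/-- `g_{ab}`. -/
def gram (g : FormField I N) (e : ι → VField I N) (x : N) : Matrix ι ι ℝ :=
  Matrix.of fun a b => g x (e a x) (e b x)

/-- `g^{ab}`. -/
def gramInv (g : FormField I N) (e : ι → VField I N) (x : N) : Matrix ι ι ℝ := (gram I g e x)⁻¹

/-- The connection coefficients: `∇_{e_a} e_b = Γ_{ab}^d e_d`. -/
def connCoeff (g : FormField I N) (e : ι → VField I N) (a b d : ι) (x : N) : ℝ :=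
  ∑ c, koszul I g (e a) (e b) (e c) x * gramInv I g e x c d

/-- The structure functions: `[e_a, e_b] = C_{ab}^d e_d`. -/
def structFun (g : FormField I N) (e : ι → VField I N) (a b d : ι) (x : N) : ℝ :=
  ∑ c, g x (mlieBracket I (e a) (e b) x) (e c x) * gramInv I g e x c d

/-- The curvature: `R(e_a, e_b) e_c = Riem_{abc}^d e_d`, where
`R(X, Y) Z = ∇_X ∇_Y Z - ∇_Y ∇_X Z - ∇_{[X, Y]} Z`. -/
def riem (g : FormField I N) (e : ι → VField I N) (a b c d : ι) (x : N) : ℝ :=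
  along I (e a) (connCoeff I g e b c d) x - along I (e b) (connCoeff I g e a c d) x
    + ∑ k, (connCoeff I g e b c k x * connCoeff I g e a k d x
      - connCoeff I g e a c k x * connCoeff I g e b k d x
      - structFun I g e a b k x * connCoeff I g e k c d x)

/-- The Ricci tensor: `Ric(Y, Z)` is the trace of `X ↦ R(X, Y) Z`. -/
def ric (g : FormField I N) (e : ι → VField I N) (b c : ι) (x : N) : ℝ :=
  ∑ a, riem I g e a b c a x

/-- The scalar curvature. -/
def scal (g : FormField I N) (e : ι → VField I N) (x : N) : ℝ :=
  ∑ a, ∑ b, gramInv I g e x a b * ric I g e a b x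

/-- The Hessian `∇²φ`. -/
def hess (g : FormField I N) (e : ι → VField I N) (φ : N → ℝ) (a b : ι) (x : N) : ℝ :=
  along I (e a) (along I (e b) φ) x - ∑ c, connCoeff I g e a b c x * along I (e c) φ x

/-- The Laplacian `Δφ`, the trace of the Hessian. -/
def lap (g : FormField I N) (e : ι → VField I N) (φ : N → ℝ) (x : N) : ℝ :=
  ∑ a, ∑ b, gramInv I g e x a b * hess I g e φ a b x

/-- The squared norm `|∇φ|²` of the gradient. -/
def gradSq (g : FormField I N) (e : ι → VField I N) (φ : N → ℝ) (x : N) : ℝ :=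
  ∑ a, ∑ b, gramInv I g e x a b * along I (e a) φ x * along I (e b) φ x

/-- `P_φ = Ric + ∇²φ - lam g`. -/
def wP (g : FormField I N) (e : ι → VField I N) (φ : N → ℝ) (lam : ℝ) (a b : ι) (x : N) : ℝ :=
  ric I g e a b x + hess I g e φ a b x - lam * g x (e a x) (e b x)

/-- `F_φ = Δφ - |∇φ|² + 2 lam φ - dim · lam`. -/
def wF (g : FormField I N) (e : ι → VField I N) (φ : N → ℝ) (lam : ℝ) (x : N) : ℝ :=
  lap I g e φ x - gradSq I g e φ x + 2 * lam * φ x - (Fintype.card ι : ℝ) * lam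

/-- `R_φ = R + 2Δφ - |∇φ|² + 2 lam (φ - dim)`. -/
def wR (g : FormField I N) (e : ι → VField I N) (φ : N → ℝ) (lam : ℝ) (x : N) : ℝ :=
  scal I g e x + 2 * lap I g e φ x - gradSq I g e φ x + 2 * lam * (φ x - Fintype.card ι)

end Frames

section Spacetime

variable {n : ℕ} {M : Type*} [TopologicalSpace M] [ChartedSpace (EuclideanHalfSpace (n + 1)) M]
  [IsManifold (𝓡∂ (n + 1)) ∞ M]

/-- The spatial distribution `ker dt`. -/
def spatial (t : M → ℝ) (x : M) : Submodule ℝ (TangentSpace (𝓡∂ (n + 1)) x) :=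
  LinearMap.ker (mvfderiv (𝓡∂ (n + 1)) t x).toLinearMap

/-- A gradient Ricci flow spacetime with parameter `lam`, on the `(n+1)`-manifold with boundary
`M`. The inner product on `ker dt` is extended to `TM` by `g(∂_t, ·) = 0`. That the time function is
a submersion follows from `∂_t t = 1`. The Ricci tensor, Hessian, scalar curvature and Laplacian are
those of the time slices; the flow equations are required in every local frame of `ker dt`. -/
structure GradientRicciFlowSpacetime (n : ℕ) (M : Type*) [TopologicalSpace M]
    [ChartedSpace (EuclideanHalfSpace (n + 1)) M] [IsManifold (𝓡∂ (n + 1)) ∞ M] (lam : ℝ) where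
  /-- the time interval -/
  interval : Set ℝ
  interval_ordConnected : interval.OrdConnected
  /-- the time function -/
  time : M → ℝ
  time_smooth : ContMDiff (𝓡∂ (n + 1)) 𝓘(ℝ, ℝ) ∞ time
  time_mem : ∀ x, time x ∈ interval
  boundary_eq : (𝓡∂ (n + 1)).boundary M = time ⁻¹' (frontier interval)
  /-- the time vector field -/
  dt : VField (𝓡∂ (n + 1)) M
  dt_smooth : SmoothFieldOn (𝓡∂ (n + 1)) dt Set.univ
  dt_time : ∀ x, along (𝓡∂ (n + 1)) dt time x = 1
  /-- the spatial metric -/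
  g : FormField (𝓡∂ (n + 1)) M
  g_smooth : SmoothForm (𝓡∂ (n + 1)) g
  g_symm : ∀ x X Y, g x X Y = g x Y X
  g_dt : ∀ x X, g x (dt x) X = 0
  g_pos : ∀ x, ∀ X ∈ spatial time x, X ≠ 0 → 0 < g x X X
  /-- the potential -/
  φ : M → ℝ
  φ_smooth : ContMDiff (𝓡∂ (n + 1)) 𝓘(ℝ, ℝ) ∞ φ
  flow_g : ∀ (e : Fin n → VField (𝓡∂ (n + 1)) M) (U : Set M),
    IsFrameOn (𝓡∂ (n + 1)) (spatial time) e U → ∀ x ∈ U, ∀ a b,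
      lieDerivForm (𝓡∂ (n + 1)) dt g (e a) (e b) x =
        -2 * (ric (𝓡∂ (n + 1)) g e a b x + hess (𝓡∂ (n + 1)) g e φ a b x
          - lam * g x (e a x) (e b x))
  flow_φ : ∀ (e : Fin n → VField (𝓡∂ (n + 1)) M) (U : Set M),
    IsFrameOn (𝓡∂ (n + 1)) (spatial time) e U → ∀ x ∈ U,
      along (𝓡∂ (n + 1)) dt φ x =
        -(scal (𝓡∂ (n + 1)) g e x + lap (𝓡∂ (n + 1)) g e φ x - n * lam)

namespace GradientRicciFlowSpacetime

variable {lam : ℝ} (S : GradientRicciFlowSpacetime n M lam)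

open Classical in
/-- The weighted scalar curvature `R_φ` of the time slices, a function on `M`: its value at `x` is
computed in any local frame of `ker dt` around `x`. -/
def weightedScal (x : M) : ℝ :=
  if h : ∃ (e : Fin n → VField (𝓡∂ (n + 1)) M) (U : Set M),
      IsFrameOn (𝓡∂ (n + 1)) (spatial S.time) e U ∧ x ∈ U then
    wR (𝓡∂ (n + 1)) S.g h.choose S.φ lam x
  else 0

end GradientRicciFlowSpacetime

end Spacetime

/-- The coordinate `u` as a function of time: the solution of `du/dt = -(1 - lam u)`
(i.e. `∂_t = -(1 - lam u) ∂_u`) with `u(t₀) = 0`. -/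
def uCoord (lam t₀ t : ℝ) : ℝ :=
  if lam = 0 then t₀ - t else (1 - Real.exp (lam * (t - t₀))) / lam

theorem uCoord_self (lam t₀ : ℝ) : uCoord lam t₀ t₀ = 0 := by
  simp [uCoord]

theorem hasDerivAt_uCoord (lam t₀ t : ℝ) :
    HasDerivAt (uCoord lam t₀) (-(1 - lam * uCoord lam t₀ t)) t := by
  by_cases h : lam = 0
  · have : uCoord lam t₀ = fun s => t₀ - s := by funext s; simp [uCoord, h]
    rw [this]
    simpa [h] using (hasDerivAt_id t).const_sub t₀
  · have h1 : uCoord lam t₀ = fun s => (1 - Real.exp (lam * (s - t₀))) / lam := by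
      funext s; simp [uCoord, h]
    rw [h1]
    have h2 := (((((hasDerivAt_id t).sub_const t₀).const_mul lam).exp).const_sub 1).div_const lam
    have h3 : -(1 - lam * ((1 - Real.exp (lam * (t - t₀))) / lam)) =
        -(Real.exp (lam * (t - t₀)) * (lam * 1)) / lam := by
      field_simp
      ring
    rw [h3]
    exact h2

section HalfSpace

variable {n : ℕ} {M : Type*} [TopologicalSpace M] [ChartedSpace (EuclideanHalfSpace (n + 1)) M]

/-- The model with corners of `M × ℝ`. -/
abbrev prodModel (n : ℕ) := (𝓡∂ (n + 1)).prod 𝓘(ℝ, ℝ)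

/-- The coordinate vector field `∂_v` of the factor `ℝ`. -/
def vertField : VField (prodModel n) (M × ℝ) := fun p =>
  mfderiv 𝓘(ℝ, ℝ) (prodModel n) (fun s : ℝ => ((p.1, s) : M × ℝ)) p.2 (1 : ℝ)

/-- The translation `v ↦ v + s` of `M × ℝ`. -/
def vertShift (s : ℝ) (p : M × ℝ) : M × ℝ := (p.1, p.2 + s)

/-- A symmetric bilinear form has signature `(k, 1)`. -/
def HasLorentzSignature (k : ℕ) {V : Type*} [AddCommGroup V] [Module ℝ V]
    (B : LinearMap.BilinForm ℝ V) : Prop :=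
  ∃ b : Module.Basis (Fin k ⊕ Fin 1) ℝ V, ∀ i j,
    B (b i) (b j) = (Matrix.fromBlocks 1 0 0 (-1) : Matrix (Fin k ⊕ Fin 1) (Fin k ⊕ Fin 1) ℝ) i j

variable [IsManifold (𝓡∂ (n + 1)) ∞ M]

namespace GradientRicciFlowSpacetime

variable {lam : ℝ} (S : GradientRicciFlowSpacetime n M lam) (t₀ : ℝ)

/-- The function `u` on `M × ℝ`; it vanishes on the time slice `t = t₀`. -/
def u (p : M × ℝ) : ℝ := uCoord lam t₀ (S.time p.1)

/-- The one-form `du`. -/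
def du (p : M × ℝ) : TangentSpace (prodModel n) p →ₗ[ℝ] ℝ :=
  (mvfderiv (prodModel n) (S.u t₀) p).toLinearMap

/-- The one-form `dv`. -/
def dv (p : M × ℝ) : TangentSpace (prodModel n) p →ₗ[ℝ] ℝ :=
  (mvfderiv (prodModel n) (Prod.snd : M × ℝ → ℝ) p).toLinearMap

/-- The differential of the projection `M × ℝ → M`. -/
def dπ (p : M × ℝ) : TangentSpace (prodModel n) p →ₗ[ℝ] TangentSpace (𝓡∂ (n + 1)) p.1 :=
  (mfderiv (prodModel n) (𝓡∂ (n + 1)) (Prod.fst : M × ℝ → M) p).toLinearMap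

/-- The dilation `δ_s`: `v ↦ v + (lam u - 1)⁻¹ s`. -/
def dilation (s : ℝ) (p : M × ℝ) : M × ℝ := (p.1, p.2 + (lam * S.u t₀ p - 1)⁻¹ * s)

/-- `(M × ℝ, G, Φ, lam)` is a global weighted ambient half-space over the time slice `t = t₀` of
the spacetime `S`. -/
structure IsGlobalAmbientHalfSpace (G : FormField (prodModel n) (M × ℝ)) (Φ : M × ℝ → ℝ) :
    Prop where
  /-- the half-space `u ≤ 0` is the part of the spacetime from time `t₀` on -/
  half_space : ∀ p, S.u t₀ p ≤ 0 ↔ t₀ ≤ S.time p.1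
  metric_smooth : SmoothForm (prodModel n) G
  metric_symm : ∀ p X Y, G p X Y = G p Y X
  signature : ∀ p, HasLorentzSignature (n + 1) (G p)
  potential_smooth : ContMDiff (prodModel n) 𝓘(ℝ, ℝ) ∞ Φ
  /-- `G` is independent of `v` -/
  metric_invariant : ∀ (s : ℝ) (p : M × ℝ) (X Y : TangentSpace (prodModel n) p),
    G (vertShift s p) (mfderiv (prodModel n) (prodModel n) (vertShift (M := M) s) p X)
      (mfderiv (prodModel n) (prodModel n) (vertShift (M := M) s) p Y) = G p X Y
  /-- `δ_s^* Φ = Φ + s` -/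
  potential_homogeneous : ∀ (s : ℝ) (p : M × ℝ), Φ (S.dilation t₀ s p) = Φ p + s
  /-- the initial condition `ι^* G = g`, on vectors tangent to the hypersurface `u = 0` -/
  metric_initial : ∀ p, S.time p.1 = t₀ → ∀ X Y : TangentSpace (prodModel n) p,
    S.du t₀ p X = 0 → S.du t₀ p Y = 0 → G p X Y = S.g p.1 (dπ p X) (dπ p Y)
  /-- the initial condition `ι^* Φ = φ - v` -/
  potential_initial : ∀ p, S.time p.1 = t₀ → Φ p = S.φ p.1 - p.2
  /-- `∇_{∂_v} ∂_v = 0` where `u = 0` -/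
  straight : ∀ p, S.time p.1 = t₀ → ∀ (U : Set (M × ℝ)) (Z : VField (prodModel n) (M × ℝ)),
    IsOpen U → p ∈ U → SmoothFieldOn (prodModel n) Z U →
      koszul (prodModel n) G vertField vertField Z p = 0
  /-- `P_Φ = 0`, in every local frame of `T(M × ℝ)` -/
  wP_eq_zero : ∀ (e : Fin (n + 2) → VField (prodModel n) (M × ℝ)) (U : Set (M × ℝ)),
    IsFrameOn (prodModel n) (fun _ => ⊤) e U → ∀ p ∈ U, ∀ a b,
      wP (prodModel n) G e Φ lam a b p = 0
  /-- `F_Φ = 0`, in every local frame of `T(M × ℝ)` -/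
  wF_eq_zero : ∀ (e : Fin (n + 2) → VField (prodModel n) (M × ℝ)) (U : Set (M × ℝ)),
    IsFrameOn (prodModel n) (fun _ => ⊤) e U → ∀ p ∈ U,
      wF (prodModel n) G e Φ lam p = 0

/-- `2 du dv + g_u - (1 - lam u)⁻² R_φ du²`. -/
def ambientMetric : FormField (prodModel n) (M × ℝ) := fun p =>
  LinearMap.BilinForm.linMulLin (S.du t₀ p) (dv p)
    + LinearMap.BilinForm.linMulLin (dv p) (S.du t₀ p)
    + LinearMap.BilinForm.comp (S.g p.1) (dπ p) (dπ p)
    - ((1 - lam * S.u t₀ p) ^ 2)⁻¹ • S.weightedScal p.1 •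
      LinearMap.BilinForm.linMulLin (S.du t₀ p) (S.du t₀ p)

/-- `φ_u - v + lam u v`. -/
def ambientPotential (p : M × ℝ) : ℝ := S.φ p.1 - p.2 + lam * S.u t₀ p * p.2

end GradientRicciFlowSpacetime

end HalfSpace

end RicciAmbient

end

/-!
The field `∂_v` is Killing and its dual form `du` is closed, so `∂_v` is null and parallel. Hence
the weighted Ricci form `P̃` of the ambient space kills `∂_v`, and the flow equation for `g` says
that it vanishes on vectors tangent to the hypersurfaces of constant `u`; the flow equation for `φ`
and the formula for `R_φ` give `F̃ = 0`. What is left is `P̃(∂_t, ·)`. The trace of `P̃` vanishes,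
so the weighted contracted Bianchi identity reads `div P̃ = P̃(∇φ̃, ·)`. As `∂_v` is parallel and
`∂_v φ̃ = -(1 - lam u)` never vanishes, this is a linear equation that determines first
`P̃(∂_t, X)` for `X` tangent to the slices and then `P̃(∂_t, ∂_t)`, and both are zero.
-/

noncomputable section

namespace RicciAmbient

section LieRinehart

variable {A L : Type*} [CommRing A] [LieRing L] [Module A L] [LieRingModule L A]
  [LieRinehartRing A L]

@[simp] lemma lie_one (X : L) : ⁅X, (1 : A)⁆ = 0 := by
  simpa using LieRinehartRing.leibniz_mul_right X (1 : A) 1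

lemma lie_mul (X : L) (a b : A) : ⁅X, a * b⁆ = a * ⁅X, b⁆ + ⁅X, a⁆ * b :=
  LieRinehartRing.leibniz_mul_right X a b

lemma lie_natCast (X : L) (n : ℕ) : ⁅X, (n : A)⁆ = 0 := by
  induction n with
  | zero => simp
  | succ n ih => rw [Nat.cast_succ, lie_add, ih, lie_one, add_zero]

lemma leibniz_smul_left (a : A) (X Y : L) : ⁅a • X, Y⁆ = a • ⁅X, Y⁆ - ⁅Y, a⁆ • X := by
  rw [← lie_skew, LieRinehartRing.leibniz_smul_right, ← lie_skew X Y]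
  simp only [smul_neg]; abel

lemma lie_form_of_span {κ : Type*} {g : LinearMap.BilinForm A L} {e : κ → L} {V : L}
    (span : ∀ X, X ∈ Submodule.span A (Set.range e))
    (lie_frame : ∀ i j, ⁅V, g (e i) (e j)⁆ = g ⁅V, e i⁆ (e j) + g (e i) ⁅V, e j⁆) (X Y : L) :
    ⁅V, g X Y⁆ = g ⁅V, X⁆ Y + g X ⁅V, Y⁆ := by
  have extend_right (i : κ) : ⁅V, g (e i) Y⁆ = g ⁅V, e i⁆ Y + g (e i) ⁅V, Y⁆ := by
    induction span Y using Submodule.span_induction with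
    | mem y hy => obtain ⟨j, rfl⟩ := hy; exact lie_frame i j
    | zero => simp
    | add y z _ _ hy hz => simp only [map_add, lie_add, hy, hz]; ring
    | smul a y _ hy =>
      simp only [map_smul, smul_eq_mul, lie_mul, hy, LieRinehartRing.leibniz_smul_right, map_add]
      ring
  induction span X using Submodule.span_induction with
  | mem x hx => obtain ⟨i, rfl⟩ := hx; exact extend_right i
  | zero => simp
  | add x y _ _ hx hy => simp only [map_add, lie_add, hx, hy, LinearMap.add_apply]; ring
  | smul a x _ hx =>
    simp only [map_smul, smul_eq_mul, lie_mul, hx, LieRinehartRing.leibniz_smul_right,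
      map_add, LinearMap.smul_apply, LinearMap.add_apply]
    ring

end LieRinehart

section LeviCivita

variable {A L : Type*} [CommRing A] [LieRing L] [Module A L] [LieRingModule L A]

/-- The curvature `R(X, Y) Z` of a connection `nab X Y = ∇_X Y`. -/
def curvature (nab : L → L → L) (X Y Z : L) : L :=
  nab X (nab Y Z) - nab Y (nab X Z) - nab ⁅X, Y⁆ Z

/-- The covariant derivative `(∇_X R)(Y, Z) W` of the curvature. -/
def covDerivCurvature (nab : L → L → L) (X Y Z W : L) : L :=
  nab X (curvature nab Y Z W) - curvature nab (nab X Y) Z W - curvature nab Y (nab X Z) W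
    - curvature nab Y Z (nab X W)

/-- The covariant derivative `(∇_X B)(Y, Z)` of a bilinear form. -/
def covDeriv (nab : L → L → L) (B : LinearMap.BilinForm A L) (X Y Z : L) : A :=
  ⁅X, B Y Z⁆ - B (nab X Y) Z - B Y (nab X Z)

variable [Invertible (2 : A)]

/-- The right-hand side of the Koszul formula, the algebraic counterpart of `koszul`. -/
def koszulForm (g : LinearMap.BilinForm A L) (X Y Z : L) : A :=
  ⅟2 * (⁅X, g Y Z⁆ + ⁅Y, g X Z⁆ - ⁅Z, g X Y⁆ + g ⁅X, Y⁆ Z - g ⁅X, Z⁆ Y - g ⁅Y, Z⁆ X)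

lemma two_mul_koszulForm (g : LinearMap.BilinForm A L) (X Y Z : L) :
    2 * koszulForm g X Y Z =
      ⁅X, g Y Z⁆ + ⁅Y, g X Z⁆ - ⁅Z, g X Y⁆ + g ⁅X, Y⁆ Z - g ⁅X, Z⁆ Y - g ⁅Y, Z⁆ X :=
  mul_invOf_cancel_left' _ _

lemma koszulForm_add_left (g : LinearMap.BilinForm A L) (X X' Y Z : L) :
    koszulForm g (X + X') Y Z = koszulForm g X Y Z + koszulForm g X' Y Z := by
  simp only [koszulForm, map_add, lie_add, add_lie, LinearMap.add_apply]; ring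

/-- `nab` is the Levi-Civita connection of the non-degenerate symmetric form `g`. -/
structure IsLeviCivita (g : LinearMap.BilinForm A L) (nab : L → L → L) : Prop where
  symm : ∀ X Y, g X Y = g Y X
  ext : ∀ X Y, (∀ Z, g X Z = g Y Z) → X = Y
  koszul : ∀ X Y Z, g (nab X Y) Z = koszulForm g X Y Z

namespace IsLeviCivita

variable {g : LinearMap.BilinForm A L} {nab : L → L → L} (h : IsLeviCivita g nab)
include h

lemma torsion_free (X Y : L) : nab X Y - nab Y X = ⁅X, Y⁆ := by
  refine h.ext _ _ fun Z => (isUnit_of_invertible (2 : A)).mul_left_cancel ?_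
  simp only [map_sub, LinearMap.sub_apply, h.koszul, mul_sub, two_mul_koszulForm, h.symm Y X]
  rw [← lie_skew X Y]
  simp only [map_neg, LinearMap.neg_apply]; ring

lemma metric_compat (X Y Z : L) : ⁅X, g Y Z⁆ = g (nab X Y) Z + g Y (nab X Z) := by
  refine (isUnit_of_invertible (2 : A)).mul_left_cancel ?_
  rw [h.symm Y (nab X Z), h.koszul, h.koszul, mul_add, two_mul_koszulForm, two_mul_koszulForm,
    h.symm Z Y, ← lie_skew Y Z]
  simp only [map_neg, LinearMap.neg_apply]; ring

lemma add_left (X X' Y : L) : nab (X + X') Y = nab X Y + nab X' Y :=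
  h.ext _ _ fun Z => by simp only [map_add, LinearMap.add_apply, h.koszul, koszulForm_add_left]

lemma add_right (X Y Y' : L) : nab X (Y + Y') = nab X Y + nab X Y' := by
  have torsion := h.torsion_free X (Y + Y')
  rw [h.add_left, lie_add, ← h.torsion_free, ← h.torsion_free, ← sub_eq_zero] at torsion
  rw [← sub_eq_zero, ← torsion]; abel

lemma zero_right (X : L) : nab X 0 = 0 :=
  (AddMonoidHom.mk' (nab X) (h.add_right X)).map_zero

lemma neg_right (X Y : L) : nab X (-Y) = -nab X Y :=
  (AddMonoidHom.mk' (nab X) (h.add_right X)).map_neg Y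

lemma sub_right (X Y Z : L) : nab X (Y - Z) = nab X Y - nab X Z :=
  (AddMonoidHom.mk' (nab X) (h.add_right X)).map_sub Y Z

lemma sum_right {κ : Type*} (s : Finset κ) (X : L) (Y : κ → L) :
    nab X (∑ i ∈ s, Y i) = ∑ i ∈ s, nab X (Y i) :=
  map_sum (AddMonoidHom.mk' (nab X) (h.add_right X)) Y s

lemma zero_left (Y : L) : nab 0 Y = 0 :=
  (AddMonoidHom.mk' (nab · Y) (h.add_left · · Y)).map_zero

lemma neg_left (X Y : L) : nab (-X) Y = -nab X Y :=
  (AddMonoidHom.mk' (nab · Y) (h.add_left · · Y)).map_neg X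

lemma sub_left (X Y Z : L) : nab (X - Y) Z = nab X Z - nab Y Z :=
  (AddMonoidHom.mk' (nab · Z) (h.add_left · · Z)).map_sub X Y

lemma sum_left {κ : Type*} (s : Finset κ) (X : κ → L) (Y : L) :
    nab (∑ i ∈ s, X i) Y = ∑ i ∈ s, nab (X i) Y :=
  map_sum (AddMonoidHom.mk' (nab · Y) (h.add_left · · Y)) X s

lemma unique {nab' : L → L → L} (h' : IsLeviCivita g nab') : nab = nab' := by
  funext X Y
  exact h.ext _ _ fun Z => by rw [h.koszul, h'.koszul]

lemma curvature_antisymm (X Y Z : L) : curvature nab X Y Z = -curvature nab Y X Z := by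
  unfold curvature
  rw [← lie_skew X Y, h.neg_left]; abel

lemma curvature_add_left (X X' Y Z : L) :
    curvature nab (X + X') Y Z = curvature nab X Y Z + curvature nab X' Y Z := by
  simp only [curvature, h.add_right, h.add_left, add_lie]; abel

lemma curvature_add_mid (X Y Y' Z : L) :
    curvature nab X (Y + Y') Z = curvature nab X Y Z + curvature nab X Y' Z := by
  simp only [curvature, h.add_right, h.add_left, lie_add]; abel

lemma curvature_add_right (X Y Z W : L) :
    curvature nab X Y (Z + W) = curvature nab X Y Z + curvature nab X Y W := by
  simp only [curvature, h.add_right]; abel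

lemma curvature_sub_left (X X' Y Z : L) :
    curvature nab (X - X') Y Z = curvature nab X Y Z - curvature nab X' Y Z :=
  (AddMonoidHom.mk' (curvature nab · Y Z) (h.curvature_add_left · · Y Z)).map_sub X X'

lemma curvature_zero_mid (X Z : L) : curvature nab X 0 Z = 0 :=
  (AddMonoidHom.mk' (curvature nab X · Z) (h.curvature_add_mid X · · Z)).map_zero

lemma first_bianchi (X Y Z : L) :
    curvature nab X Y Z + curvature nab Y Z X + curvature nab Z X Y = 0 := by
  have jacobi : ⁅X, ⁅Y, Z⁆⁆ + ⁅Y, ⁅Z, X⁆⁆ + ⁅Z, ⁅X, Y⁆⁆ = 0 := lie_jacobi X Y Z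
  rw [← h.torsion_free X ⁅Y, Z⁆, ← h.torsion_free Y ⁅Z, X⁆, ← h.torsion_free Z ⁅X, Y⁆] at jacobi
  nth_rw 1 [← h.torsion_free Y Z] at jacobi
  nth_rw 1 [← h.torsion_free Z X] at jacobi
  nth_rw 1 [← h.torsion_free X Y] at jacobi
  simp only [h.sub_right] at jacobi
  rw [← jacobi]; unfold curvature; abel

lemma form_curvature_antisymm (X Y Z W : L) :
    g (curvature nab X Y Z) W = -g (curvature nab X Y W) Z := by
  have commutator : ⁅⁅X, Y⁆, g Z W⁆ = ⁅X, ⁅Y, g Z W⁆⁆ - ⁅Y, ⁅X, g Z W⁆⁆ := lie_lie _ _ _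
  simp only [h.metric_compat, lie_add] at commutator
  simp only [curvature, map_sub, LinearMap.sub_apply]
  simp only [h.symm Z] at commutator ⊢
  linear_combination (-1 : A) * commutator

lemma form_curvature_pair_symm (X Y Z W : L) :
    g (curvature nab X Y Z) W = g (curvature nab Z W X) Y := by
  have bianchi (X Y Z W : L) :
      g (curvature nab X Y Z) W + g (curvature nab Y Z X) W + g (curvature nab Z X Y) W = 0 := by
    simpa using congrArg (g · W) (h.first_bianchi X Y Z)
  have antisymm (X Y Z W : L) : g (curvature nab X Y Z) W = -g (curvature nab Y X Z) W := by
    rw [h.curvature_antisymm]; simp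
  have antisymm' := h.form_curvature_antisymm
  apply (isUnit_of_invertible (2 : A)).mul_left_cancel
  -- The octahedron argument: the first Bianchi identity on the four faces.
  have b₁ := bianchi X Y Z W
  have b₂ := bianchi Y Z W X
  have b₃ := bianchi Z W X Y
  have b₄ := bianchi W X Y Z
  rw [antisymm' Y Z W X, antisymm' Z W Y X, antisymm W Y Z X, antisymm' Y W Z X] at b₂
  rw [antisymm' W X Z Y, antisymm X Z W Y, antisymm' Z X W Y] at b₃
  rw [antisymm' X Y W Z] at b₄
  linear_combination b₁ + b₂ - b₃ - b₄

lemma second_bianchi (X Y Z W : L) :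
    covDerivCurvature nab X Y Z W + covDerivCurvature nab Y Z X W
      + covDerivCurvature nab Z X Y W = 0 := by
  have jacobi : nab ⁅X, ⁅Y, Z⁆⁆ W + nab ⁅Y, ⁅Z, X⁆⁆ W + nab ⁅Z, ⁅X, Y⁆⁆ W = 0 := by
    rw [← h.add_left, ← h.add_left, lie_jacobi, h.zero_left]
  have torsion (X Y Z : L) : curvature nab (nab X Y) Z W - curvature nab (nab Y X) Z W =
      curvature nab ⁅X, Y⁆ Z W := by
    rw [← h.torsion_free, h.curvature_sub_left]
  have expand : covDerivCurvature nab X Y Z W + covDerivCurvature nab Y Z X W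
        + covDerivCurvature nab Z X Y W =
      (nab X (curvature nab Y Z W) + nab Y (curvature nab Z X W) + nab Z (curvature nab X Y W))
      - (curvature nab Y Z (nab X W) + curvature nab Z X (nab Y W) + curvature nab X Y (nab Z W))
      - (curvature nab ⁅X, Y⁆ Z W + curvature nab ⁅Y, Z⁆ X W + curvature nab ⁅Z, X⁆ Y W) := by
    rw [← torsion X Y Z, ← torsion Y Z X, ← torsion Z X Y]
    unfold covDerivCurvature
    rw [h.curvature_antisymm Y (nab X Z), h.curvature_antisymm Z (nab Y X),
      h.curvature_antisymm X (nab Z Y)]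
    abel
  have swap (X Y Z : L) : nab ⁅⁅X, Y⁆, Z⁆ W = -nab ⁅Z, ⁅X, Y⁆⁆ W := by
    rw [← lie_skew, h.neg_left]
  rw [expand]
  simp only [curvature, h.sub_right, swap]
  refine Eq.trans ?_ (neg_eq_zero.mpr jacobi)
  abel

lemma covDerivCurvature_antisymm (X Y Z W : L) :
    covDerivCurvature nab X Y Z W = -covDerivCurvature nab X Z Y W := by
  unfold covDerivCurvature
  rw [h.curvature_antisymm Y Z W, h.curvature_antisymm (nab X Y) Z,
    h.curvature_antisymm Y (nab X Z), h.curvature_antisymm Y Z, h.neg_right]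
  abel

lemma form_covDerivCurvature_antisymm (X Y Z W U : L) :
    g (covDerivCurvature nab X Y Z W) U = -g (covDerivCurvature nab X Y Z U) W := by
  have antisymm := h.form_curvature_antisymm
  have derivative : ⁅X, g (curvature nab Y Z W) U⁆ = -⁅X, g (curvature nab Y Z U) W⁆ := by
    rw [antisymm, lie_neg]
  rw [h.metric_compat, h.metric_compat] at derivative
  simp only [covDerivCurvature, map_sub, LinearMap.sub_apply]
  linear_combination derivative - antisymm (nab X Y) Z W U - antisymm Y (nab X Z) W U
    - antisymm Y Z (nab X W) U - antisymm Y Z W (nab X U)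

end IsLeviCivita

variable [LieRinehartRing A L]

lemma koszulForm_smul_left (g : LinearMap.BilinForm A L) (a : A) (X Y Z : L) :
    koszulForm g (a • X) Y Z = a * koszulForm g X Y Z := by
  simp only [koszulForm, map_smul, map_sub, smul_eq_mul, lie_mul, LinearMap.sub_apply,
    leibniz_smul_left, LieRinehartRing.lie_smul_eq_mul, LinearMap.smul_apply]
  ring

/-- The Koszul formula, as an `A`-linear form in its last argument. -/
def koszulLinear (g : LinearMap.BilinForm A L) (hg : ∀ X Y, g X Y = g Y X) (X Y : L) :
    L →ₗ[A] A where
  toFun := koszulForm g X Y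
  map_add' Z W := by
    simp only [koszulForm, map_add, lie_add, add_lie, LinearMap.add_apply]; ring
  map_smul' a Z := by
    simp only [koszulForm, map_smul, map_add, smul_eq_mul, lie_mul, LinearMap.add_apply,
      LieRinehartRing.leibniz_smul_right, LieRinehartRing.lie_smul_eq_mul, LinearMap.smul_apply,
      hg Z X, hg Z Y, RingHom.id_apply]
    ring

namespace IsLeviCivita

variable {g : LinearMap.BilinForm A L} {nab : L → L → L} (h : IsLeviCivita g nab)

section

include h

lemma smul_left (a : A) (X Y : L) : nab (a • X) Y = a • nab X Y :=
  h.ext _ _ fun Z => by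
    simp only [map_smul, LinearMap.smul_apply, h.koszul, koszulForm_smul_left, smul_eq_mul]

lemma smul_right (a : A) (X Y : L) : nab X (a • Y) = a • nab X Y + ⁅X, a⁆ • Y := by
  have torsion := h.torsion_free X (a • Y)
  rw [h.smul_left, LieRinehartRing.leibniz_smul_right, ← h.torsion_free, smul_sub,
    ← sub_eq_zero] at torsion
  rw [← sub_eq_zero, ← torsion]; abel

lemma curvature_smul_left (a : A) (X Y Z : L) :
    curvature nab (a • X) Y Z = a • curvature nab X Y Z := by
  simp only [curvature, h.smul_right, h.smul_left, leibniz_smul_left, h.sub_left, smul_sub]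
  abel

lemma curvature_smul_mid (a : A) (X Y Z : L) :
    curvature nab X (a • Y) Z = a • curvature nab X Y Z := by
  rw [h.curvature_antisymm, h.curvature_smul_left, h.curvature_antisymm X Y, smul_neg]

lemma curvature_smul_right (a : A) (X Y Z : L) :
    curvature nab X Y (a • Z) = a • curvature nab X Y Z := by
  simp only [curvature, h.smul_right, h.add_right, lie_lie, smul_sub, sub_smul]
  abel

end

/-- The bilinear form `(X, W) ↦ g(R(X, Y) Z, W)`. -/
def curvatureForm (Y Z : L) : LinearMap.BilinForm A L :=
  LinearMap.mk₂ A (fun X W => g (curvature nab X Y Z) W)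
    (fun X X' W => by simp only [h.curvature_add_left, map_add, LinearMap.add_apply])
    (fun a X W => by simp only [h.curvature_smul_left, map_smul, LinearMap.smul_apply])
    (fun X W W' => map_add _ _ _) (fun a X W => map_smul _ _ _)

@[simp] lemma curvatureForm_apply (X Y Z W : L) :
    h.curvatureForm Y Z X W = g (curvature nab X Y Z) W := rfl

/-- The Hessian `∇²φ` of a function. -/
def hessian (φ : A) : LinearMap.BilinForm A L :=
  LinearMap.mk₂ A (fun X Y => ⁅X, ⁅Y, φ⁆⁆ - ⁅nab X Y, φ⁆)
    (fun X X' Y => by simp only [h.add_left, add_lie]; ring)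
    (fun a X Y => by
      simp only [h.smul_left, LieRinehartRing.lie_smul_eq_mul, smul_eq_mul]; ring)
    (fun X Y Y' => by simp only [h.add_right, add_lie, lie_add]; ring)
    (fun a X Y => by
      simp only [h.smul_right, add_lie, LieRinehartRing.lie_smul_eq_mul, smul_eq_mul,
        lie_mul]; ring)

lemma hessian_apply (φ : A) (X Y : L) : h.hessian φ X Y = ⁅X, ⁅Y, φ⁆⁆ - ⁅nab X Y, φ⁆ := rfl

lemma hessian_symm (φ : A) (X Y : L) : h.hessian φ X Y = h.hessian φ Y X := by
  have commutator : ⁅⁅X, Y⁆, φ⁆ = ⁅X, ⁅Y, φ⁆⁆ - ⁅Y, ⁅X, φ⁆⁆ := lie_lie _ _ _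
  rw [← h.torsion_free, sub_lie] at commutator
  rw [hessian_apply, hessian_apply]
  linear_combination -commutator

lemma hessian_eq_hessian {nab' : L → L → L} (h' : IsLeviCivita g nab') (φ : A) :
    h.hessian φ = h'.hessian φ := by
  obtain rfl := h.unique h'
  rfl

lemma hessian_eq {φ : A} {V : L} (hV : ∀ Z, g V Z = ⁅Z, φ⁆) (X Y : L) :
    h.hessian φ X Y = g (nab X V) Y := by
  rw [hessian_apply, ← hV, ← hV, h.metric_compat]; ring

lemma covDeriv_hessian_sub {φ : A} {V : L} (hV : ∀ Z, g V Z = ⁅Z, φ⁆) (X Y Z : L) :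
    covDeriv nab (h.hessian φ) X Y Z - covDeriv nab (h.hessian φ) Y X Z =
      g (curvature nab X Y V) Z := by
  have torsion : g (nab ⁅X, Y⁆ V) Z = g (nab (nab X Y) V) Z - g (nab (nab Y X) V) Z := by
    rw [← h.torsion_free, h.sub_left, map_sub, LinearMap.sub_apply]
  simp only [covDeriv, h.hessian_eq hV, h.metric_compat, curvature, map_sub, LinearMap.sub_apply,
    torsion]
  ring

end IsLeviCivita

end LeviCivita

section DualFrames

variable {A L : Type*} [CommRing A] [LieRing L] [Module A L] {ι : Type*} [Fintype ι]

/-- `e` and `f` are frames of `L` that are dual to each other with respect to `g`. -/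
structure IsDualFrames [DecidableEq ι] (g : LinearMap.BilinForm A L) (e f : ι → L) : Prop where
  symm : ∀ X Y, g X Y = g Y X
  left : ∀ X, ∑ a, g X (f a) • e a = X
  right : ∀ X, ∑ a, g X (e a) • f a = X
  dual : ∀ a b, g (e a) (f b) = if a = b then 1 else 0

/-- The trace of a bilinear form in a pair of dual frames. -/
def frameTrace (e f : ι → L) (B : LinearMap.BilinForm A L) : A := ∑ a, B (e a) (f a)

namespace IsDualFrames

variable [DecidableEq ι] {g : LinearMap.BilinForm A L} {e f : ι → L} (F : IsDualFrames g e f)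
include F

lemma swap : IsDualFrames g f e where
  symm := F.symm
  left := F.right
  right := F.left
  dual a b := by rw [F.symm, F.dual]; simp only [eq_comm]

lemma frameTrace_eq {κ : Type*} [Fintype κ] [DecidableEq κ] {e' f' : κ → L}
    (F' : IsDualFrames g e' f') (B : LinearMap.BilinForm A L) :
    frameTrace e f B = frameTrace e' f' B := by
  have expand_left (a : ι) : B (e a) (f a) = ∑ j, g (e a) (f' j) * B (e' j) (f a) := by
    conv_lhs => rw [← F'.left (e a)]
    simp
  have expand_right (j : κ) : B (e' j) (f' j) = ∑ a, g (e a) (f' j) * B (e' j) (f a) := by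
    conv_lhs => rw [← F.right (f' j)]
    simp [F.symm (f' j)]
  simp only [frameTrace, expand_left, expand_right]
  exact Finset.sum_comm

lemma frameTrace_form : frameTrace e f g = Fintype.card ι := by
  simp [frameTrace, F.dual]

end IsDualFrames

variable [LieRingModule L A]

/-- The Levi-Civita connection, in a pair of dual frames. -/
def leviCivita [Invertible (2 : A)] (g : LinearMap.BilinForm A L) (e f : ι → L) (X Y : L) : L :=
  ∑ a, koszulForm g X Y (e a) • f a

/-- The gradient of a function, in a pair of dual frames. -/
def frameGradient (e f : ι → L) (φ : A) : L := ∑ a, ⁅e a, φ⁆ • f a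

namespace IsDualFrames

variable [LieRinehartRing A L] [DecidableEq ι] {g : LinearMap.BilinForm A L} {e f : ι → L}
  (F : IsDualFrames g e f)
include F

lemma isLeviCivita [Invertible (2 : A)] : IsLeviCivita g (leviCivita g e f) where
  symm := F.symm
  ext X Y h := by rw [← F.left X, ← F.left Y]; simp only [h]
  koszul X Y Z := by
    change _ = koszulLinear g F.symm X Y Z
    conv_rhs => rw [← F.left Z]
    simp [leviCivita, koszulLinear, F.symm (f _), mul_comm]

lemma form_frameGradient (φ : A) (Z : L) : g (frameGradient e f φ) Z = ⁅Z, φ⁆ := by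
  conv_rhs => rw [← F.left Z]
  rw [sum_lie]
  simp [frameGradient, F.symm (f _), mul_comm]

lemma frameGradient_eq {κ : Type*} [Fintype κ] [DecidableEq κ] {e' f' : κ → L}
    (F' : IsDualFrames g e' f') (φ : A) : frameGradient e f φ = frameGradient e' f' φ := by
  rw [← F.left (frameGradient e f φ), ← F.left (frameGradient e' f' φ)]
  simp only [F.form_frameGradient, F'.form_frameGradient]

end IsDualFrames

end DualFrames

section WeightedBianchi

variable {A L : Type*} [CommRing A] [LieRing L] [Module A L] [LieRingModule L A]
  [LieRinehartRing A L] [Invertible (2 : A)] {ι : Type*} [Fintype ι]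

namespace IsLeviCivita

variable {g : LinearMap.BilinForm A L} {nab : L → L → L} (h : IsLeviCivita g nab)

/-- The Ricci form `Ric(Y, Z) = tr (X ↦ R(X, Y) Z)`, in a pair of dual frames. -/
def ricci (e f : ι → L) : LinearMap.BilinForm A L :=
  LinearMap.mk₂ A (fun Y Z => frameTrace e f (h.curvatureForm Y Z))
    (fun Y Y' Z => by simp [frameTrace, h.curvature_add_mid, Finset.sum_add_distrib])
    (fun a Y Z => by simp [frameTrace, h.curvature_smul_mid, Finset.mul_sum])
    (fun Y Z Z' => by simp [frameTrace, h.curvature_add_right, Finset.sum_add_distrib])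
    (fun a Y Z => by simp [frameTrace, h.curvature_smul_right, Finset.mul_sum])

lemma ricci_apply (e f : ι → L) (Y Z : L) :
    h.ricci e f Y Z = frameTrace e f (h.curvatureForm Y Z) := rfl

/-- The weighted Ricci form `P = Ric + ∇²φ - lam g`, in a pair of dual frames. -/
def weightedRicci (e f : ι → L) (φ lam : A) : LinearMap.BilinForm A L :=
  h.ricci e f + h.hessian φ - lam • g

lemma weightedRicci_apply (e f : ι → L) (φ lam : A) (X Y : L) :
    h.weightedRicci e f φ lam X Y = h.ricci e f X Y + h.hessian φ X Y - lam * g X Y := by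
  simp [weightedRicci]

lemma covDeriv_weightedRicci (e f : ι → L) (φ lam : A) (hlam : ∀ X : L, ⁅X, lam⁆ = 0)
    (X Y Z : L) : covDeriv nab (h.weightedRicci e f φ lam) X Y Z =
      covDeriv nab (h.ricci e f) X Y Z + covDeriv nab (h.hessian φ) X Y Z := by
  simp only [covDeriv, weightedRicci_apply, lie_sub, lie_add, lie_mul, hlam, h.metric_compat]
  ring

variable [DecidableEq ι] {e f : ι → L} (F : IsDualFrames g e f)
include F

lemma ricci_eq {nab' : L → L → L} (h' : IsLeviCivita g nab') {κ : Type*} [Fintype κ]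
    [DecidableEq κ] {e' f' : κ → L} (F' : IsDualFrames g e' f') :
    h.ricci e f = h'.ricci e' f' := by
  obtain rfl := h.unique h'
  ext Y Z
  exact F.frameTrace_eq F' _

lemma frameTrace_weightedRicci (φ lam : A) :
    frameTrace e f (h.weightedRicci e f φ lam) =
      frameTrace e f (h.ricci e f) + frameTrace e f (h.hessian φ) - lam * Fintype.card ι := by
  rw [← F.frameTrace_form]
  simp only [frameTrace, h.weightedRicci_apply, Finset.sum_sub_distrib, Finset.sum_add_distrib,
    Finset.mul_sum]

lemma ricci_symm (Y Z : L) : h.ricci e f Y Z = h.ricci e f Z Y := by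
  rw [ricci_apply, F.frameTrace_eq F.swap, ricci_apply]
  refine Finset.sum_congr rfl fun a _ => ?_
  simp only [curvatureForm_apply]
  rw [h.form_curvature_pair_symm, h.curvature_antisymm, map_neg, LinearMap.neg_apply,
    h.form_curvature_antisymm, neg_neg]

include h in
lemma sum_form_nab_eq_zero (B : LinearMap.BilinForm A L) (X : L) :
    ∑ a, (B (nab X (e a)) (f a) + B (e a) (nab X (f a))) = 0 := by
  have expand_left (a : ι) :
      B (nab X (e a)) (f a) = ∑ b, g (nab X (e a)) (f b) * B (e b) (f a) := by
    conv_lhs => rw [← F.left (nab X (e a))]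
    simp
  have expand_right (a : ι) :
      B (e a) (nab X (f a)) = ∑ b, g (nab X (f a)) (e b) * B (e a) (f b) := by
    conv_lhs => rw [← F.right (nab X (f a))]
    simp
  -- Differentiating `g(e_b, f_a) = δ_{ab}`.
  have dual_derivative (a b : ι) : g (nab X (e b)) (f a) + g (nab X (f a)) (e b) = 0 := by
    rw [← h.symm (e b), ← h.metric_compat, F.dual]
    split_ifs <;> simp
  simp only [Finset.sum_add_distrib, expand_left, expand_right]
  rw [Finset.sum_comm, ← Finset.sum_add_distrib]
  refine Finset.sum_eq_zero fun a _ => ?_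
  rw [← Finset.sum_add_distrib]
  exact Finset.sum_eq_zero fun b _ => by rw [← add_mul, dual_derivative, zero_mul]

include h in
lemma sum_covDeriv (B : LinearMap.BilinForm A L) (X : L) :
    ∑ a, covDeriv nab B X (e a) (f a) = ⁅X, frameTrace e f B⁆ := by
  have cancel := h.sum_form_nab_eq_zero F B X
  simp only [covDeriv, frameTrace, lie_sum, Finset.sum_sub_distrib, Finset.sum_add_distrib] at *
  linear_combination -cancel

lemma sum_form_covDerivCurvature (X Y Z : L) :
    ∑ a, g (covDerivCurvature nab X (e a) Y Z) (f a) = covDeriv nab (h.ricci e f) X Y Z := by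
  have cancel := h.sum_form_nab_eq_zero F (h.curvatureForm Y Z) X
  have compat (a : ι) : g (nab X (curvature nab (e a) Y Z)) (f a) =
      ⁅X, g (curvature nab (e a) Y Z) (f a)⁆ - g (curvature nab (e a) Y Z) (nab X (f a)) := by
    rw [h.metric_compat]; ring
  simp only [covDerivCurvature, covDeriv, map_sub, LinearMap.sub_apply, compat, ricci_apply,
    frameTrace, lie_sum, Finset.sum_sub_distrib, Finset.sum_add_distrib,
    curvatureForm_apply] at *
  linear_combination -cancel

theorem contracted_bianchi (Z : L) :
    2 * ∑ a, covDeriv nab (h.ricci e f) (e a) Z (f a) = ⁅Z, frameTrace e f (h.ricci e f)⁆ := by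
  have bianchi : ∑ a, ∑ b, (g (covDerivCurvature nab (e a) (e b) Z (f b)) (f a)
      + g (covDerivCurvature nab (e b) Z (e a) (f b)) (f a)
      + g (covDerivCurvature nab Z (e a) (e b) (f b)) (f a)) = 0 :=
    Finset.sum_eq_zero fun a _ => Finset.sum_eq_zero fun b _ => by
      simpa using congrArg (g · (f a)) (h.second_bianchi (e a) (e b) Z (f b))
  simp only [Finset.sum_add_distrib] at bianchi
  have first : ∑ a, ∑ b, g (covDerivCurvature nab (e a) (e b) Z (f b)) (f a) =
      -∑ a, covDeriv nab (h.ricci e f) (e a) Z (f a) := by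
    simp only [← h.sum_form_covDerivCurvature F, ← Finset.sum_neg_distrib]
    exact Finset.sum_congr rfl fun a _ => Finset.sum_congr rfl fun b _ =>
      h.form_covDerivCurvature_antisymm _ _ _ _ _
  have second : ∑ a, ∑ b, g (covDerivCurvature nab (e b) Z (e a) (f b)) (f a) =
      -∑ a, covDeriv nab (h.ricci e f) (e a) Z (f a) := by
    rw [Finset.sum_comm]
    simp only [← h.sum_form_covDerivCurvature F, ← Finset.sum_neg_distrib]
    exact Finset.sum_congr rfl fun a _ => Finset.sum_congr rfl fun b _ => by
      rw [h.covDerivCurvature_antisymm, map_neg, LinearMap.neg_apply]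
  have third : ∑ a, ∑ b, g (covDerivCurvature nab Z (e a) (e b) (f b)) (f a) =
      ⁅Z, frameTrace e f (h.ricci e f)⁆ := by
    rw [Finset.sum_comm, ← h.sum_covDeriv F]
    exact Finset.sum_congr rfl fun b _ => h.sum_form_covDerivCurvature F _ _ _
  rw [first, second, third] at bianchi
  linear_combination -bianchi

lemma weightedRicci_symm (φ lam : A) (X Y : L) :
    h.weightedRicci e f φ lam X Y = h.weightedRicci e f φ lam Y X := by
  rw [weightedRicci_apply, weightedRicci_apply, h.ricci_symm F, h.hessian_symm, h.symm X]

theorem div_hessian (φ : A) (Z : L) :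
    ∑ a, covDeriv nab (h.hessian φ) (e a) Z (f a) =
      ⁅Z, frameTrace e f (h.hessian φ)⁆ + h.ricci e f Z (frameGradient e f φ) := by
  rw [← h.sum_covDeriv F, ricci_apply, frameTrace, ← Finset.sum_add_distrib]
  refine Finset.sum_congr rfl fun a _ => ?_
  rw [curvatureForm_apply, ← h.covDeriv_hessian_sub (F.form_frameGradient φ)]
  ring

theorem weighted_contracted_bianchi (φ lam : A) (hlam : ∀ X : L, ⁅X, lam⁆ = 0) (Z : L) :
    2 * (∑ a, covDeriv nab (h.weightedRicci e f φ lam) (e a) Z (f a)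
      - h.weightedRicci e f φ lam Z (frameGradient e f φ)) =
    ⁅Z, frameTrace e f (h.ricci e f) + 2 * frameTrace e f (h.hessian φ)
      - g (frameGradient e f φ) (frameGradient e f φ) + 2 * (lam * φ)⁆ := by
  have lie_two : ⁅Z, (2 : A)⁆ = 0 := by exact_mod_cast lie_natCast (A := A) Z 2
  simp only [h.covDeriv_weightedRicci e f φ lam hlam, Finset.sum_add_distrib, lie_sub, lie_add,
    lie_mul, hlam, lie_two, ← h.contracted_bianchi F Z, h.div_hessian F, weightedRicci_apply,
    h.metric_compat Z, h.hessian_eq (F.form_frameGradient φ)]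
  rw [h.symm (frameGradient e f φ) (nab Z _), h.symm Z, F.form_frameGradient]
  ring

end IsLeviCivita

end WeightedBianchi

section FrameFormulas

variable {A L : Type*} [CommRing A] [LieRing L] [Module A L] {ι : Type*} [Fintype ι]

/-- The family dual to `e`, where `gi` is the inverse of the Gram matrix of `e`. -/
def dualFamily (e : ι → L) (gi : Matrix ι ι A) (a : ι) : L := ∑ b, gi b a • e b

lemma form_dualFamily (g : LinearMap.BilinForm A L) (e : ι → L) (gi : Matrix ι ι A) (X : L)
    (a : ι) : g X (dualFamily e gi a) = ∑ c, g X (e c) * gi c a := by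
  simp [dualFamily, mul_comm]

section

variable [DecidableEq ι]

lemma IsDualFrames.of_span {g : LinearMap.BilinForm A L} {e f : ι → L}
    (symm : ∀ X Y, g X Y = g Y X) (dual : ∀ a b, g (e a) (f b) = if a = b then 1 else 0)
    (span : ∀ X, X ∈ Submodule.span A (Set.range e)) : IsDualFrames g e f := by
  have left (X : L) : ∑ a, g X (f a) • e a = X := by
    obtain ⟨c, rfl⟩ := (Submodule.mem_span_range_iff_exists_fun A).1 (span X)
    simp [dual]
  refine ⟨symm, left, fun X => ?_, dual⟩
  have same_pairing (Z : L) : g (∑ a, g X (e a) • f a) Z = g X Z := by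
    conv_rhs => rw [← left Z]
    simp [symm (f _), mul_comm]
  rw [← left (∑ a, g X (e a) • f a)]
  simp only [same_pairing, left]

/-- `gi` is the inverse of the Gram matrix of `e`. -/
structure IsGramInv (g : LinearMap.BilinForm A L) (e : ι → L) (gi : Matrix ι ι A) : Prop where
  symm : ∀ a b, gi a b = gi b a
  mul : ∀ a b, ∑ c, g (e a) (e c) * gi c b = if a = b then 1 else 0

namespace IsGramInv

variable {g : LinearMap.BilinForm A L} {e : ι → L} {gi : Matrix ι ι A} (hgi : IsGramInv g e gi)
include hgi

lemma form_dualFamily (a b : ι) : g (e a) (dualFamily e gi b) = if a = b then 1 else 0 := by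
  rw [RicciAmbient.form_dualFamily, hgi.mul]

lemma isDualFrames (symm : ∀ X Y, g X Y = g Y X)
    (span : ∀ X, X ∈ Submodule.span A (Set.range e)) : IsDualFrames g e (dualFamily e gi) :=
  .of_span symm hgi.form_dualFamily span

lemma sum_eq_frameTrace (B : LinearMap.BilinForm A L) :
    ∑ a, ∑ b, gi a b * B (e a) (e b) = frameTrace e (dualFamily e gi) B := by
  refine Finset.sum_congr rfl fun a _ => ?_
  rw [RicciAmbient.form_dualFamily]
  exact Finset.sum_congr rfl fun b _ => by rw [hgi.symm a b, mul_comm]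

end IsGramInv

lemma IsDualFrames.isGramInv {g : LinearMap.BilinForm A L} {e : ι → L} {gi : Matrix ι ι A}
    (F : IsDualFrames g e (dualFamily e gi)) : IsGramInv g e gi where
  symm a b := by
    have form_dual (a b : ι) : g (dualFamily e gi a) (dualFamily e gi b) = gi a b := by
      rw [form_dualFamily]
      simp [F.symm (dualFamily e gi a), F.dual]
    rw [← form_dual, F.symm, form_dual]
  mul a b := by rw [← form_dualFamily, F.dual]

end

variable [LieRingModule L A]

section Components

variable [Invertible (2 : A)] (g : LinearMap.BilinForm A L) (gi : Matrix ι ι A) (e : ι → L)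

/-- The connection coefficients of `g` in the frame `e`. -/
def frameConn (a b d : ι) : A := ∑ c, koszulForm g (e a) (e b) (e c) * gi c d

/-- The structure functions of the frame `e`. -/
def frameStruct (a b d : ι) : A := ∑ c, g ⁅e a, e b⁆ (e c) * gi c d

/-- The components of the curvature of `g` in the frame `e`. -/
def frameRiem (a b c d : ι) : A :=
  ⁅e a, frameConn g gi e b c d⁆ - ⁅e b, frameConn g gi e a c d⁆
    + ∑ k, (frameConn g gi e b c k * frameConn g gi e a k d
      - frameConn g gi e a c k * frameConn g gi e b k d
      - frameStruct g gi e a b k * frameConn g gi e k c d)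

/-- The components of the Ricci form of `g` in the frame `e`. -/
def frameRic (b c : ι) : A := ∑ a, frameRiem g gi e a b c a

/-- The scalar curvature of `g`, computed in the frame `e`. -/
def frameScal : A := ∑ a, ∑ b, gi a b * frameRic g gi e a b

/-- The components of the Hessian of a function in the frame `e`. -/
def frameHess (φ : A) (a b : ι) : A :=
  ⁅e a, ⁅e b, φ⁆⁆ - ∑ c, frameConn g gi e a b c * ⁅e c, φ⁆

/-- The Laplacian of a function, computed in the frame `e`. -/
def frameLap (φ : A) : A := ∑ a, ∑ b, gi a b * frameHess g gi e φ a b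

/-- The squared norm of the gradient of a function, computed in the frame `e`. -/
def frameGradSq (φ : A) : A := ∑ a, ∑ b, gi a b * ⁅e a, φ⁆ * ⁅e b, φ⁆

end Components

variable {g : LinearMap.BilinForm A L} {gi : Matrix ι ι A} {e : ι → L}

lemma IsLeviCivita.frameConn_eq [Invertible (2 : A)] {nab : L → L → L} (h : IsLeviCivita g nab)
    (a b d : ι) : frameConn g gi e a b d = g (nab (e a) (e b)) (dualFamily e gi d) := by
  rw [form_dualFamily]
  simp only [frameConn, h.koszul]

variable [DecidableEq ι]

lemma IsLeviCivita.nab_frame [Invertible (2 : A)] {nab : L → L → L} (h : IsLeviCivita g nab)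
    (F : IsDualFrames g e (dualFamily e gi)) (a b : ι) :
    nab (e a) (e b) = ∑ d, frameConn g gi e a b d • e d := by
  conv_lhs => rw [← F.left (nab (e a) (e b))]
  simp only [h.frameConn_eq]

variable [LieRinehartRing A L]

lemma IsDualFrames.frameGradSq_eq (F : IsDualFrames g e (dualFamily e gi)) (φ : A) :
    frameGradSq gi e φ =
      g (frameGradient e (dualFamily e gi) φ) (frameGradient e (dualFamily e gi) φ) := by
  rw [F.form_frameGradient, frameGradient, sum_lie]
  simp only [LieRinehartRing.lie_smul_eq_mul]
  refine Finset.sum_congr rfl fun a _ => ?_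
  rw [dualFamily, sum_lie, Finset.mul_sum]
  refine Finset.sum_congr rfl fun b _ => ?_
  rw [LieRinehartRing.lie_smul_eq_mul, F.isGramInv.symm a b]; ring

namespace IsLeviCivita

variable [Invertible (2 : A)] {nab : L → L → L} (h : IsLeviCivita g nab)
include h

-- `N a b` is the component of `∇_{e a} (e b)` off the span of `e`; on the ambient space it is a
-- multiple of a parallel field.
lemma frameRiem_eq (hgi : IsGramInv g e gi) (N : ι → ι → L)
    (nab_frame : ∀ a b, nab (e a) (e b) = ∑ d, frameConn g gi e a b d • e d + N a b)
    (form_nab_N : ∀ a b c d, g (nab (e c) (N a b)) (e d) = 0)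
    (lie_frame : ∀ a b, ⁅e a, e b⁆ = ∑ d, frameStruct g gi e a b d • e d) (a b c d : ι) :
    frameRiem g gi e a b c d = g (curvature nab (e a) (e b) (e c)) (dualFamily e gi d) := by
  have form_nab_N_dual (a b c : ι) : g (nab (e c) (N a b)) (dualFamily e gi d) = 0 := by
    rw [form_dualFamily]; simp [form_nab_N]
  have second_derivative (a b c : ι) : g (nab (e a) (nab (e b) (e c))) (dualFamily e gi d) =
      ⁅e a, frameConn g gi e b c d⁆
        + ∑ k, frameConn g gi e b c k * frameConn g gi e a k d := by
    rw [nab_frame b c, h.add_right, h.sum_right]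
    simp only [h.smul_right, map_add, map_sum, map_smul, LinearMap.add_apply, LinearMap.sum_apply,
      LinearMap.smul_apply, hgi.form_dualFamily, form_nab_N_dual, ← h.frameConn_eq, smul_eq_mul,
      Finset.sum_add_distrib, mul_ite, mul_one, mul_zero, Finset.sum_ite_eq', Finset.mem_univ,
      if_true]
    ring
  have bracket_derivative : g (nab ⁅e a, e b⁆ (e c)) (dualFamily e gi d) =
      ∑ k, frameStruct g gi e a b k * frameConn g gi e k c d := by
    rw [lie_frame a b, h.sum_left]
    simp only [h.smul_left, map_sum, map_smul, LinearMap.sum_apply, LinearMap.smul_apply,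
      ← h.frameConn_eq, smul_eq_mul]
  simp only [curvature, map_sub, LinearMap.sub_apply, second_derivative, bracket_derivative,
    frameRiem, Finset.sum_sub_distrib]
  ring

variable (F : IsDualFrames g e (dualFamily e gi))
include F

lemma frameRic_eq (b c : ι) :
    frameRic g gi e b c = h.ricci e (dualFamily e gi) (e b) (e c) := by
  refine Finset.sum_congr rfl fun a _ => ?_
  refine h.frameRiem_eq F.isGramInv (fun _ _ => 0) ?_ ?_ ?_ _ _ _ _
  · intro a b; rw [add_zero, h.nab_frame F]
  · intros; rw [h.zero_right, map_zero, LinearMap.zero_apply]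
  · intro a b
    conv_lhs => rw [← F.left ⁅e a, e b⁆]
    simp only [frameStruct, form_dualFamily]

lemma frameHess_eq (φ : A) (a b : ι) : frameHess g gi e φ a b = h.hessian φ (e a) (e b) := by
  rw [h.hessian_apply, h.nab_frame F, sum_lie]
  simp only [LieRinehartRing.lie_smul_eq_mul, frameHess]

lemma frameScal_eq :
    frameScal g gi e = frameTrace e (dualFamily e gi) (h.ricci e (dualFamily e gi)) := by
  simp only [frameScal, h.frameRic_eq F, F.isGramInv.sum_eq_frameTrace]

lemma frameLap_eq (φ : A) :
    frameLap g gi e φ = frameTrace e (dualFamily e gi) (h.hessian φ) := by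
  simp only [frameLap, h.frameHess_eq F, F.isGramInv.sum_eq_frameTrace]

end IsLeviCivita

end FrameFormulas

section Ambient

variable {A L : Type*} [CommRing A] [LieRing L] [Module A L]

/-- The frame of the ambient space obtained from a spatial frame `e` by adding `T` and `V`. -/
def ambientFrame {ι : Type*} (e : ι → L) (T V : L) : ι ⊕ Fin 2 → L := Sum.elim e ![T, V]

variable {ι : Type*} [Fintype ι]

/-- The frame dual to `ambientFrame e T V` for the ambient metric; `wi` is the inverse of
`1 - lam u` and `ρ` is the weighted scalar curvature. -/
def ambientDualFrame (e : ι → L) (gi : Matrix ι ι A) (T V : L) (ρ wi : A) : ι ⊕ Fin 2 → L :=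
  Sum.elim (dualFamily e gi) ![-wi • V, -wi • T + (wi ^ 2 * ρ) • V]

lemma sum_ambientFrame {M : Type*} [AddCommMonoid M] (e : ι → L) (gi : Matrix ι ι A) (T V : L)
    (ρ wi : A) (s : L → L → M) :
    ∑ i, s (ambientFrame e T V i) (ambientDualFrame e gi T V ρ wi i) =
      ∑ a, s (e a) (dualFamily e gi a)
        + (s T (-wi • V) + s V (-wi • T + (wi ^ 2 * ρ) • V)) := by
  simp [ambientFrame, ambientDualFrame]

variable [DecidableEq ι] [LieRingModule L A] [Invertible (2 : A)]

/-- `g` is the ambient metric of a gradient Ricci flow, in an adapted frame: `e` spans the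
directions of the slices, `T` and `V` stand for `∂_t` and `∂_v`. The potential of the flow is `φ`,
its weighted scalar curvature is `ρ`, and `wi` is the inverse of `1 - lam u`. -/
structure IsAmbient (g : LinearMap.BilinForm A L) (e : ι → L) (gi : Matrix ι ι A) (T V : L)
    (u v φ ρ lam wi : A) : Prop where
  symm : ∀ X Y, g X Y = g Y X
  gram : IsGramInv g e gi
  span : ∀ X, X ∈ Submodule.span A (Set.range (ambientFrame e T V))
  form_e_T : ∀ a, g (e a) T = 0
  form_T_T : g T T = -ρ
  form_V : ∀ Z, g V Z = ⁅Z, u⁆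
  lie_e_u : ∀ a, ⁅e a, u⁆ = 0
  lie_T_u : ⁅T, u⁆ = -(1 - lam * u)
  lie_V_u : ⁅V, u⁆ = 0
  wi_mul : wi * (1 - lam * u) = 1
  lie_lam : ∀ X : L, ⁅X, lam⁆ = 0
  lie_V_e : ∀ a, ⁅V, e a⁆ = 0
  lie_V_T : ⁅V, T⁆ = 0
  lie_V_gram : ∀ a b, ⁅V, g (e a) (e b)⁆ = 0
  lie_V_ρ : ⁅V, ρ⁆ = 0
  lie_V_φ : ⁅V, φ⁆ = 0
  lie_V_v : ⁅V, v⁆ = 1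
  lie_e_v : ∀ a, ⁅e a, v⁆ = 0
  lie_T_v : ⁅T, v⁆ = 0
  form_lie_e_e_T : ∀ a b, g ⁅e a, e b⁆ T = 0
  flow_g : ∀ a b, ⁅T, g (e a) (e b)⁆ - g ⁅T, e a⁆ (e b) - g (e a) ⁅T, e b⁆ =
    -2 * (frameRic g gi e a b + frameHess g gi e φ a b - lam * g (e a) (e b))
  flow_φ : ⁅T, φ⁆ = -(frameScal g gi e + frameLap g gi e φ - Fintype.card ι * lam)
  ρ_eq : ρ = frameScal g gi e + 2 * frameLap g gi e φ - frameGradSq gi e φ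
    + 2 * lam * (φ - Fintype.card ι)

namespace IsAmbient

variable {g : LinearMap.BilinForm A L} {e : ι → L} {gi : Matrix ι ι A} {T V : L}
  {u v φ ρ lam wi : A}

/-- The frame of the ambient space. -/
abbrev frame (_ : IsAmbient g e gi T V u v φ ρ lam wi) : ι ⊕ Fin 2 → L := ambientFrame e T V

/-- The frame of the ambient space dual to `frame`. -/
abbrev dualFrame (_ : IsAmbient g e gi T V u v φ ρ lam wi) : ι ⊕ Fin 2 → L :=
  ambientDualFrame e gi T V ρ wi

/-- The ambient potential. -/
abbrev potential (_ : IsAmbient g e gi T V u v φ ρ lam wi) : A := φ - v + lam * u * v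

variable (H : IsAmbient g e gi T V u v φ ρ lam wi)
include H

lemma form_V_e (a : ι) : g V (e a) = 0 := by rw [H.form_V, H.lie_e_u]

lemma form_V_V : g V V = 0 := by rw [H.form_V, H.lie_V_u]

lemma form_V_T : g V T = -(1 - lam * u) := by rw [H.form_V, H.lie_T_u]

lemma form_V_dual (a : ι) : g V (dualFamily e gi a) = 0 := by
  simp [form_dualFamily, H.form_V_e]

lemma form_T_dual (a : ι) : g T (dualFamily e gi a) = 0 := by
  rw [form_dualFamily]; simp [H.symm T, H.form_e_T]

lemma isDualFrames : IsDualFrames g H.frame H.dualFrame := by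
  have w := H.wi_mul
  have form_e_V (a : ι) : g (e a) V = 0 := by rw [H.symm, H.form_V_e]
  have form_T_V : g T V = -(1 - lam * u) := by rw [H.symm, H.form_V_T]
  refine .of_span H.symm ?_ H.span
  rintro (a | a) (b | b)
  · simp [ambientFrame, ambientDualFrame, H.gram.form_dualFamily]
  · fin_cases b <;> simp [ambientFrame, ambientDualFrame, form_e_V, H.form_e_T]
  · fin_cases a <;> simp [ambientFrame, ambientDualFrame, H.form_V_dual, H.form_T_dual]
  · fin_cases a <;> fin_cases b <;>
      simp [ambientFrame, ambientDualFrame, H.form_V_T, H.form_V_V, form_T_V, H.form_T_T]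
    · linear_combination w
    · linear_combination -wi * ρ * w
    · linear_combination w

lemma expand (X : L) : X = ∑ a, g X (dualFamily e gi a) • e a
    + (-wi * g X V) • T + (-wi * g X T + wi ^ 2 * ρ * g X V) • V := by
  conv_lhs => rw [← H.isDualFrames.left X, sum_ambientFrame _ _ _ _ _ _ fun Y Z => g X Z • Y]
  simp [add_assoc]

lemma lie_dual_u (a : ι) : ⁅dualFamily e gi a, u⁆ = 0 := by
  rw [← H.form_V, H.form_V_dual]

lemma lie_V_frame (i : ι ⊕ Fin 2) : ⁅V, H.frame i⁆ = 0 := by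
  rcases i with a | i
  · exact H.lie_V_e a
  · fin_cases i
    · exact H.lie_V_T
    · exact lie_self V

lemma lie_e_e (a b : ι) : ⁅e a, e b⁆ = ∑ d, frameStruct g gi e a b d • e d := by
  have form_V : g ⁅e a, e b⁆ V = 0 := by
    rw [H.symm, H.form_V, lie_lie, H.lie_e_u, H.lie_e_u, lie_zero, lie_zero, sub_zero]
  conv_lhs => rw [H.expand ⁅e a, e b⁆]
  simp [form_V, H.form_lie_e_e_T, frameStruct, form_dualFamily]

-- The evolution equation of the metric enters here.
lemma form_nab_e_e_T {nab : L → L → L} (h : IsLeviCivita g nab) (a b : ι) :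
    g (nab (e a) (e b)) T =
    frameRic g gi e a b + frameHess g gi e φ a b - lam * g (e a) (e b) := by
  apply (isUnit_of_invertible (2 : A)).mul_left_cancel
  rw [h.koszul, two_mul_koszulForm, H.form_e_T, H.form_e_T, H.form_lie_e_e_T,
    ← lie_skew (e a) T, ← lie_skew (e b) T, map_neg, map_neg, LinearMap.neg_apply,
    LinearMap.neg_apply, H.symm ⁅T, e b⁆, lie_zero, lie_zero]
  linear_combination -H.flow_g a b

end IsAmbient

variable [LieRinehartRing A L]

namespace IsAmbient

variable {g : LinearMap.BilinForm A L} {e : ι → L} {gi : Matrix ι ι A} {T V : L}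
  {u v φ ρ lam wi : A} (H : IsAmbient g e gi T V u v φ ρ lam wi)

section Invariance

include H

lemma lie_V_form_frame (i j : ι ⊕ Fin 2) : ⁅V, g (H.frame i) (H.frame j)⁆ = 0 := by
  have lie_V_lie_V_u : ⁅V, ⁅V, u⁆⁆ = 0 := by rw [H.lie_V_u, lie_zero]
  have lie_V_lie_T_u : ⁅V, ⁅T, u⁆⁆ = 0 := by
    rw [H.lie_T_u, lie_neg, lie_sub, lie_mul, H.lie_lam, H.lie_V_u]; simp
  rcases i with a | i <;> rcases j with b | j
  · exact H.lie_V_gram a b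
  · fin_cases j
    · simp [ambientFrame, H.form_e_T]
    · simp [ambientFrame, H.symm _ V, H.form_V_e]
  · fin_cases i
    · simp [ambientFrame, H.symm T, H.form_e_T]
    · simp [ambientFrame, H.form_V_e]
  · fin_cases i <;> fin_cases j
    · simp [ambientFrame, H.form_T_T, H.lie_V_ρ]
    · simpa [ambientFrame, H.symm T V, H.form_V] using lie_V_lie_T_u
    · simpa [ambientFrame, H.form_V] using lie_V_lie_T_u
    · simpa [ambientFrame, H.form_V] using lie_V_lie_V_u

lemma killing (X Y : L) : ⁅V, g X Y⁆ = g ⁅V, X⁆ Y + g X ⁅V, Y⁆ :=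
  lie_form_of_span H.span
    (fun i j => by simpa [H.lie_V_frame] using H.lie_V_form_frame i j) X Y

lemma lie_potential (X : L) :
    ⁅X, H.potential⁆ = ⁅X, φ⁆ - (1 - lam * u) * ⁅X, v⁆ + lam * v * ⁅X, u⁆ := by
  simp only [lie_add, lie_sub, lie_mul, H.lie_lam]; ring

lemma lie_e_potential (a : ι) : ⁅e a, H.potential⁆ = ⁅e a, φ⁆ := by
  rw [H.lie_potential, H.lie_e_u, H.lie_e_v]; ring

lemma lie_V_potential : ⁅V, H.potential⁆ = -(1 - lam * u) := by
  rw [H.lie_potential, H.lie_V_u, H.lie_V_v, H.lie_V_φ]; ring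

lemma lie_T_potential : ⁅T, H.potential⁆ = ⁅T, φ⁆ - lam * v * (1 - lam * u) := by
  rw [H.lie_potential, H.lie_T_u, H.lie_T_v]; ring

end Invariance

variable {nab : L → L → L} (h : IsLeviCivita g nab)

section Parallel

include H h

-- `V` is a Killing field whose metric dual `du` is closed, so it is parallel.
lemma nab_V (X : L) : nab X V = 0 := by
  refine h.ext _ _ fun Z => (isUnit_of_invertible (2 : A)).mul_left_cancel ?_
  have closed : ⁅⁅X, Z⁆, u⁆ = ⁅X, ⁅Z, u⁆⁆ - ⁅Z, ⁅X, u⁆⁆ := lie_lie _ _ _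
  rw [h.koszul, two_mul_koszulForm, H.symm X V, H.symm ⁅X, Z⁆ V, H.form_V, H.form_V, H.form_V,
    closed, H.killing X Z, ← lie_skew X V, H.symm X]
  simp only [map_neg, map_zero, LinearMap.neg_apply, LinearMap.zero_apply]
  ring

lemma curvature_V_right (X Y : L) : curvature nab X Y V = 0 := by
  simp [curvature, H.nab_V h, h.zero_right]

lemma curvature_V_left (X Y : L) : curvature nab V X Y = 0 :=
  h.ext _ _ fun Z => by rw [h.form_curvature_pair_symm, H.curvature_V_right h]; simp

lemma curvature_V_mid (X Y : L) : curvature nab X V Y = 0 := by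
  rw [h.curvature_antisymm, H.curvature_V_left h, neg_zero]

lemma covDerivCurvature_V (X Y Z : L) : covDerivCurvature nab V X Y Z = 0 := by
  have mid (X Y : L) : covDerivCurvature nab X Y V Z = 0 := by
    simp [covDerivCurvature, H.curvature_V_mid h, H.nab_V h, h.zero_right, h.curvature_zero_mid]
  have left (X Y : L) : covDerivCurvature nab X V Y Z = 0 := by
    rw [h.covDerivCurvature_antisymm, mid, neg_zero]
  simpa [mid, left] using h.second_bianchi V X Y Z

lemma form_nab_V (X Y : L) : g (nab X Y) V = ⁅X, g Y V⁆ := by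
  rw [h.metric_compat, H.nab_V h, map_zero, add_zero]

lemma lie_nab_u (X : L) {Y : L} (hY : ⁅Y, u⁆ = 0) : ⁅nab X Y, u⁆ = 0 := by
  rw [← H.form_V] at hY
  rw [← H.form_V, H.symm, H.form_nab_V h, H.symm, hY, lie_zero]

lemma nab_e_e (a b : ι) : nab (e a) (e b) =
    ∑ d, frameConn g gi e a b d • e d + (-wi * g (nab (e a) (e b)) T) • V := by
  have form_V : g (nab (e a) (e b)) V = 0 := by
    rw [H.form_nab_V h, H.symm, H.form_V_e, lie_zero]
  conv_lhs => rw [H.expand (nab (e a) (e b))]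
  simp [form_V, h.frameConn_eq]

end Parallel

/-- The Ricci form of the ambient metric. -/
abbrev ricci : LinearMap.BilinForm A L := h.ricci H.frame H.dualFrame

/-- The weighted Ricci form of the ambient metric and the ambient potential. -/
abbrev weightedRicci : LinearMap.BilinForm A L :=
  h.weightedRicci H.frame H.dualFrame H.potential lam

lemma ricci_e_e (b c : ι) : H.ricci h (e b) (e c) = frameRic g gi e b c := by
  have riem (a : ι) : g (curvature nab (e a) (e b) (e c)) (dualFamily e gi a) =
      frameRiem g gi e a b c a := .symm <|
    h.frameRiem_eq H.gram (fun a b => (-wi * g (nab (e a) (e b)) T) • V) (H.nab_e_e h)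
      (fun a b c d => by rw [h.smul_right, H.nab_V h]; simp [H.form_V_e]) H.lie_e_e a b c a
  rw [h.ricci_apply, frameTrace, sum_ambientFrame _ _ _ _ _ _ fun X Y => h.curvatureForm _ _ X Y]
  simp [frameRic, riem, H.curvature_V_left h, h.form_curvature_antisymm _ _ _ V,
    H.curvature_V_right h]

lemma ricci_V (X : L) : H.ricci h X V = 0 := by
  simp [h.ricci_apply, frameTrace, H.curvature_V_right h]

lemma hessian_e_e (a b : ι) :
    h.hessian H.potential (e a) (e b) = lam * g (e a) (e b) - frameRic g gi e a b := by
  rw [h.hessian_apply, H.nab_e_e h, add_lie, sum_lie, H.form_nab_e_e_T h]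
  simp only [LieRinehartRing.lie_smul_eq_mul, H.lie_e_potential, H.lie_V_potential]
  unfold frameHess
  linear_combination (-1 : A) * (frameRic g gi e a b + (⁅e a, ⁅e b, φ⁆⁆ -
    ∑ c, frameConn g gi e a b c * ⁅e c, φ⁆) - lam * g (e a) (e b)) * H.wi_mul

lemma hessian_V (X : L) : h.hessian H.potential X V = lam * g X V := by
  rw [h.hessian_apply, H.nab_V h, zero_lie, H.lie_V_potential, H.symm X V, H.form_V]
  simp only [lie_neg, lie_sub, lie_mul, lie_one, H.lie_lam]
  ring

lemma laplacian_potential : frameTrace H.frame H.dualFrame (h.hessian H.potential) =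
    -frameScal g gi e + (Fintype.card ι + 2) * lam := by
  have slice (a : ι) : h.hessian H.potential (e a) (dualFamily e gi a) =
      lam * g (e a) (dualFamily e gi a) - ∑ b, gi a b * frameRic g gi e a b := by
    simp only [form_dualFamily, H.hessian_e_e h, sub_mul, Finset.sum_sub_distrib, Finset.mul_sum,
      H.gram.symm a, mul_assoc, mul_comm (gi _ a)]
  have V_T : h.hessian H.potential V T = lam * g T V := by rw [h.hessian_symm, H.hessian_V h]
  rw [frameTrace, sum_ambientFrame _ _ _ _ _ _ fun X Y => h.hessian H.potential X Y]
  simp only [slice, H.gram.form_dualFamily, map_add, map_smul, smul_eq_mul, V_T, H.hessian_V h,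
    H.form_V_V, H.symm T V, H.form_V_T, Finset.sum_sub_distrib, frameScal, if_true, mul_one,
    Finset.sum_const, Finset.card_univ, nsmul_eq_mul]
  linear_combination 2 * lam * H.wi_mul

lemma weightedScalar_eq_zero : frameTrace H.frame H.dualFrame (h.hessian H.potential)
    - g (frameGradient H.frame H.dualFrame H.potential)
        (frameGradient H.frame H.dualFrame H.potential)
    + 2 * lam * H.potential - (Fintype.card ι + 2) * lam = 0 := by
  have slice (a : ι) : ⁅e a, H.potential⁆ * ⁅dualFamily e gi a, H.potential⁆ =
      ∑ b, gi a b * ⁅e a, φ⁆ * ⁅e b, φ⁆ := by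
    rw [dualFamily, sum_lie, Finset.mul_sum]
    refine Finset.sum_congr rfl fun b _ => ?_
    rw [LieRinehartRing.lie_smul_eq_mul, H.lie_e_potential, H.lie_e_potential, H.gram.symm a b]
    ring
  have gradient_sq : g (frameGradient H.frame H.dualFrame H.potential)
      (frameGradient H.frame H.dualFrame H.potential) = frameGradSq gi e φ
      + 2 * (⁅T, φ⁆ - lam * v * (1 - lam * u)) + ρ := by
    rw [H.isDualFrames.form_frameGradient, frameGradient, sum_lie]
    simp only [LieRinehartRing.lie_smul_eq_mul]
    rw [sum_ambientFrame _ _ _ _ _ _ fun X Y => ⁅X, H.potential⁆ * ⁅Y, H.potential⁆]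
    simp only [slice, LieRinehartRing.lie_smul_eq_mul, add_lie, H.lie_V_potential,
      H.lie_T_potential, frameGradSq]
    have wi_mul_sq : (wi * (1 - lam * u)) ^ 2 = 1 := by rw [H.wi_mul, one_pow]
    linear_combination ρ * wi_mul_sq + 2 * (⁅T, φ⁆ - lam * v * (1 - lam * u)) * H.wi_mul
  rw [H.laplacian_potential h, gradient_sq]
  linear_combination -H.ρ_eq - 2 * H.flow_φ

lemma weightedRicci_V (X : L) : H.weightedRicci h X V = 0 := by
  rw [h.weightedRicci_apply, H.ricci_V h, H.hessian_V h]; ring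

lemma weightedRicci_V_left (X : L) : H.weightedRicci h V X = 0 := by
  rw [h.weightedRicci_symm H.isDualFrames, H.weightedRicci_V h]

lemma weightedRicci_e_e (a b : ι) : H.weightedRicci h (e a) (e b) = 0 := by
  rw [h.weightedRicci_apply, H.ricci_e_e h, H.hessian_e_e h]; ring

lemma weightedRicci_eq_zero_of_lie_u {X Y : L} (hX : ⁅X, u⁆ = 0) (hY : ⁅Y, u⁆ = 0) :
    H.weightedRicci h X Y = 0 := by
  rw [← H.form_V, H.symm] at hX hY
  rw [H.expand X, H.expand Y, hX, hY]
  simp [H.weightedRicci_V h, H.weightedRicci_V_left h, H.weightedRicci_e_e h]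

lemma covDeriv_weightedRicci_V (Y Z : L) : covDeriv nab (H.weightedRicci h) V Y Z = 0 := by
  have swap := h.covDeriv_hessian_sub (H.isDualFrames.form_frameGradient H.potential) V Y Z
  rw [H.curvature_V_left h, map_zero, LinearMap.zero_apply, sub_eq_zero] at swap
  rw [h.covDeriv_weightedRicci _ _ _ _ H.lie_lam, ← h.sum_form_covDerivCurvature H.isDualFrames,
    swap, covDeriv, H.nab_V h, h.hessian_symm _ V Z, h.hessian_symm _ V (nab Y Z), H.hessian_V h,
    H.hessian_V h, lie_mul, H.lie_lam, h.metric_compat, H.nab_V h]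
  simp [H.covDerivCurvature_V h]

lemma covDeriv_weightedRicci_smul_V (a : A) (X Y : L) :
    covDeriv nab (H.weightedRicci h) X Y (a • V) = 0 := by
  simp [covDeriv, H.weightedRicci_V h, h.smul_right, H.nab_V h]

lemma div_weightedRicci (Z : L) :
    ∑ i, covDeriv nab (H.weightedRicci h) (H.frame i) Z (H.dualFrame i) =
      ∑ a, covDeriv nab (H.weightedRicci h) (e a) Z (dualFamily e gi a) := by
  rw [sum_ambientFrame _ _ _ _ _ _ fun X Y => covDeriv nab (H.weightedRicci h) X Z Y,
    H.covDeriv_weightedRicci_V h, H.covDeriv_weightedRicci_smul_V h, add_zero, add_zero]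

lemma frameTrace_weightedRicci : frameTrace H.frame H.dualFrame (H.weightedRicci h) = 0 := by
  rw [frameTrace, sum_ambientFrame _ _ _ _ _ _ fun X Y => H.weightedRicci h X Y]
  simp [H.weightedRicci_V h, H.weightedRicci_V_left h,
    fun a => H.weightedRicci_eq_zero_of_lie_u h (H.lie_e_u a) (H.lie_dual_u a)]

lemma weightedRicci_gradient (Z : L) :
    H.weightedRicci h Z (frameGradient H.frame H.dualFrame H.potential) =
      ∑ a, covDeriv nab (H.weightedRicci h) (e a) Z (dualFamily e gi a) := by
  have trace := h.frameTrace_weightedRicci H.isDualFrames H.potential lam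
  rw [H.frameTrace_weightedRicci h, Fintype.card_sum, Fintype.card_fin, Nat.cast_add] at trace
  have scalar_const : frameTrace H.frame H.dualFrame (H.ricci h)
      + 2 * frameTrace H.frame H.dualFrame (h.hessian H.potential)
      - g (frameGradient H.frame H.dualFrame H.potential)
          (frameGradient H.frame H.dualFrame H.potential)
      + 2 * (lam * H.potential) = ((2 * (Fintype.card ι + 2) : ℕ) : A) * lam := by
    push_cast at trace ⊢
    linear_combination H.weightedScalar_eq_zero h - trace
  have bianchi := h.weighted_contracted_bianchi H.isDualFrames H.potential lam H.lie_lam Z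
  rw [scalar_const, lie_mul, lie_natCast, H.lie_lam, mul_zero, zero_mul, add_zero,
    H.div_weightedRicci h] at bianchi
  refine (isUnit_of_invertible (2 : A)).mul_left_cancel ?_
  linear_combination -bianchi

lemma weightedRicci_T_of_div {Z : L}
    (div : ∑ a, covDeriv nab (H.weightedRicci h) (e a) Z (dualFamily e gi a) = 0)
    (slice : ∀ a, H.weightedRicci h Z (dualFamily e gi a) = 0) : H.weightedRicci h Z T = 0 := by
  have gradient := (H.weightedRicci_gradient h Z).trans div
  rw [frameGradient, map_sum] at gradient
  simp only [map_smul] at gradient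
  rw [sum_ambientFrame _ _ _ _ _ _ fun X Y => ⁅X, H.potential⁆ • H.weightedRicci h Z Y] at gradient
  simp only [map_add, map_smul, smul_eq_mul, slice, H.weightedRicci_V h, H.lie_V_potential,
    mul_zero, Finset.sum_const_zero] at gradient
  linear_combination gradient - H.weightedRicci h Z T * H.wi_mul

lemma weightedRicci_T_eq_zero_of_lie_u {Z : L} (hZ : ⁅Z, u⁆ = 0) : H.weightedRicci h Z T = 0 := by
  have tangent {X Y : L} := H.weightedRicci_eq_zero_of_lie_u h (X := X) (Y := Y)
  have hdual := H.lie_dual_u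
  refine H.weightedRicci_T_of_div h (Finset.sum_eq_zero fun a _ => ?_) fun a => tangent hZ (hdual a)
  rw [covDeriv, tangent hZ (hdual a), tangent (H.lie_nab_u h _ hZ) (hdual a),
    tangent hZ (H.lie_nab_u h _ (hdual a)), lie_zero, sub_zero, sub_zero]

lemma weightedRicci_eq_zero_of_lie_u_right (X : L) {Z : L} (hZ : ⁅Z, u⁆ = 0) :
    H.weightedRicci h X Z = 0 := by
  have T_Z : H.weightedRicci h T Z = 0 := by
    rw [h.weightedRicci_symm H.isDualFrames, H.weightedRicci_T_eq_zero_of_lie_u h hZ]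
  rw [H.expand X]
  simp [H.weightedRicci_V_left h, H.weightedRicci_eq_zero_of_lie_u h (H.lie_e_u _) hZ, T_Z]

lemma weightedRicci_T_T : H.weightedRicci h T T = 0 := by
  have tangent (X : L) {Z : L} := H.weightedRicci_eq_zero_of_lie_u_right h X (Z := Z)
  have hdual := H.lie_dual_u
  refine H.weightedRicci_T_of_div h (Finset.sum_eq_zero fun a _ => ?_) fun a => tangent T (hdual a)
  rw [covDeriv, tangent _ (hdual a), tangent _ (hdual a), tangent _ (H.lie_nab_u h _ (hdual a)),
    lie_zero, sub_zero, sub_zero]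

theorem weightedRicci_eq_zero : H.weightedRicci h = 0 := by
  have e_right (X : L) (a : ι) := H.weightedRicci_eq_zero_of_lie_u_right h X (H.lie_e_u a)
  have e_left (a : ι) := H.weightedRicci_T_eq_zero_of_lie_u h (H.lie_e_u a)
  have T_right (X : L) : H.weightedRicci h X T = 0 := by
    rw [H.expand X]
    simp [e_left, H.weightedRicci_T_T h, H.weightedRicci_V_left h]
  ext X Y
  rw [H.expand Y]
  simp [H.weightedRicci_V h, e_right, T_right]

end IsAmbient

end Ambient

section Fields

variable {E : Type*} [NormedAddCommGroup E] [NormedSpace ℝ E]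
  {H : Type*} [TopologicalSpace H] {I : ModelWithCorners ℝ E H}
  {N : Type*} [TopologicalSpace N] [ChartedSpace H N]

lemma mdiffAt_of_contMDiffOn {f : N → ℝ} {U : Set N} (hU : IsOpen U)
    (hf : ContMDiffOn I 𝓘(ℝ, ℝ) ∞ f U) {x : N} (hx : x ∈ U) :
    MDifferentiableAt I 𝓘(ℝ, ℝ) f x :=
  ((hf x hx).contMDiffAt (hU.mem_nhds hx)).mdifferentiableAt (by simp)

lemma along_congr {X X' : VField I N} {f f' : N → ℝ} {x : N} (hX : X x = X' x)
    (hf : f =ᶠ[𝓝 x] f') : along I X f x = along I X' f' x := by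
  have hdf : mfderiv I 𝓘(ℝ, ℝ) f x = mfderiv I 𝓘(ℝ, ℝ) f' x := hf.mfderiv_eq
  unfold along mvfderiv
  rw [hX, hdf]
  rfl

variable [IsManifold I ∞ N]

lemma SmoothFieldOn.mono {X : VField I N} {U W : Set N} (hX : SmoothFieldOn I X U) (h : W ⊆ U) :
    SmoothFieldOn I X W :=
  ContMDiffOn.mono hX h

lemma IsFrameOn.mono {ι : Type*} {D : (x : N) → Submodule ℝ (TangentSpace I x)}
    {e : ι → VField I N} {U W : Set N} (he : IsFrameOn I D e U) (hW : IsOpen W) (hWU : W ⊆ U) :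
    IsFrameOn I D e W :=
  ⟨hW, fun a => (he.smooth a).mono hWU, fun x hx => he.linearIndependent x (hWU hx),
    fun x hx => he.span_eq x (hWU hx)⟩

lemma IsFrameOn.mem {ι : Type*} {D : (x : N) → Submodule ℝ (TangentSpace I x)}
    {e : ι → VField I N} {U : Set N} (he : IsFrameOn I D e U) (a : ι) {x : N} (hx : x ∈ U) :
    e a x ∈ D x := by
  rw [← he.span_eq x hx]; exact Submodule.subset_span ⟨a, rfl⟩

lemma SmoothFieldOn.mdiffAt {X : VField I N} {U : Set N} (hU : IsOpen U)
    (hX : SmoothFieldOn I X U) {x : N} (hx : x ∈ U) :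
    MDifferentiableAt I I.tangent (fun x => (⟨x, X x⟩ : TangentBundle I N)) x :=
  ((hX x hx).contMDiffAt (hU.mem_nhds hx)).mdifferentiableAt (by simp)

lemma SmoothFieldOn.along {X : VField I N} {U : Set N} (hU : IsOpen U)
    (hX : SmoothFieldOn I X U) {f : N → ℝ} (hf : ContMDiffOn I 𝓘(ℝ, ℝ) ∞ f U) :
    ContMDiffOn I 𝓘(ℝ, ℝ) ∞ (along I X f) U := by
  have hdf := hf.contMDiffOn_tangentMapWithin (m := ∞) (by simp) hU.uniqueMDiffOn
  have hdfX := (contMDiff_snd_tangentBundle_modelSpace (n := ∞) ℝ 𝓘(ℝ, ℝ)).comp_contMDiffOn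
    (hdf.comp hX fun x hx => hx)
  refine hdfX.congr fun x hx => ?_
  simp only [Function.comp, tangentMapWithin, RicciAmbient.along, mvfderiv]
  rw [mfderivWithin_of_isOpen hU hx]
  rfl

lemma SmoothFieldOn.lieBracket [CompleteSpace E] {X Y : VField I N} {U : Set N} (hU : IsOpen U)
    (hX : SmoothFieldOn I X U) (hY : SmoothFieldOn I Y U) :
    SmoothFieldOn I (mlieBracket I X Y) U := by
  intro x hx
  have hX' : ContMDiffAt I I.tangent ((⊤ : ℕ∞) : ℕ∞ω) (fun x => (⟨x, X x⟩ : TangentBundle I N)) x :=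
    (hX x hx).contMDiffAt (hU.mem_nhds hx)
  have hY' : ContMDiffAt I I.tangent ((⊤ : ℕ∞) : ℕ∞ω) (fun x => (⟨x, Y x⟩ : TangentBundle I N)) x :=
    (hY x hx).contMDiffAt (hU.mem_nhds hx)
  have : IsManifold I (minSmoothness ℝ 2) N := by
    rw [minSmoothness_of_isRCLikeNormedField]; infer_instance
  have : IsManifold I (((⊤ : ℕ∞) : ℕ∞ω) + 1) N := by simpa
  exact (ContMDiffAt.mlieBracket_vectorField (m := ⊤) hX' hY' (by simp)).contMDiffWithinAt

lemma SmoothFieldOn.add {X Y : VField I N} {U : Set N} (hX : SmoothFieldOn I X U)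
    (hY : SmoothFieldOn I Y U) : SmoothFieldOn I (X + Y) U :=
  ContMDiffOn.add_section hX hY

lemma SmoothFieldOn.smul {f : N → ℝ} {X : VField I N} {U : Set N}
    (hf : ContMDiffOn I 𝓘(ℝ, ℝ) ∞ f U) (hX : SmoothFieldOn I X U) :
    SmoothFieldOn I (f • X) U :=
  ContMDiffOn.smul_section hf hX

lemma smoothFieldOn_zero (U : Set N) : SmoothFieldOn I (0 : VField I N) U :=
  (Bundle.contMDiff_zeroSection ℝ (TangentSpace I : N → Type _)).contMDiffOn

lemma exists_smoothFieldOn (x : N) (w : TangentSpace I x) :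
    ∃ (X : VField I N) (U : Set N), IsOpen U ∧ x ∈ U ∧ SmoothFieldOn I X U ∧ X x = w := by
  obtain ⟨s, hs, h⟩ := FiberBundle.exists_contMDiffOn_extend (k := ∞) I E w
  obtain ⟨U, hUs, hU, hx⟩ := mem_nhds_iff.1 hs
  exact ⟨FiberBundle.extend E w, U, hU, hx, h.mono hUs, FiberBundle.extend_apply_self E w⟩

lemma mlieBracket_jacobi [CompleteSpace E] {X Y Z : VField I N} {U : Set N} (hU : IsOpen U)
    (hX : SmoothFieldOn I X U) (hY : SmoothFieldOn I Y U) (hZ : SmoothFieldOn I Z U) {x : N}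
    (hx : x ∈ U) : mlieBracket I X (mlieBracket I Y Z) x =
      mlieBracket I (mlieBracket I X Y) Z x + mlieBracket I Y (mlieBracket I X Z) x := by
  have : IsManifold I (minSmoothness ℝ 3) N := by
    rw [minSmoothness_of_isRCLikeNormedField]; infer_instance
  have contMDiffAt {X : VField I N} (hX : SmoothFieldOn I X U) :
      ContMDiffAt I I.tangent (minSmoothness ℝ 2) (fun x => (⟨x, X x⟩ : TangentBundle I N)) x :=
    ((hX x hx).contMDiffAt (hU.mem_nhds hx)).of_le (by
      rw [minSmoothness_of_isRCLikeNormedField]; exact ENat.LEInfty.out)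
  exact leibniz_identity_mlieBracket_apply (contMDiffAt hX) (contMDiffAt hY) (contMDiffAt hZ)

lemma mlieBracket_smul [CompleteSpace E] {X Y : VField I N} {f : N → ℝ} {U : Set N} (hU : IsOpen U)
    (hY : SmoothFieldOn I Y U)
    (hf : ContMDiffOn I 𝓘(ℝ, ℝ) ∞ f U) {x : N} (hx : x ∈ U) :
    mlieBracket I X (f • Y) x = along I X f x • Y x + f x • mlieBracket I X Y x := by
  have : IsManifold I 2 N := inferInstance
  exact mlieBracket_smul_right (mdiffAt_of_contMDiffOn hU hf hx) (hY.mdiffAt hU hx)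

lemma mlieBracket_mlieBracket_smul [CompleteSpace E] {X Y Z : VField I N} {f : N → ℝ} {U : Set N}
    (hU : IsOpen U) (hY : SmoothFieldOn I Y U)
    (hZ : SmoothFieldOn I Z U) (hf : ContMDiffOn I 𝓘(ℝ, ℝ) ∞ f U) {x : N} (hx : x ∈ U) :
    mlieBracket I X (mlieBracket I Y (f • Z)) x =
      along I X (along I Y f) x • Z x + along I Y f x • mlieBracket I X Z x
      + (along I X f x • mlieBracket I Y Z x + f x • mlieBracket I X (mlieBracket I Y Z) x) := by
  have leibniz : mlieBracket I Y (f • Z) =ᶠ[𝓝 x]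
      ((along I Y f) • Z + f • mlieBracket I Y Z : VField I N) := by
    filter_upwards [hU.mem_nhds hx] with y hy
    exact mlieBracket_smul hU hZ hf hy
  have hYf := hY.along hU hf
  have hYZ := hY.lieBracket hU hZ
  rw [Filter.EventuallyEq.mlieBracket_vectorField_eq (Filter.EventuallyEq.refl _ X) leibniz,
    mlieBracket_add_right ((SmoothFieldOn.smul hYf hZ).mdiffAt hU hx)
      ((SmoothFieldOn.smul hf hYZ).mdiffAt hU hx),
    mlieBracket_smul hU hZ hYf hx, mlieBracket_smul hU hYZ hf hx]

-- The identity is read off the coefficient of `Z` in the Jacobi identity for `X`, `Y`, `f • Z`.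
lemma along_lieBracket [CompleteSpace E] {X Y : VField I N} {f : N → ℝ} {U : Set N}
    (hU : IsOpen U) (hX : SmoothFieldOn I X U) (hY : SmoothFieldOn I Y U)
    (hf : ContMDiffOn I 𝓘(ℝ, ℝ) ∞ f U) {x : N} (hx : x ∈ U) :
    along I (mlieBracket I X Y) f x = along I X (along I Y f) x - along I Y (along I X f) x := by
  by_cases htrivial : ∀ w : TangentSpace I x, w = 0
  · simp [along, htrivial]
  push Not at htrivial
  obtain ⟨w, hw⟩ := htrivial
  obtain ⟨Z, W, hW, hxW, hZ, hZx⟩ := exists_smoothFieldOn x w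
  have hUW := hU.inter hW
  have hxUW : x ∈ U ∩ W := ⟨hx, hxW⟩
  replace hX := hX.mono (W := U ∩ W) Set.inter_subset_left
  replace hY := hY.mono (W := U ∩ W) Set.inter_subset_left
  replace hZ := hZ.mono (W := U ∩ W) Set.inter_subset_right
  replace hf := hf.mono (t := U ∩ W) Set.inter_subset_left
  have jacobi_fZ := mlieBracket_jacobi hUW hX hY (SmoothFieldOn.smul hf hZ) hxUW
  rw [mlieBracket_mlieBracket_smul hUW hY hZ hf hxUW,
    mlieBracket_mlieBracket_smul hUW hX hZ hf hxUW, mlieBracket_smul hUW hZ hf hxUW,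
    mlieBracket_jacobi hUW hX hY hZ hxUW] at jacobi_fZ
  refine smul_left_injective ℝ (hZx ▸ hw : Z x ≠ 0) ?_
  change along I (mlieBracket I X Y) f x • Z x =
    (along I X (along I Y f) x - along I Y (along I X f) x) • Z x
  rw [← sub_eq_zero] at jacobi_fZ ⊢
  rw [← neg_eq_zero, ← jacobi_fZ]
  simp only [smul_add, sub_smul]
  abel

end Fields

section Sections

variable {E : Type*} [NormedAddCommGroup E] [NormedSpace ℝ E]
  {H : Type*} [TopologicalSpace H] {I : ModelWithCorners ℝ E H}
  {N : Type*} [TopologicalSpace N] [ChartedSpace H N]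

variable (I) in
/-- The algebra of functions on the open set `U` that extend to functions on `N` smooth on `U`. -/
def SmoothFun (U : TopologicalSpace.Opens N) : Subalgebra ℝ (U → ℝ) where
  carrier := {f | ∃ F : N → ℝ, ContMDiffOn I 𝓘(ℝ, ℝ) ∞ F U ∧ ∀ x : U, f x = F x}
  mul_mem' := by
    rintro f g ⟨F, hF, hf⟩ ⟨G, hG, hg⟩
    exact ⟨F * G, hF.mul hG, fun x => by simp [hf, hg]⟩
  add_mem' := by
    rintro f g ⟨F, hF, hf⟩ ⟨G, hG, hg⟩
    exact ⟨F + G, hF.add hG, fun x => by simp [hf, hg]⟩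
  algebraMap_mem' r := ⟨fun _ => r, contMDiffOn_const, fun _ => rfl⟩

variable {U : TopologicalSpace.Opens N}

/-- A choice of function on the whole manifold restricting to `f`, to which the pointwise notions of
the manifold library apply. -/
def extendFun (f : SmoothFun I U) : N → ℝ := f.2.choose

lemma extendFun_smooth (f : SmoothFun I U) : ContMDiffOn I 𝓘(ℝ, ℝ) ∞ (extendFun f) U :=
  f.2.choose_spec.1

lemma extendFun_apply (f : SmoothFun I U) (x : U) : extendFun f x = f.1 x :=
  (f.2.choose_spec.2 x).symm

namespace SmoothFun

/-- The restriction to `U` of a function that is smooth on `U`. -/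
def mk (F : N → ℝ) (hF : ContMDiffOn I 𝓘(ℝ, ℝ) ∞ F U) : SmoothFun I U :=
  ⟨fun x => F x, F, hF, fun _ => rfl⟩

@[ext] lemma ext' {f f' : SmoothFun I U} (h : ∀ x : U, f.1 x = f'.1 x) : f = f' :=
  Subtype.ext (funext h)

@[simp] lemma mk_apply (F : N → ℝ) (hF : ContMDiffOn I 𝓘(ℝ, ℝ) ∞ F U) (x : U) :
    (mk F hF).1 x = F x := rfl

@[simp] lemma add_apply (f f' : SmoothFun I U) (x : U) : (f + f').1 x = f.1 x + f'.1 x := rfl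

@[simp] lemma mul_apply (f f' : SmoothFun I U) (x : U) : (f * f').1 x = f.1 x * f'.1 x := rfl

instance : Invertible (2 : SmoothFun I U) where
  invOf := algebraMap ℝ _ (1 / 2)
  invOf_mul_self := by
    rw [← map_ofNat (algebraMap ℝ (SmoothFun I U)) 2, ← map_mul]; norm_num
  mul_invOf_self := by
    rw [← map_ofNat (algebraMap ℝ (SmoothFun I U)) 2, ← map_mul]; norm_num

end SmoothFun

variable [IsManifold I ∞ N]

variable (I N) in
/-- An involutive distribution: a family of subspaces of the tangent spaces whose smooth local
sections are closed under the Lie bracket. Neither smoothness nor constant rank is assumed. -/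
structure InvolutiveDist where
  dist : (x : N) → Submodule ℝ (TangentSpace I x)
  lie_mem : ∀ (U : Set N) (X Y : VField I N), IsOpen U → SmoothFieldOn I X U →
    SmoothFieldOn I Y U → (∀ x ∈ U, X x ∈ dist x) → (∀ x ∈ U, Y x ∈ dist x) →
    ∀ x ∈ U, mlieBracket I X Y x ∈ dist x

/-- The module of smooth sections of a distribution over an open set. -/
def SmoothSec (D : InvolutiveDist I N) (U : TopologicalSpace.Opens N) :
    Submodule (SmoothFun I U) ((x : U) → TangentSpace I (x : N)) where
  carrier := {X | ∃ X' : VField I N, SmoothFieldOn I X' U ∧ (∀ x ∈ U, X' x ∈ D.dist x) ∧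
    ∀ x : U, X x = X' x}
  zero_mem' := ⟨0, smoothFieldOn_zero _, fun x _ => (D.dist x).zero_mem, fun _ => rfl⟩
  add_mem' := by
    rintro X Y ⟨X', hX', hX, hXX⟩ ⟨Y', hY', hY, hYY⟩
    exact ⟨X' + Y', hX'.add hY', fun x hx => (D.dist x).add_mem (hX x hx) (hY x hx),
      fun x => by simp [hXX, hYY]⟩
  smul_mem' := by
    rintro ⟨f, F, hF, hf⟩ X ⟨X', hX', hX, hXX⟩
    refine ⟨F • X', SmoothFieldOn.smul hF hX', fun x hx => (D.dist x).smul_mem _ (hX x hx),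
      fun x => ?_⟩
    change f x • X x = F x • X' x
    rw [hf, hXX]

variable {D : InvolutiveDist I N}

/-- A choice of vector field on the whole manifold restricting to `X`. -/
def extendSec (X : SmoothSec D U) : VField I N := X.2.choose

lemma extendSec_smooth (X : SmoothSec D U) : SmoothFieldOn I (extendSec X) U := X.2.choose_spec.1

lemma extendSec_mem (X : SmoothSec D U) : ∀ x ∈ U, extendSec X x ∈ D.dist x := X.2.choose_spec.2.1

lemma extendSec_apply (X : SmoothSec D U) (x : U) : extendSec X x = X.1 x :=
  (X.2.choose_spec.2.2 x).symm

namespace SmoothSec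

/-- The restriction to `U` of a vector field that is smooth on `U`. -/
def mk (X : VField I N) (hX : SmoothFieldOn I X U) (hD : ∀ x ∈ U, X x ∈ D.dist x) :
    SmoothSec D U := ⟨fun x => X x, X, hX, hD, fun _ => rfl⟩

lemma apply_mem (X : SmoothSec D U) (x : U) : X.1 x ∈ D.dist x :=
  extendSec_apply X x ▸ extendSec_mem X x x.2

@[ext] lemma ext' {X Y : SmoothSec D U} (h : ∀ x : U, X.1 x = Y.1 x) : X = Y :=
  Subtype.ext (funext h)

@[simp] lemma mk_apply (X : VField I N) (hX : SmoothFieldOn I X U) (hD : ∀ x ∈ U, X x ∈ D.dist x)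
    (x : U) : (mk X hX hD : SmoothSec D U).1 x = X x := rfl

@[simp] lemma add_apply (X Y : SmoothSec D U) (x : U) : (X + Y).1 x = X.1 x + Y.1 x := rfl

@[simp] lemma smul_apply (f : SmoothFun I U) (X : SmoothSec D U) (x : U) :
    (f • X).1 x = f.1 x • X.1 x := rfl

lemma sum_apply {κ : Type*} (s : Finset κ) (X : κ → SmoothSec D U) (x : U) :
    (∑ i ∈ s, X i).1 x = ∑ i ∈ s, (X i).1 x := by
  rw [Submodule.coe_sum, Finset.sum_apply]

instance : Bracket (SmoothSec D U) (SmoothFun I U) where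
  bracket X f := SmoothFun.mk (along I (extendSec X) (extendFun f))
    ((extendSec_smooth X).along U.2 (extendFun_smooth f))

lemma lie_fun_apply {X : SmoothSec D U} {f : SmoothFun I U} {X' : VField I N} {f' : N → ℝ}
    {x : U} (hX : X.1 x = X' x) (hf : ∀ y : U, f.1 y = f' y) :
    (⁅X, f⁆ : SmoothFun I U).1 x = along I X' f' x := by
  refine along_congr (by rw [extendSec_apply, hX]) ?_
  filter_upwards [U.2.mem_nhds x.2] with y hy
  rw [extendFun_apply f ⟨y, hy⟩, hf]

variable [CompleteSpace E]

instance : Bracket (SmoothSec D U) (SmoothSec D U) where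
  bracket X Y := SmoothSec.mk (mlieBracket I (extendSec X) (extendSec Y))
    ((extendSec_smooth X).lieBracket U.2 (extendSec_smooth Y))
    (D.lie_mem U _ _ U.2 (extendSec_smooth X) (extendSec_smooth Y) (extendSec_mem X)
      (extendSec_mem Y))

lemma lie_apply {X Y : SmoothSec D U} {X' Y' : VField I N} (hX : ∀ x : U, X.1 x = X' x)
    (hY : ∀ x : U, Y.1 x = Y' x) (x : U) :
    (⁅X, Y⁆ : SmoothSec D U).1 x = mlieBracket I X' Y' x := by
  refine Filter.EventuallyEq.mlieBracket_vectorField_eq ?_ ?_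
  · filter_upwards [U.2.mem_nhds x.2] with y hy
    rw [extendSec_apply X ⟨y, hy⟩, hX]
  · filter_upwards [U.2.mem_nhds x.2] with y hy
    rw [extendSec_apply Y ⟨y, hy⟩, hY]

lemma lie_add_apply (X Y Z : SmoothSec D U) : ⁅X, Y + Z⁆ = ⁅X, Y⁆ + ⁅X, Z⁆ := by
  have : IsManifold I 2 N := inferInstance
  ext x
  rw [lie_apply (fun y => (extendSec_apply X y).symm) (Y' := extendSec Y + extendSec Z)
    (fun y => by simp [extendSec_apply]),
    mlieBracket_add_right ((extendSec_smooth Y).mdiffAt U.2 x.2)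
      ((extendSec_smooth Z).mdiffAt U.2 x.2)]
  rfl

lemma lie_swap (X Y : SmoothSec D U) : ⁅X, Y⁆ = -⁅Y, X⁆ := by
  ext x
  exact mlieBracket_swap_apply

instance : LieRing (SmoothSec D U) where
  add_lie X Y Z := by
    rw [lie_swap, lie_add_apply, lie_swap X, lie_swap Y]; abel
  lie_add := lie_add_apply
  lie_self X := by
    ext x
    change mlieBracket I (extendSec X) (extendSec X) x = 0
    simp
  leibniz_lie X Y Z := by
    ext x
    rw [lie_apply (X' := extendSec X) (Y' := mlieBracket I (extendSec Y) (extendSec Z))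
      (fun y => (extendSec_apply X y).symm) (fun y => rfl), add_apply,
      lie_apply (X' := mlieBracket I (extendSec X) (extendSec Y)) (Y' := extendSec Z) (fun y => rfl)
      (fun y => (extendSec_apply Z y).symm),
      lie_apply (X' := extendSec Y) (Y' := mlieBracket I (extendSec X) (extendSec Z))
      (fun y => (extendSec_apply Y y).symm) (fun y => rfl)]
    exact mlieBracket_jacobi U.2 (extendSec_smooth X) (extendSec_smooth Y) (extendSec_smooth Z) x.2

instance : LieRingModule (SmoothSec D U) (SmoothFun I U) where
  add_lie X Y f := by
    ext x
    rw [lie_fun_apply (X' := extendSec X + extendSec Y) (f' := extendFun f)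
      (by simp [extendSec_apply])
      (fun y => (extendFun_apply f y).symm)]
    simp only [along, Pi.add_apply, map_add]
    rfl
  lie_add X f f' := by
    ext x
    rw [lie_fun_apply (X' := extendSec X) (f' := extendFun f + extendFun f')
      (extendSec_apply X x).symm
      (fun y => by simp [extendFun_apply])]
    have hadd := mvfderiv_add (mdiffAt_of_contMDiffOn U.2 (extendFun_smooth f) x.2)
      (mdiffAt_of_contMDiffOn U.2 (extendFun_smooth f') x.2)
    simp only [along, hadd]
    rfl
  leibniz_lie X Y f := by
    ext x
    have lie_lie (X Y : SmoothSec D U) : (⁅X, ⁅Y, f⁆⁆ : SmoothFun I U).1 x =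
        along I (extendSec X) (along I (extendSec Y) (extendFun f)) x :=
      lie_fun_apply (extendSec_apply X x).symm fun y => rfl
    have bracket_lie : (⁅⁅X, Y⁆, f⁆ : SmoothFun I U).1 x =
        along I (mlieBracket I (extendSec X) (extendSec Y)) (extendFun f) x :=
      lie_fun_apply rfl fun y => (extendFun_apply f y).symm
    rw [SmoothFun.add_apply, lie_lie, lie_lie, bracket_lie,
      along_lieBracket U.2 (extendSec_smooth X) (extendSec_smooth Y) (extendFun_smooth f) x.2]
    ring

instance : LieRinehartRing (SmoothFun I U) (SmoothSec D U) where
  lie_smul_eq_mul' f f' X := by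
    ext x
    rw [lie_fun_apply (X' := extendFun f • extendSec X) (f' := extendFun f')
      (by simp [extendSec_apply, extendFun_apply]) (fun y => (extendFun_apply f' y).symm)]
    simp only [along, Pi.smul_apply', map_smul, extendFun_apply]
    rfl
  leibniz_mul_right' X f f' := by
    ext x
    rw [lie_fun_apply (X' := extendSec X) (f' := extendFun f * extendFun f')
      (extendSec_apply X x).symm
      (fun y => by simp [extendFun_apply])]
    have hmul := mvfderiv_mul (mdiffAt_of_contMDiffOn U.2 (extendFun_smooth f) x.2)
      (mdiffAt_of_contMDiffOn U.2 (extendFun_smooth f') x.2)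
    have hf' : (⁅X, f'⁆ : SmoothFun I U).1 x = along I (extendSec X) (extendFun f') x := rfl
    have hf : (⁅X, f⁆ : SmoothFun I U).1 x = along I (extendSec X) (extendFun f) x := rfl
    rw [SmoothFun.add_apply, smul_eq_mul, SmoothFun.mul_apply, SmoothFun.mul_apply, hf', hf]
    simp [along, hmul, extendFun_apply, mul_comm]
  leibniz_smul_right' X Y f := by
    ext x
    rw [lie_apply (X' := extendSec X) (Y' := extendFun f • extendSec Y)
      (fun y => (extendSec_apply X y).symm)
      (fun y => by simp [extendSec_apply, extendFun_apply]),
      mlieBracket_smul U.2 (extendSec_smooth Y) (extendFun_smooth f) x.2, add_comm, extendFun_apply,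
      extendSec_apply]
    rfl

end SmoothSec

/-- The bilinear form on the sections of `D` over `U` defined by a smooth field of forms. -/
def secForm (g : FormField I N) (hg : SmoothForm I g) (D : InvolutiveDist I N)
    (U : TopologicalSpace.Opens N) : LinearMap.BilinForm (SmoothFun I U) (SmoothSec D U) :=
  LinearMap.mk₂ (SmoothFun I U)
    (fun X Y => SmoothFun.mk (fun x => g x (extendSec X x) (extendSec Y x))
      (hg U (extendSec X) (extendSec Y) U.2 (extendSec_smooth X) (extendSec_smooth Y)))
    (fun X X' Y => by
      ext x
      simp [extendSec_apply])
    (fun a X Y => by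
      ext x
      simp [extendSec_apply])
    (fun X X' Y => by
      ext x
      simp [extendSec_apply])
    (fun a X Y => by
      ext x
      simp [extendSec_apply])

lemma secForm_apply (g : FormField I N) (hg : SmoothForm I g) (X Y : SmoothSec D U) (x : U) :
    (secForm g hg D U X Y).1 x = g x (X.1 x) (Y.1 x) := by
  rw [← extendSec_apply, ← extendSec_apply]; rfl

end Sections

section Evaluation

variable {E : Type*} [NormedAddCommGroup E] [NormedSpace ℝ E]
  {H : Type*} [TopologicalSpace H] {I : ModelWithCorners ℝ E H}
  {N : Type*} [TopologicalSpace N] [ChartedSpace H N]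
  {U : TopologicalSpace.Opens N}

/-- Evaluation of smooth functions at a point, through which identities in the Lie-Rinehart algebra
of sections become pointwise identities. -/
def ev (x : U) : SmoothFun I U →+* ℝ :=
  (Pi.evalRingHom (fun _ : U => ℝ) x).comp (SmoothFun I U).val.toRingHom

lemma ev_apply (x : U) (f : SmoothFun I U) : ev x f = f.1 x := rfl

@[simp] lemma ev_mk (F : N → ℝ) (hF : ContMDiffOn I 𝓘(ℝ, ℝ) ∞ F U) (x : U) :
    ev x (SmoothFun.mk F hF) = F x := rfl

lemma ext_ev {f f' : SmoothFun I U} (h : ∀ x : U, ev x f = ev x f') : f = f' :=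
  SmoothFun.ext' h

@[simp] lemma ev_invOf_two (x : U) : ev x (⅟(2 : SmoothFun I U)) = 1 / 2 := rfl

lemma contMDiffOn_of_ev (f : SmoothFun I U) {F : N → ℝ} (h : ∀ x : U, ev x f = F x) :
    ContMDiffOn I 𝓘(ℝ, ℝ) ∞ F U :=
  (extendFun_smooth f).congr fun x hx => by rw [← h ⟨x, hx⟩, ev_apply, ← extendFun_apply]

lemma isUnit_of_ev_ne_zero {f : SmoothFun I U} (h : ∀ x : U, ev x f ≠ 0) : IsUnit f := by
  have extendFun_ne_zero : ∀ x ∈ U, extendFun f x ≠ 0 := fun x hx => by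
    rw [extendFun_apply f ⟨x, hx⟩]; exact h ⟨x, hx⟩
  refine IsUnit.of_mul_eq_one (SmoothFun.mk (fun x => (extendFun f x)⁻¹)
    ((extendFun_smooth f).inv₀ extendFun_ne_zero)) (ext_ev fun x => ?_)
  rw [map_mul, map_one, ev_mk, extendFun_apply]
  exact mul_inv_cancel₀ (h x)

variable [IsManifold I ∞ N] {D : InvolutiveDist I N}

lemma ev_lie {X : SmoothSec D U} {X' : VField I N} {f : SmoothFun I U} {F : N → ℝ} {x : U}
    (hX : X.1 x = X' x) (hF : ∀ y : U, ev y f = F y) : ev x ⁅X, f⁆ = along I X' F x :=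
  SmoothSec.lie_fun_apply hX hF

variable {g : FormField I N} {hg : SmoothForm I g}

lemma ev_koszulForm [CompleteSpace E] {X Y Z : SmoothSec D U} {X' Y' Z' : VField I N}
    (hX : ∀ x : U, X.1 x = X' x) (hY : ∀ x : U, Y.1 x = Y' x) (hZ : ∀ x : U, Z.1 x = Z' x) (x : U) :
    ev x (koszulForm (secForm g hg D U) X Y Z) = koszul I g X' Y' Z' x := by
  have ev_secForm {X Y : SmoothSec D U} {X' Y' : VField I N} (hX : ∀ x : U, X.1 x = X' x)
      (hY : ∀ x : U, Y.1 x = Y' x) (y : U) :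
      ev y (secForm g hg D U X Y) = g y (X' y) (Y' y) := by
    rw [ev_apply, secForm_apply, hX, hY]
  simp only [koszulForm, koszul, map_mul, map_sub, map_add, ev_invOf_two]
  rw [ev_lie (F := fun y => g y (Y' y) (Z' y)) (hX x) (ev_secForm hY hZ),
    ev_lie (F := fun y => g y (X' y) (Z' y)) (hY x) (ev_secForm hX hZ),
    ev_lie (F := fun y => g y (X' y) (Y' y)) (hZ x) (ev_secForm hX hY)]
  simp only [ev_apply, secForm_apply, SmoothSec.lie_apply hX hY, SmoothSec.lie_apply hX hZ,
    SmoothSec.lie_apply hY hZ, hX, hY, hZ]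

/-- The sections defined by a local frame. -/
def IsFrameOn.sec {ι : Type*} {e : ι → VField I N} (he : IsFrameOn I D.dist e U) (a : ι) :
    SmoothSec D U :=
  SmoothSec.mk (e a) (he.smooth a) fun _ hx => he.mem a hx

lemma IsFrameOn.sec_apply {ι : Type*} {e : ι → VField I N} (he : IsFrameOn I D.dist e U) (a : ι)
    (x : U) : (he.sec a).1 x = e a x := rfl

variable {ι : Type*} [Fintype ι] [DecidableEq ι]

section Family

variable {e : ι → VField I N} {s : ι → SmoothSec D U} (hs : ∀ a, ∀ x : U, (s a).1 x = e a x)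
  {gi : Matrix ι ι (SmoothFun I U)} (hgi : ∀ (x : U) a b, ev x (gi a b) = gramInv I g e x a b)
include hs hgi

variable [CompleteSpace E]

lemma ev_frameConn (x : U) (a b d : ι) :
    ev x (frameConn (secForm g hg D U) gi s a b d) = connCoeff I g e a b d x := by
  simp only [frameConn, connCoeff, map_sum, map_mul, hgi, ev_koszulForm (hs _) (hs _) (hs _)]

lemma ev_frameStruct (x : U) (a b d : ι) :
    ev x (frameStruct (secForm g hg D U) gi s a b d) = structFun I g e a b d x := by
  simp only [frameStruct, structFun, map_sum, map_mul, hgi]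
  simp only [ev_apply, secForm_apply, SmoothSec.lie_apply (hs _) (hs _), hs]

lemma ev_frameRiem (x : U) (a b c d : ι) :
    ev x (frameRiem (secForm g hg D U) gi s a b c d) = riem I g e a b c d x := by
  simp only [frameRiem, riem, map_sum, map_mul, map_sub, map_add, ev_frameConn hs hgi,
    ev_frameStruct hs hgi]
  rw [ev_lie (hs a x) (ev_frameConn hs hgi · b c d), ev_lie (hs b x) (ev_frameConn hs hgi · a c d)]

lemma ev_frameRic (x : U) (b c : ι) :
    ev x (frameRic (secForm g hg D U) gi s b c) = ric I g e b c x := by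
  simp only [frameRic, ric, map_sum, ev_frameRiem hs hgi]

lemma ev_frameScal (x : U) : ev x (frameScal (secForm g hg D U) gi s) = scal I g e x := by
  simp only [frameScal, scal, map_sum, map_mul, hgi, ev_frameRic hs hgi]

variable {φ : SmoothFun I U} {Φ : N → ℝ} (hφ : ∀ x : U, ev x φ = Φ x)
include hφ

lemma ev_frameHess (x : U) (a b : ι) :
    ev x (frameHess (secForm g hg D U) gi s φ a b) = hess I g e Φ a b x := by
  simp only [frameHess, hess, map_sum, map_mul, map_sub, ev_frameConn hs hgi]
  rw [ev_lie (hs a x) (fun y => ev_lie (hs b y) hφ)]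
  simp only [ev_lie (hs _ x) hφ]

lemma ev_frameLap (x : U) : ev x (frameLap (secForm g hg D U) gi s φ) = lap I g e Φ x := by
  simp only [frameLap, lap, map_sum, map_mul, hgi, ev_frameHess hs hgi hφ]

lemma ev_frameGradSq (x : U) : ev x (frameGradSq gi s φ) = gradSq I g e Φ x := by
  simp only [frameGradSq, gradSq, map_sum, map_mul, hgi, ev_lie (hs _ x) hφ]

end Family

variable [CompleteSpace E]

variable (hg) in
lemma exists_isGramInv {e : ι → VField I N} {s : ι → SmoothSec D U}
    (hs : ∀ a, ∀ x : U, (s a).1 x = e a x) (symm : ∀ x X Y, g x X Y = g x Y X)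
    (hdet : ∀ x ∈ U, (gram I g e x).det ≠ 0) :
    ∃ gi : Matrix ι ι (SmoothFun I U), IsGramInv (secForm g hg D U) s gi ∧
      ∀ (x : U) a b, ev x (gi a b) = gramInv I g e x a b := by
  let G : Matrix ι ι (SmoothFun I U) := Matrix.of fun a b => secForm g hg D U (s a) (s b)
  have ev_G (x : U) : (ev x).mapMatrix G = gram I g e x := by
    ext a b
    simp [G, gram, ev_apply, secForm_apply, hs]
  have transpose_G : G.transpose = G := by
    ext a b x
    simp only [G, Matrix.transpose_apply, Matrix.of_apply, secForm_apply, symm]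
  have isUnit_det : IsUnit G.det := isUnit_of_ev_ne_zero fun x => by
    rw [RingHom.map_det, ev_G]; exact hdet x x.2
  have G_mul_inv : G * G⁻¹ = 1 := Matrix.mul_nonsing_inv G isUnit_det
  refine ⟨G⁻¹, ⟨fun a b => ?_, fun a b => ?_⟩, fun x a b => ?_⟩
  · have transpose_inv : G⁻¹.transpose = G⁻¹ := by rw [Matrix.transpose_nonsing_inv, transpose_G]
    exact congrFun₂ transpose_inv b a
  · rw [← Matrix.one_apply, ← G_mul_inv]
    rfl
  · have gram_mul_inv : gram I g e x * (ev x).mapMatrix G⁻¹ = 1 := by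
      rw [← ev_G, ← map_mul, G_mul_inv, map_one]
    rw [gramInv, Matrix.inv_eq_right_inv gram_mul_inv]
    rfl

lemma IsFrameOn.mem_span_sec {e : ι → VField I N} (he : IsFrameOn I D.dist e U)
    {gi : Matrix ι ι (SmoothFun I U)} (h : IsGramInv (secForm g hg D U) he.sec gi)
    (X : SmoothSec D U) : X ∈ Submodule.span (SmoothFun I U) (Set.range he.sec) := by
  rw [Submodule.mem_span_range_iff_exists_fun]
  refine ⟨fun d => ∑ c, secForm g hg D U X (he.sec c) * gi c d, SmoothSec.ext' fun x => ?_⟩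
  have mem_span : X.1 x ∈ Submodule.span ℝ (Set.range fun a => e a x) := by
    rw [he.span_eq x x.2]; exact SmoothSec.apply_mem X x
  obtain ⟨c, hc⟩ := (Submodule.mem_span_range_iff_exists_fun ℝ).1 mem_span
  have gram_mul (a d : ι) :
      ∑ k, g x (e a x) (e k x) * ev x (gi k d) = if a = d then 1 else 0 := by
    simpa [ev_apply, secForm_apply, IsFrameOn.sec_apply, apply_ite (ev x)]
      using congrArg (ev x) (h.mul a d)
  have coeff (d : ι) : ev x (∑ k, secForm g hg D U X (he.sec k) * gi k d) = c d := by
    simp only [map_sum, map_mul]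
    simp only [ev_apply, secForm_apply, IsFrameOn.sec_apply, ← hc]
    simp only [← ev_apply, map_sum, map_smul, LinearMap.sum_apply, LinearMap.smul_apply,
      Finset.sum_mul, smul_eq_mul, mul_assoc]
    rw [Finset.sum_comm]
    simp only [← Finset.mul_sum, gram_mul]
    simp
  rw [SmoothSec.sum_apply, ← hc]
  refine Finset.sum_congr rfl fun d _ => ?_
  rw [SmoothSec.smul_apply, ← ev_apply, coeff, IsFrameOn.sec_apply]

lemma IsFrameOn.isDualFrames {e : ι → VField I N} (he : IsFrameOn I D.dist e U)
    (symm : ∀ x X Y, g x X Y = g x Y X)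
    {gi : Matrix ι ι (SmoothFun I U)} (h : IsGramInv (secForm g hg D U) he.sec gi) :
    IsDualFrames (secForm g hg D U) he.sec (dualFamily he.sec gi) :=
  h.isDualFrames (fun X Y => ext_ev fun x => by
    rw [ev_apply, ev_apply, secForm_apply, secForm_apply, symm]) (he.mem_span_sec h)

section WeightedGeometry

variable (symm : ∀ x X Y, g x X Y = g x Y X) {e : ι → VField I N}
  (he : IsFrameOn I D.dist e U) (hdet : ∀ x ∈ U, (gram I g e x).det ≠ 0)
  {Φ : N → ℝ} {φ : SmoothFun I U} (hφ : ∀ x : U, ev x φ = Φ x) (lam : ℝ)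
  {κ : Type*} [Fintype κ] [DecidableEq κ] {s f : κ → SmoothSec D U}
  (F : IsDualFrames (secForm g hg D U) s f)
include symm hdet hφ

theorem wP_eq_ev (x : U) (a b : ι) :
    wP I g e Φ lam a b x =
      ev x (F.isLeviCivita.weightedRicci s f φ (algebraMap ℝ _ lam) (he.sec a) (he.sec b)) := by
  obtain ⟨gi, hgi, hev⟩ := exists_isGramInv hg he.sec_apply symm hdet
  have F' := he.isDualFrames symm hgi
  rw [IsLeviCivita.weightedRicci_apply, F.isLeviCivita.ricci_eq F F'.isLeviCivita F',
    F.isLeviCivita.hessian_eq_hessian F'.isLeviCivita, ← F'.isLeviCivita.frameRic_eq F',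
    ← F'.isLeviCivita.frameHess_eq F', map_sub, map_add, map_mul,
    ev_frameRic he.sec_apply hev, ev_frameHess he.sec_apply hev hφ]
  simp only [wP, ev_apply x (secForm _ _ _ _ _ _), secForm_apply]
  rfl

include he

theorem wF_eq_ev (x : U) :
    wF I g e Φ lam x =
      ev x (frameTrace s f (F.isLeviCivita.hessian φ)
        - secForm g hg D U (frameGradient s f φ) (frameGradient s f φ)
        + 2 * algebraMap ℝ _ lam * φ - (Fintype.card ι : SmoothFun I U) * algebraMap ℝ _ lam) := by
  obtain ⟨gi, hgi, hev⟩ := exists_isGramInv hg he.sec_apply symm hdet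
  have F' := he.isDualFrames symm hgi
  rw [F.frameTrace_eq F', F.isLeviCivita.hessian_eq_hessian F'.isLeviCivita, F.frameGradient_eq F',
    ← F'.isLeviCivita.frameLap_eq F', ← F'.frameGradSq_eq]
  simp only [map_add, map_sub, map_mul, ev_frameLap he.sec_apply hev hφ,
    ev_frameGradSq he.sec_apply hev hφ, map_natCast, map_ofNat, hφ]
  rfl

theorem wR_eq_ev (x : U) :
    wR I g e Φ lam x =
      ev x (frameTrace s f (F.isLeviCivita.ricci s f)
        + 2 * frameTrace s f (F.isLeviCivita.hessian φ)
        - secForm g hg D U (frameGradient s f φ) (frameGradient s f φ)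
        + 2 * algebraMap ℝ _ lam * (φ - (Fintype.card ι : SmoothFun I U))) := by
  obtain ⟨gi, hgi, hev⟩ := exists_isGramInv hg he.sec_apply symm hdet
  have F' := he.isDualFrames symm hgi
  rw [F.isLeviCivita.ricci_eq F F'.isLeviCivita F', F.frameTrace_eq F', F.frameTrace_eq F',
    F.isLeviCivita.hessian_eq_hessian F'.isLeviCivita, F.frameGradient_eq F',
    ← F'.isLeviCivita.frameScal_eq F', ← F'.isLeviCivita.frameLap_eq F', ← F'.frameGradSq_eq]
  simp only [map_add, map_sub, map_mul, ev_frameScal he.sec_apply hev,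
    ev_frameLap he.sec_apply hev hφ, ev_frameGradSq he.sec_apply hev hφ, map_natCast,
    map_ofNat, hφ]
  rfl

end WeightedGeometry

variable (hg) in
lemma IsFrameOn.exists_isDualFrames {e : ι → VField I N} (he : IsFrameOn I D.dist e U)
    (symm : ∀ x X Y, g x X Y = g x Y X) (hdet : ∀ x ∈ U, (gram I g e x).det ≠ 0) :
    ∃ s f : ι → SmoothSec D U, IsDualFrames (secForm g hg D U) s f :=
  let ⟨_, hgi, _⟩ := exists_isGramInv hg he.sec_apply symm hdet
  ⟨_, _, he.isDualFrames symm hgi⟩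

theorem wR_eq_wR (hg : SmoothForm I g) (symm : ∀ x X Y, g x X Y = g x Y X)
    {e e' : ι → VField I N} (he : IsFrameOn I D.dist e U) (he' : IsFrameOn I D.dist e' U)
    (hdet : ∀ x ∈ U, (gram I g e x).det ≠ 0) (hdet' : ∀ x ∈ U, (gram I g e' x).det ≠ 0)
    {Φ : N → ℝ} (hΦ : ContMDiffOn I 𝓘(ℝ, ℝ) ∞ Φ U) (lam : ℝ) {x : N} (hx : x ∈ U) :
    wR I g e Φ lam x = wR I g e' Φ lam x := by
  obtain ⟨s, f, F⟩ := he.exists_isDualFrames hg symm hdet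
  have hφ : ∀ y : U, ev y (SmoothFun.mk Φ hΦ) = Φ y := fun _ => rfl
  exact (wR_eq_ev symm he hdet hφ lam F ⟨x, hx⟩).trans
    (wR_eq_ev symm he' hdet' hφ lam F ⟨x, hx⟩).symm

theorem contMDiffOn_wR (hg : SmoothForm I g) (symm : ∀ x X Y, g x X Y = g x Y X)
    {e : ι → VField I N} (he : IsFrameOn I D.dist e U) (hdet : ∀ x ∈ U, (gram I g e x).det ≠ 0)
    {Φ : N → ℝ} (hΦ : ContMDiffOn I 𝓘(ℝ, ℝ) ∞ Φ U) (lam : ℝ) :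
    ContMDiffOn I 𝓘(ℝ, ℝ) ∞ (wR I g e Φ lam) U := by
  obtain ⟨s, f, F⟩ := he.exists_isDualFrames hg symm hdet
  exact contMDiffOn_of_ev _ fun x =>
    (wR_eq_ev symm he hdet (φ := SmoothFun.mk Φ hΦ) (fun _ => rfl) lam F x).symm

end Evaluation

section Gram

variable {E : Type*} [NormedAddCommGroup E] [NormedSpace ℝ E]
  {H : Type*} [TopologicalSpace H] {I : ModelWithCorners ℝ E H}
  {N : Type*} [TopologicalSpace N] [ChartedSpace H N] {ι : Type*} [Fintype ι] [DecidableEq ι]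

lemma linearIndependent_of_det_gram_ne_zero {g : FormField I N} {e : ι → VField I N} {x : N}
    (h : (gram I g e x).det ≠ 0) : LinearIndependent ℝ (fun a => e a x) := by
  rw [Fintype.linearIndependent_iff]
  intro c hc
  refine congrFun (Matrix.eq_zero_of_vecMul_eq_zero h ?_)
  ext b
  simpa [Matrix.vecMul, dotProduct, gram] using congrArg (fun X => g x X (e b x)) hc

lemma det_gram_ne_zero {g : FormField I N} {e : ι → VField I N} {x : N}
    (symm : ∀ X Y, g x X Y = g x Y X) (hli : LinearIndependent ℝ (fun a => e a x))
    (hnd : ∀ X ∈ Submodule.span ℝ (Set.range fun a => e a x),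
      (∀ a, g x X (e a x) = 0) → X = 0) : (gram I g e x).det ≠ 0 := by
  intro h
  obtain ⟨v, hv, hv0⟩ := Matrix.exists_mulVec_eq_zero_iff.2 h
  refine hv (funext (Fintype.linearIndependent_iff.1 hli v ?_))
  refine hnd _ (Submodule.sum_mem _ fun a _ =>
    Submodule.smul_mem _ _ (Submodule.subset_span ⟨a, rfl⟩)) fun a => ?_
  have gram_mulVec : ∑ b, g x (e a x) (e b x) * v b = 0 := congrFun hv0 a
  simp only [map_sum, map_smul, LinearMap.sum_apply, LinearMap.smul_apply, smul_eq_mul]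
  rw [← gram_mulVec]
  exact Finset.sum_congr rfl fun b _ => by rw [symm, mul_comm]

end Gram

section Spacetime

lemma SmoothForm.continuousOn_det_gram {E : Type*} [NormedAddCommGroup E] [NormedSpace ℝ E]
    {H : Type*} [TopologicalSpace H] {I : ModelWithCorners ℝ E H} {N : Type*} [TopologicalSpace N]
    [ChartedSpace H N] [IsManifold I ∞ N] {ι : Type*} [Fintype ι] [DecidableEq ι]
    {g : FormField I N} (hg : SmoothForm I g) {e : ι → VField I N} {U : Set N} (hU : IsOpen U)
    (he : ∀ a, SmoothFieldOn I (e a) U) : ContinuousOn (fun x => (gram I g e x).det) U := by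
  have continuousOn_gram : ContinuousOn (gram I g e) U :=
    continuousOn_pi.2 fun a => continuousOn_pi.2 fun b =>
      (hg U (e a) (e b) hU (he a) (he b)).continuousOn
  exact continuous_id.matrix_det.comp_continuousOn continuousOn_gram

namespace GradientRicciFlowSpacetime

variable {n : ℕ} {M : Type*} [TopologicalSpace M] [ChartedSpace (EuclideanHalfSpace (n + 1)) M]
  [IsManifold (𝓡∂ (n + 1)) ∞ M] {lam : ℝ} (S : GradientRicciFlowSpacetime n M lam)

lemma mvfderiv_time_dt (x : M) : mvfderiv (𝓡∂ (n + 1)) S.time x (S.dt x) = 1 := S.dt_time x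

lemma mem_spatial {x : M} {X : TangentSpace (𝓡∂ (n + 1)) x} :
    X ∈ spatial S.time x ↔ mvfderiv (𝓡∂ (n + 1)) S.time x X = 0 := Iff.rfl

lemma finrank_spatial (x : M) : Module.finrank ℝ (spatial (n := n) S.time x) = n := by
  let dtime := (mvfderiv (𝓡∂ (n + 1)) S.time x).toLinearMap
  have finrank_tangent : Module.finrank ℝ (TangentSpace (𝓡∂ (n + 1)) x) = n + 1 :=
    finrank_euclideanSpace_fin (𝕜 := ℝ)
  have : FiniteDimensional ℝ (TangentSpace (𝓡∂ (n + 1)) x) :=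
    inferInstanceAs (FiniteDimensional ℝ (EuclideanSpace ℝ (Fin (n + 1))))
  have range_dtime : LinearMap.range dtime = ⊤ :=
    LinearMap.range_eq_top.2 fun r => ⟨r • S.dt x, by simp [dtime, S.mvfderiv_time_dt]⟩
  have rank_nullity := dtime.finrank_range_add_finrank_ker
  rw [range_dtime, finrank_top, finrank_tangent, Module.finrank_self] at rank_nullity
  exact Nat.add_left_cancel (rank_nullity.trans (add_comm n 1))

lemma det_gram_spatial_ne_zero {e : Fin n → VField (𝓡∂ (n + 1)) M} {x : M}
    (linearIndependent : LinearIndependent ℝ fun a => e a x) (he : ∀ a, e a x ∈ spatial S.time x) :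
    (gram (𝓡∂ (n + 1)) S.g e x).det ≠ 0 := by
  refine det_gram_ne_zero (S.g_symm x) linearIndependent fun X X_mem_span X_orthogonal => ?_
  by_contra X_ne_zero
  have X_mem_spatial : X ∈ spatial S.time x :=
    Submodule.span_le.2 (Set.range_subset_iff.2 he) X_mem_span
  refine (S.g_pos x X X_mem_spatial X_ne_zero).ne' ?_
  obtain ⟨c, hc⟩ := (Submodule.mem_span_range_iff_exists_fun ℝ).1 X_mem_span
  calc S.g x X X = S.g x X (∑ a, c a • e a x) := by rw [hc]
    _ = 0 := by simp [X_orthogonal]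

lemma det_gram_frame_ne_zero {e : Fin n → VField (𝓡∂ (n + 1)) M} {U : Set M}
    (he : IsFrameOn (𝓡∂ (n + 1)) (spatial S.time) e U) {x : M} (hx : x ∈ U) :
    (gram (𝓡∂ (n + 1)) S.g e x).det ≠ 0 :=
  S.det_gram_spatial_ne_zero (he.linearIndependent x hx) fun a => he.mem a hx

lemma exists_isFrameOn_of_linearIndependent {e : Fin n → VField (𝓡∂ (n + 1)) M} {U : Set M}
    (hU : IsOpen U) (he : ∀ a, SmoothFieldOn (𝓡∂ (n + 1)) (e a) U)
    (mem_spatial : ∀ a y, e a y ∈ spatial S.time y) {x : M} (hx : x ∈ U)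
    (linearIndependent : LinearIndependent ℝ fun a => e a x) :
    ∃ V, IsFrameOn (𝓡∂ (n + 1)) (spatial S.time) e V ∧ x ∈ V := by
  let detGram (y : M) : ℝ := (gram (𝓡∂ (n + 1)) S.g e y).det
  have continuousOn_detGram : ContinuousOn detGram U := S.g_smooth.continuousOn_det_gram hU he
  refine ⟨U ∩ detGram ⁻¹' {0}ᶜ,
    ⟨continuousOn_detGram.isOpen_inter_preimage hU isOpen_compl_singleton,
      fun a => (he a).mono Set.inter_subset_left,
      fun y hy => linearIndependent_of_det_gram_ne_zero hy.2, fun y hy => ?_⟩,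
    hx, S.det_gram_spatial_ne_zero linearIndependent fun a => mem_spatial a x⟩
  have : FiniteDimensional ℝ (TangentSpace (𝓡∂ (n + 1)) y) :=
    inferInstanceAs (FiniteDimensional ℝ (EuclideanSpace ℝ (Fin (n + 1))))
  refine Submodule.eq_of_le_of_finrank_eq
    (Submodule.span_le.2 (Set.range_subset_iff.2 fun a => mem_spatial a y)) ?_
  rw [finrank_span_eq_card (linearIndependent_of_det_gram_ne_zero hy.2), S.finrank_spatial,
    Fintype.card_fin]

/-- The projection of a vector field to the spatial distribution along `∂_t`. -/
def spatialPart (X : VField (𝓡∂ (n + 1)) M) : VField (𝓡∂ (n + 1)) M :=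
  X + (fun y => -along (𝓡∂ (n + 1)) X S.time y) • S.dt

lemma spatialPart_mem (X : VField (𝓡∂ (n + 1)) M) (x : M) :
    S.spatialPart X x ∈ spatial S.time x := by
  rw [S.mem_spatial]
  simp [spatialPart, along, S.mvfderiv_time_dt]

lemma spatialPart_apply {X : VField (𝓡∂ (n + 1)) M} {x : M} (hX : X x ∈ spatial S.time x) :
    S.spatialPart X x = X x := by
  have along_time : along (𝓡∂ (n + 1)) X S.time x = 0 := hX
  simp [spatialPart, along_time]

lemma spatialPart_smooth {X : VField (𝓡∂ (n + 1)) M} {U : Set M} (hU : IsOpen U)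
    (hX : SmoothFieldOn (𝓡∂ (n + 1)) X U) : SmoothFieldOn (𝓡∂ (n + 1)) (S.spatialPart X) U :=
  hX.add (SmoothFieldOn.smul (hX.along hU S.time_smooth.contMDiffOn).neg
    (S.dt_smooth.mono (Set.subset_univ _)))

theorem exists_isFrameOn (x : M) : ∃ (e : Fin n → VField (𝓡∂ (n + 1)) M) (U : Set M),
    IsFrameOn (𝓡∂ (n + 1)) (spatial S.time) e U ∧ x ∈ U := by
  have : FiniteDimensional ℝ (TangentSpace (𝓡∂ (n + 1)) x) :=
    inferInstanceAs (FiniteDimensional ℝ (EuclideanSpace ℝ (Fin (n + 1))))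
  let b := Module.finBasisOfFinrankEq ℝ (spatial (n := n) S.time x) (S.finrank_spatial x)
  choose X O hO hxO hX hXx using fun a =>
    exists_smoothFieldOn (I := 𝓡∂ (n + 1)) x (b a : TangentSpace (𝓡∂ (n + 1)) x)
  let U : Set M := ⋂ a, O a
  have hU : IsOpen U := isOpen_iInter_of_finite hO
  have spatialPart_x (a : Fin n) : S.spatialPart (X a) x = b a := by
    rw [S.spatialPart_apply (by rw [hXx]; exact (b a).2), hXx]
  have linearIndependent : LinearIndependent ℝ fun a => S.spatialPart (X a) x := by
    simp only [spatialPart_x]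
    exact b.linearIndependent.map' (Submodule.subtype _) (Submodule.ker_subtype _)
  exact ⟨fun a => S.spatialPart (X a), S.exists_isFrameOn_of_linearIndependent hU
    (fun a => S.spatialPart_smooth hU ((hX a).mono (Set.iInter_subset _ a)))
    (fun a => S.spatialPart_mem (X a)) (Set.mem_iInter.2 hxO) linearIndependent⟩

/-- The spatial distribution `ker dt`, whose leaves are the time slices. -/
def spatialDist : InvolutiveDist (𝓡∂ (n + 1)) M where
  dist := spatial S.time
  lie_mem U X Y hU hX hY hXD hYD x hx := by
    have along_along_time {X Y : VField (𝓡∂ (n + 1)) M} (hY : ∀ x ∈ U, Y x ∈ spatial S.time x) :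
        along (𝓡∂ (n + 1)) X (along (𝓡∂ (n + 1)) Y S.time) x = 0 := by
      rw [along_congr (f' := fun _ => 0) rfl]
      · simp [along, mvfderiv_const]
      · exact Filter.eventually_of_mem (hU.mem_nhds hx) hY
    have along_bracket := along_lieBracket hU hX hY S.time_smooth.contMDiffOn hx
    rwa [along_along_time hYD, along_along_time hXD, sub_zero] at along_bracket

lemma weightedScal_eq {e : Fin n → VField (𝓡∂ (n + 1)) M} {U : Set M}
    (he : IsFrameOn (𝓡∂ (n + 1)) (spatial S.time) e U) {x : M} (hx : x ∈ U) :
    S.weightedScal x = wR (𝓡∂ (n + 1)) S.g e S.φ lam x := by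
  have exists_frame : ∃ (e : Fin n → VField (𝓡∂ (n + 1)) M) (U : Set M),
      IsFrameOn (𝓡∂ (n + 1)) (spatial S.time) e U ∧ x ∈ U := ⟨e, U, he, hx⟩
  rw [weightedScal, dif_pos exists_frame]
  obtain ⟨U', he', hx'⟩ := exists_frame.choose_spec
  have isOpen_inter := he'.isOpen.inter he.isOpen
  exact wR_eq_wR (D := S.spatialDist) (U := ⟨U' ∩ U, isOpen_inter⟩) S.g_smooth S.g_symm
    (he'.mono isOpen_inter Set.inter_subset_left) (he.mono isOpen_inter Set.inter_subset_right)
    (fun y hy => S.det_gram_frame_ne_zero he' hy.1) (fun y hy => S.det_gram_frame_ne_zero he hy.2)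
    S.φ_smooth.contMDiffOn lam ⟨hx', hx⟩

lemma weightedScal_smooth : ContMDiff (𝓡∂ (n + 1)) 𝓘(ℝ, ℝ) ∞ S.weightedScal := by
  intro x
  obtain ⟨e, U, he, hx⟩ := S.exists_isFrameOn x
  have contMDiffOn_weightedScal : ContMDiffOn (𝓡∂ (n + 1)) 𝓘(ℝ, ℝ) ∞ S.weightedScal U :=
    (contMDiffOn_wR (D := S.spatialDist) (U := ⟨U, he.isOpen⟩) S.g_smooth S.g_symm he
      (fun y hy => S.det_gram_frame_ne_zero he hy) S.φ_smooth.contMDiffOn lam).congr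
      fun y hy => S.weightedScal_eq he hy
  exact contMDiffOn_weightedScal.contMDiffAt (he.isOpen.mem_nhds hx)

end GradientRicciFlowSpacetime

end Spacetime

section CoordinateFrame

variable {E : Type*} [NormedAddCommGroup E] [NormedSpace ℝ E]
  {H : Type*} [TopologicalSpace H] {I : ModelWithCorners ℝ E H}
  {N : Type*} [TopologicalSpace N] [ChartedSpace H N] [IsManifold I ∞ N]

variable (I) in
/-- A local frame whose dual coframe consists of the exact differentials `dξ i`. -/
structure IsCoordinateFrameOn {ι : Type*} [Fintype ι]
    (s : ι → VField I N) (ξ : ι → N → ℝ) (O : Set N) : Prop where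
  isOpen : IsOpen O
  smooth_field : ∀ i, SmoothFieldOn I (s i) O
  smooth_coord : ∀ i, ContMDiffOn I 𝓘(ℝ, ℝ) ∞ (ξ i) O
  eq_sum : ∀ y ∈ O, ∀ w : TangentSpace I y, w = ∑ i, mvfderiv I (ξ i) y w • s i y

lemma mvfderiv_comp_extChartAt (ℓ : E →L[ℝ] ℝ) (x : N) {y : N} (hy : y ∈ (chartAt H x).source)
    (w : TangentSpace I y) :
    mvfderiv I (ℓ ∘ extChartAt I x) y w =
      ℓ ((trivializationAt E (TangentSpace I : N → Type _) x).continuousLinearMapAt ℝ y w) := by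
  have mfderiv_ℓ : mfderiv 𝓘(ℝ, E) 𝓘(ℝ, ℝ) ℓ (extChartAt I x y) = ℓ := ℓ.mfderiv_eq
  rw [mvfderiv_comp_apply (I := 𝓘(ℝ, E)) (I' := I) (g := ℓ) (f := extChartAt I x) y
    (ℓ.contMDiff.mdifferentiableAt (n := ∞) (by simp)) (mdifferentiableAt_extChartAt hy) w]
  unfold mvfderiv
  rw [mfderiv_ℓ, TangentBundle.continuousLinearMapAt_trivializationAt hy]
  rfl

lemma exists_isCoordinateFrameOn [FiniteDimensional ℝ E] (x : N) :
    ∃ (O : Set N) (s : Fin (Module.finrank ℝ E) → VField I N)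
      (ξ : Fin (Module.finrank ℝ E) → N → ℝ), IsCoordinateFrameOn I s ξ O ∧ x ∈ O := by
  let t := trivializationAt E (TangentSpace I : N → Type _) x
  let b := Module.finBasis ℝ E
  let ℓ (i : Fin (Module.finrank ℝ E)) : E →L[ℝ] ℝ := LinearMap.toContinuousLinearMap (b.coord i)
  refine ⟨(chartAt H x).source, t.localFrame b, fun i => ℓ i ∘ extChartAt I x,
    ⟨(chartAt H x).open_source, t.contMDiffOn_localFrame_baseSet ∞ b,
      fun i => (ℓ i).contMDiff.comp_contMDiffOn contMDiffOn_extChartAt, fun y hy w => ?_⟩,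
    mem_chart_source H x⟩
  have y_mem_baseSet : y ∈ t.baseSet := hy
  have repr_eq (i) :
      (t.basisAt b y_mem_baseSet).repr w i = mvfderiv I (ℓ i ∘ extChartAt I x) y w := by
    rw [mvfderiv_comp_extChartAt _ x hy]
    change b.repr (t.linearEquivAt ℝ y y_mem_baseSet w) i = b.repr (t.linearMapAt ℝ y w) i
    rw [t.coe_linearMapAt_of_mem (R := ℝ) y_mem_baseSet]
    rfl
  conv_lhs => rw [← (t.basisAt b y_mem_baseSet).sum_repr w]
  refine Finset.sum_congr rfl fun i _ => ?_
  rw [repr_eq, Bundle.Trivialization.localFrame_apply_of_mem_baseSet (hx := y_mem_baseSet)]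

variable [FiniteDimensional ℝ E]

lemma tangent_ext {x : N} {w w' : TangentSpace I x}
    (h : ∀ (O : Set N) (f : N → ℝ), IsOpen O → x ∈ O → ContMDiffOn I 𝓘(ℝ, ℝ) ∞ f O →
      mvfderiv I f x w = mvfderiv I f x w') : w = w' := by
  obtain ⟨O, s, ξ, hξ, hx⟩ := exists_isCoordinateFrameOn (I := I) x
  rw [hξ.eq_sum x hx w, hξ.eq_sum x hx w']
  exact Finset.sum_congr rfl fun i _ => by rw [h O (ξ i) hξ.isOpen hx (hξ.smooth_coord i)]

variable {E' : Type*} [NormedAddCommGroup E'] [NormedSpace ℝ E']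
  {H' : Type*} [TopologicalSpace H'] {I' : ModelWithCorners ℝ E' H'}
  {N' : Type*} [TopologicalSpace N'] [ChartedSpace H' N'] [IsManifold I' ∞ N']

lemma SmoothForm.pullback {g : FormField I N} (hg : SmoothForm I g) {F : N' → N}
    (hF : ContMDiff I' I ∞ F) :
    SmoothForm I' fun p => LinearMap.BilinForm.comp (g (F p))
      (mfderiv I' I F p).toLinearMap (mfderiv I' I F p).toLinearMap := by
  intro U X Y hU hX hY p hp
  obtain ⟨O, s, ξ, hξ, hpO⟩ := exists_isCoordinateFrameOn (I := I) (F p)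
  let W : Set N' := U ∩ F ⁻¹' O
  have hW : IsOpen W := hU.inter (hξ.isOpen.preimage hF.continuous)
  have smooth_coord {X : VField I' N'} (hX : SmoothFieldOn I' X U) (i) :
      ContMDiffOn I' 𝓘(ℝ, ℝ) ∞ (along I' X (ξ i ∘ F)) W :=
    (hX.mono Set.inter_subset_left).along hW
      ((hξ.smooth_coord i).comp hF.contMDiffOn fun q hq => hq.2)
  have smooth_gram (i j) : ContMDiffOn I' 𝓘(ℝ, ℝ) ∞ (fun q => g (F q) (s i (F q)) (s j (F q))) W :=
    (hg O (s i) (s j) hξ.isOpen (hξ.smooth_field i) (hξ.smooth_field j)).comp hF.contMDiffOn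
      fun q hq => hq.2
  have mfderiv_eq_sum (X : VField I' N') {q : N'} (hq : q ∈ W) :
      mfderiv I' I F q (X q) = ∑ i, along I' X (ξ i ∘ F) q • s i (F q) := by
    rw [hξ.eq_sum (F q) hq.2 (mfderiv I' I F q (X q))]
    refine Finset.sum_congr rfl fun i _ => ?_
    rw [along, mvfderiv_comp_apply q (mdiffAt_of_contMDiffOn hξ.isOpen (hξ.smooth_coord i) hq.2)
      (hF.mdifferentiableAt (by simp))]
  refine ContMDiffWithinAt.mono_of_mem_nhdsWithin (s := W) ?_
    (mem_nhdsWithin_of_mem_nhds (hW.mem_nhds ⟨hp, hpO⟩))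
  refine ContMDiffOn.congr (f := fun q => ∑ i, ∑ j, along I' X (ξ i ∘ F) q *
    (along I' Y (ξ j ∘ F) q * g (F q) (s i (F q)) (s j (F q)))) ?_ (fun q hq => ?_) p ⟨hp, hpO⟩
  · exact contMDiffOn_finsetSum fun i _ => contMDiffOn_finsetSum fun j _ =>
      (smooth_coord hX i).mul ((smooth_coord hY j).mul (smooth_gram i j))
  · change g (F q) (mfderiv I' I F q (X q)) (mfderiv I' I F q (Y q)) = _
    rw [mfderiv_eq_sum X hq, mfderiv_eq_sum Y hq]
    simp only [map_sum, map_smul, LinearMap.sum_apply, LinearMap.smul_apply, smul_eq_mul,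
      Finset.mul_sum]
    rw [Finset.sum_comm]
    exact Finset.sum_congr rfl fun i _ => Finset.sum_congr rfl fun j _ => mul_left_comm _ _ _

end CoordinateFrame

section Product

variable {E : Type*} [NormedAddCommGroup E] [NormedSpace ℝ E]
  {H : Type*} [TopologicalSpace H] {I : ModelWithCorners ℝ E H}
  {N : Type*} [TopologicalSpace N] [ChartedSpace H N]

/-- The horizontal lift of a vector field to the product with the line. -/
def lift (X : VField I N) : VField (I.prod 𝓘(ℝ, ℝ)) (N × ℝ) := fun p =>
  mfderiv I (I.prod 𝓘(ℝ, ℝ)) (fun y => (y, p.2)) p.1 (X p.1)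

/-- The coordinate vector field of the line factor. -/
def lineField : VField (I.prod 𝓘(ℝ, ℝ)) (N × ℝ) := fun p =>
  mfderiv 𝓘(ℝ, ℝ) (I.prod 𝓘(ℝ, ℝ)) (fun s : ℝ => (p.1, s)) p.2 (1 : ℝ)

lemma mfderiv_fst_lift (X : VField I N) (p : N × ℝ) :
    mfderiv (I.prod 𝓘(ℝ, ℝ)) I Prod.fst p (lift X p) = X p.1 := by
  rw [lift, mfderiv_prod_left, mfderiv_fst]; rfl

lemma mfderiv_fst_lineField (p : N × ℝ) :
    mfderiv (I.prod 𝓘(ℝ, ℝ)) I Prod.fst p (lineField p) = 0 := by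
  rw [lineField, mfderiv_prod_right, mfderiv_fst]; rfl

lemma mvfderiv_snd_lift (X : VField I N) (p : N × ℝ) :
    mvfderiv (I.prod 𝓘(ℝ, ℝ)) (Prod.snd : N × ℝ → ℝ) p (lift X p) = 0 := by
  unfold mvfderiv
  rw [lift, mfderiv_prod_left, mfderiv_snd]; rfl

lemma mvfderiv_snd_lineField (p : N × ℝ) :
    mvfderiv (I.prod 𝓘(ℝ, ℝ)) (Prod.snd : N × ℝ → ℝ) p (lineField p) = 1 := by
  unfold mvfderiv
  rw [lineField, mfderiv_prod_right, mfderiv_snd]; rfl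

lemma tangent_prod_ext {p : N × ℝ} {w w' : TangentSpace (I.prod 𝓘(ℝ, ℝ)) p}
    (fst_eq : mfderiv (I.prod 𝓘(ℝ, ℝ)) I Prod.fst p w = mfderiv (I.prod 𝓘(ℝ, ℝ)) I Prod.fst p w')
    (snd_eq : mvfderiv (I.prod 𝓘(ℝ, ℝ)) (Prod.snd : N × ℝ → ℝ) p w =
      mvfderiv (I.prod 𝓘(ℝ, ℝ)) (Prod.snd : N × ℝ → ℝ) p w') : w = w' := by
  unfold mvfderiv at snd_eq
  rw [mfderiv_fst] at fst_eq
  rw [mfderiv_snd] at snd_eq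
  exact Prod.ext fst_eq snd_eq

lemma mvfderiv_comp_fst {f : N → ℝ} {p : N × ℝ} (hf : MDifferentiableAt I 𝓘(ℝ, ℝ) f p.1)
    (w : TangentSpace (I.prod 𝓘(ℝ, ℝ)) p) :
    mvfderiv (I.prod 𝓘(ℝ, ℝ)) (fun q : N × ℝ => f q.1) p w =
      mvfderiv I f p.1 (mfderiv (I.prod 𝓘(ℝ, ℝ)) I Prod.fst p w) :=
  mvfderiv_comp_apply (f := Prod.fst) (g := f) p hf mdifferentiableAt_fst w

lemma along_lift (X : VField I N) (f : N → ℝ) (p : N × ℝ) :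
    along (I.prod 𝓘(ℝ, ℝ)) (lift X) (fun q : N × ℝ => f q.1) p = along I X f p.1 := by
  by_cases hf : MDifferentiableAt I 𝓘(ℝ, ℝ) f p.1
  · rw [along, mvfderiv_comp_fst hf, mfderiv_fst_lift]; rfl
  · have not_mdifferentiableAt_comp_fst :
        ¬ MDifferentiableAt (I.prod 𝓘(ℝ, ℝ)) 𝓘(ℝ, ℝ) (fun q : N × ℝ => f q.1) p := fun h =>
      hf (MDifferentiableAt.comp (f := fun y : N => (y, p.2)) p.1 h
        (mdifferentiableAt_id.prodMk mdifferentiableAt_const))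
    simp [along, mvfderiv, mfderiv_zero_of_not_mdifferentiableAt hf,
      mfderiv_zero_of_not_mdifferentiableAt not_mdifferentiableAt_comp_fst]

lemma along_lineField_comp_fst {f : N → ℝ} {p : N × ℝ} (hf : MDifferentiableAt I 𝓘(ℝ, ℝ) f p.1) :
    along (I.prod 𝓘(ℝ, ℝ)) lineField (fun q : N × ℝ => f q.1) p = 0 := by
  rw [along, mvfderiv_comp_fst hf, mfderiv_fst_lineField, map_zero]

lemma preimage_fst_mem_nhds {U : Set N} (hU : IsOpen U) {p : N × ℝ} (hp : p.1 ∈ U) :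
    Prod.fst ⁻¹' U ∈ 𝓝 p :=
  (hU.preimage continuous_fst).mem_nhds hp

variable [IsManifold I ∞ N]

lemma SmoothFieldOn.lift {X : VField I N} {U : Set N} (hX : SmoothFieldOn I X U) :
    SmoothFieldOn (I.prod 𝓘(ℝ, ℝ)) (lift X) (Prod.fst ⁻¹' U) := by
  have smooth_fst : ContMDiffOn (I.prod 𝓘(ℝ, ℝ)) I.tangent ∞
      (fun p : N × ℝ => (⟨p.1, X p.1⟩ : TangentBundle I N)) (Prod.fst ⁻¹' U) :=
    ContMDiffOn.comp hX contMDiffOn_fst fun p hp => hp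
  have smooth_snd : ContMDiffOn (I.prod 𝓘(ℝ, ℝ)) 𝓘(ℝ, ℝ).tangent ∞
      (fun p : N × ℝ => (⟨p.2, 0⟩ : TangentBundle 𝓘(ℝ, ℝ) ℝ)) (Prod.fst ⁻¹' U) :=
    ContMDiff.comp_contMDiffOn
      (Bundle.contMDiff_zeroSection ℝ (TangentSpace 𝓘(ℝ, ℝ) : ℝ → Type _)) contMDiffOn_snd
  refine (contMDiff_equivTangentBundleProd_symm.comp_contMDiffOn
    (smooth_fst.prodMk smooth_snd)).congr fun p _ => ?_
  rw [RicciAmbient.lift, mfderiv_prod_left]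
  rfl

lemma smoothFieldOn_lineField (U : Set (N × ℝ)) :
    SmoothFieldOn (I.prod 𝓘(ℝ, ℝ)) (lineField (I := I)) U := by
  have smooth_fst : ContMDiffOn (I.prod 𝓘(ℝ, ℝ)) I.tangent ∞
      (fun p : N × ℝ => (⟨p.1, 0⟩ : TangentBundle I N)) U :=
    ContMDiff.comp_contMDiffOn
      (Bundle.contMDiff_zeroSection ℝ (TangentSpace I : N → Type _)) contMDiffOn_fst
  have smooth_snd : ContMDiffOn (I.prod 𝓘(ℝ, ℝ)) 𝓘(ℝ, ℝ).tangent ∞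
      (fun p : N × ℝ => (⟨p.2, (1 : ℝ)⟩ : TangentBundle 𝓘(ℝ, ℝ) ℝ)) U := by
    refine ContMDiff.comp_contMDiffOn (f := Prod.snd)
      (g := fun s : ℝ => (⟨s, (1 : ℝ)⟩ : TangentBundle 𝓘(ℝ, ℝ) ℝ)) ?_ contMDiffOn_snd
    exact contMDiff_vectorSpace_iff_contDiff.2 contDiff_const
  refine (contMDiff_equivTangentBundleProd_symm.comp_contMDiffOn
    (smooth_fst.prodMk smooth_snd)).congr fun p _ => ?_
  rw [RicciAmbient.lineField, mfderiv_prod_right]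
  rfl

variable [FiniteDimensional ℝ E]

lemma mfderiv_fst_mlieBracket {X Y : VField I N} {X' Y' : VField (I.prod 𝓘(ℝ, ℝ)) (N × ℝ)}
    {U : Set N} (hU : IsOpen U) (hX : SmoothFieldOn I X U) (hY : SmoothFieldOn I Y U)
    (hX' : SmoothFieldOn (I.prod 𝓘(ℝ, ℝ)) X' (Prod.fst ⁻¹' U))
    (hY' : SmoothFieldOn (I.prod 𝓘(ℝ, ℝ)) Y' (Prod.fst ⁻¹' U))
    (hXX' : ∀ q, mfderiv (I.prod 𝓘(ℝ, ℝ)) I Prod.fst q (X' q) = X q.1)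
    (hYY' : ∀ q, mfderiv (I.prod 𝓘(ℝ, ℝ)) I Prod.fst q (Y' q) = Y q.1)
    {p : N × ℝ} (hp : p.1 ∈ U) :
    mfderiv (I.prod 𝓘(ℝ, ℝ)) I Prod.fst p (mlieBracket (I.prod 𝓘(ℝ, ℝ)) X' Y' p) =
      mlieBracket I X Y p.1 := by
  have : CompleteSpace E := FiniteDimensional.complete ℝ E
  refine tangent_ext fun O f hO hpO hf => ?_
  have hW := hO.inter hU
  have hpW : p.1 ∈ O ∩ U := ⟨hpO, hp⟩
  have inter_subset : O ∩ U ⊆ U := Set.inter_subset_right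
  have hf' : ContMDiffOn I 𝓘(ℝ, ℝ) ∞ f (O ∩ U) := hf.mono Set.inter_subset_left
  have along_comp_fst {X : VField I N} {X' : VField (I.prod 𝓘(ℝ, ℝ)) (N × ℝ)}
      (hXX' : ∀ q, mfderiv (I.prod 𝓘(ℝ, ℝ)) I Prod.fst q (X' q) = X q.1) {f : N → ℝ}
      (hf : ContMDiffOn I 𝓘(ℝ, ℝ) ∞ f (O ∩ U)) {q : N × ℝ} (hq : q.1 ∈ O ∩ U) :
      along (I.prod 𝓘(ℝ, ℝ)) X' (fun q => f q.1) q = along I X f q.1 := by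
    rw [along, mvfderiv_comp_fst (mdiffAt_of_contMDiffOn hW hf hq), hXX']
    rfl
  have along_along_comp_fst {X Y : VField I N} {X' Y' : VField (I.prod 𝓘(ℝ, ℝ)) (N × ℝ)}
      (hY : SmoothFieldOn I Y U)
      (hXX' : ∀ q, mfderiv (I.prod 𝓘(ℝ, ℝ)) I Prod.fst q (X' q) = X q.1)
      (hYY' : ∀ q, mfderiv (I.prod 𝓘(ℝ, ℝ)) I Prod.fst q (Y' q) = Y q.1) :
      along (I.prod 𝓘(ℝ, ℝ)) X' (along (I.prod 𝓘(ℝ, ℝ)) Y' fun q => f q.1) p =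
        along I X (along I Y f) p.1 := by
    rw [← along_comp_fst hXX' ((hY.mono inter_subset).along hW hf') hpW]
    refine along_congr rfl ?_
    filter_upwards [preimage_fst_mem_nhds hW hpW] with q hq using along_comp_fst hYY' hf' hq
  calc mvfderiv I f p.1 (mfderiv (I.prod 𝓘(ℝ, ℝ)) I Prod.fst p (mlieBracket _ X' Y' p))
      = along (I.prod 𝓘(ℝ, ℝ)) (mlieBracket _ X' Y') (fun q => f q.1) p :=
        (mvfderiv_comp_fst (mdiffAt_of_contMDiffOn hW hf' hpW) _).symm
    _ = along I X (along I Y f) p.1 - along I Y (along I X f) p.1 := by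
        rw [along_lieBracket (hW.preimage continuous_fst)
          (hX'.mono (Set.preimage_mono inter_subset)) (hY'.mono (Set.preimage_mono inter_subset))
          (f := fun q : N × ℝ => f q.1)
          (hf'.comp contMDiffOn_fst fun q hq => hq) hpW,
          along_along_comp_fst hY hXX' hYY', along_along_comp_fst hX hYY' hXX']
    _ = mvfderiv I f p.1 (mlieBracket I X Y p.1) :=
        (along_lieBracket hW (hX.mono inter_subset) (hY.mono inter_subset) hf' hpW).symm

lemma mvfderiv_snd_mlieBracket {X Y : VField (I.prod 𝓘(ℝ, ℝ)) (N × ℝ)} {U : Set (N × ℝ)}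
    (hU : IsOpen U) (hX : SmoothFieldOn (I.prod 𝓘(ℝ, ℝ)) X U)
    (hY : SmoothFieldOn (I.prod 𝓘(ℝ, ℝ)) Y U) {a b : ℝ}
    (hXa : ∀ q, mvfderiv (I.prod 𝓘(ℝ, ℝ)) (Prod.snd : N × ℝ → ℝ) q (X q) = a)
    (hYb : ∀ q, mvfderiv (I.prod 𝓘(ℝ, ℝ)) (Prod.snd : N × ℝ → ℝ) q (Y q) = b)
    {p : N × ℝ} (hp : p ∈ U) :
    mvfderiv (I.prod 𝓘(ℝ, ℝ)) (Prod.snd : N × ℝ → ℝ) p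
      (mlieBracket (I.prod 𝓘(ℝ, ℝ)) X Y p) = 0 := by
  have : CompleteSpace E := FiniteDimensional.complete ℝ E
  have along_X : along (I.prod 𝓘(ℝ, ℝ)) X (Prod.snd : N × ℝ → ℝ) = fun _ => a := funext hXa
  have along_Y : along (I.prod 𝓘(ℝ, ℝ)) Y (Prod.snd : N × ℝ → ℝ) = fun _ => b := funext hYb
  have along_bracket := along_lieBracket hU hX hY (f := (Prod.snd : N × ℝ → ℝ)) contMDiffOn_snd hp
  rw [along_X, along_Y] at along_bracket
  simpa [along, mvfderiv_const] using along_bracket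

lemma mlieBracket_lift {X Y : VField I N} {U : Set N} (hU : IsOpen U) (hX : SmoothFieldOn I X U)
    (hY : SmoothFieldOn I Y U) {p : N × ℝ} (hp : p.1 ∈ U) :
    mlieBracket (I.prod 𝓘(ℝ, ℝ)) (lift X) (lift Y) p = lift (mlieBracket I X Y) p := by
  refine tangent_prod_ext ?_ ?_
  · rw [mfderiv_fst_lift, mfderiv_fst_mlieBracket hU hX hY hX.lift hY.lift (mfderiv_fst_lift X)
      (mfderiv_fst_lift Y) hp]
  · rw [mvfderiv_snd_lift, mvfderiv_snd_mlieBracket (hU.preimage continuous_fst) hX.lift hY.lift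
      (mvfderiv_snd_lift X) (mvfderiv_snd_lift Y) hp]

lemma mlieBracket_lineField_lift {X : VField I N} {U : Set N} (hU : IsOpen U)
    (hX : SmoothFieldOn I X U) {p : N × ℝ} (hp : p.1 ∈ U) :
    mlieBracket (I.prod 𝓘(ℝ, ℝ)) lineField (lift X) p = 0 := by
  have smoothFieldOn_zero : SmoothFieldOn I (0 : VField I N) U :=
    (Bundle.contMDiff_zeroSection ℝ (TangentSpace I : N → Type _)).contMDiffOn
  refine tangent_prod_ext ?_ ?_
  · rw [mfderiv_fst_mlieBracket hU smoothFieldOn_zero hX (smoothFieldOn_lineField _) hX.lift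
      mfderiv_fst_lineField (mfderiv_fst_lift X) hp, mlieBracket_zero_left, map_zero]
    rfl
  · rw [mvfderiv_snd_mlieBracket (hU.preimage continuous_fst) (smoothFieldOn_lineField _) hX.lift
      mvfderiv_snd_lineField (mvfderiv_snd_lift X) hp, map_zero]

end Product

/-- The form `G` restricts to the pullback of `g` on the horizontal lifts of the family `e`. -/
structure LiftsForm {E : Type*} [NormedAddCommGroup E] [NormedSpace ℝ E]
    {H : Type*} [TopologicalSpace H] {I : ModelWithCorners ℝ E H}
    {N : Type*} [TopologicalSpace N] [ChartedSpace H N] [IsManifold I ∞ N] {ι : Type*}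
    (g : FormField I N) (G : FormField (I.prod 𝓘(ℝ, ℝ)) (N × ℝ))
    (e : ι → VField I N) (U : Set N) : Prop where
  isOpen : IsOpen U
  smooth : ∀ a, SmoothFieldOn I (e a) U
  apply : ∀ p : N × ℝ, p.1 ∈ U → ∀ (X : VField I N) a,
    G p (lift X p) (lift (e a) p) = g p.1 (X p.1) (e a p.1)

namespace LiftsForm

variable {E : Type*} [NormedAddCommGroup E] [NormedSpace ℝ E]
  {H : Type*} [TopologicalSpace H] {I : ModelWithCorners ℝ E H}
  {N : Type*} [TopologicalSpace N] [ChartedSpace H N] [IsManifold I ∞ N]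
  {ι : Type*} [Fintype ι] [DecidableEq ι] {g : FormField I N}
  {G : FormField (I.prod 𝓘(ℝ, ℝ)) (N × ℝ)} {e : ι → VField I N} {U : Set N}
  (h : LiftsForm g G e U) {p : N × ℝ} (hp : p.1 ∈ U)
include h hp

omit [Fintype ι] [DecidableEq ι] in
lemma along_eq {F : N × ℝ → ℝ} {f : N → ℝ} (hF : ∀ q : N × ℝ, q.1 ∈ U → F q = f q.1)
    (X : VField I N) : along (I.prod 𝓘(ℝ, ℝ)) (lift X) F p = along I X f p.1 := by
  rw [← along_lift, along_congr rfl]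
  filter_upwards [preimage_fst_mem_nhds h.isOpen hp] with q hq using hF q hq

lemma gramInv_eq :
    gramInv (I.prod 𝓘(ℝ, ℝ)) G (fun a => lift (e a)) p = gramInv I g e p.1 := by
  have gram_eq : gram (I.prod 𝓘(ℝ, ℝ)) G (fun a => lift (e a)) p = gram I g e p.1 := by
    ext a b
    exact h.apply p hp _ b
  rw [gramInv, gramInv, gram_eq]

lemma gradSq_eq (φ : N → ℝ) :
    gradSq (I.prod 𝓘(ℝ, ℝ)) G (fun a => lift (e a)) (fun q => φ q.1) p = gradSq I g e φ p.1 := by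
  simp only [gradSq, h.gramInv_eq hp, along_lift]

variable [FiniteDimensional ℝ E]

omit [Fintype ι] [DecidableEq ι] in
lemma bracket_eq (a b c : ι) :
    G p (mlieBracket (I.prod 𝓘(ℝ, ℝ)) (lift (e a)) (lift (e b)) p) (lift (e c) p) =
      g p.1 (mlieBracket I (e a) (e b) p.1) (e c p.1) := by
  rw [mlieBracket_lift h.isOpen (h.smooth a) (h.smooth b) hp, h.apply p hp]

omit [Fintype ι] [DecidableEq ι] in
lemma koszul_eq (a b c : ι) :
    koszul (I.prod 𝓘(ℝ, ℝ)) G (lift (e a)) (lift (e b)) (lift (e c)) p =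
      koszul I g (e a) (e b) (e c) p.1 := by
  have along_form (a b c : ι) : along (I.prod 𝓘(ℝ, ℝ)) (lift (e a))
      (fun q => G q (lift (e b) q) (lift (e c) q)) p =
        along I (e a) (fun y => g y (e b y) (e c y)) p.1 :=
    h.along_eq hp (f := fun y => g y (e b y) (e c y)) (fun q hq => h.apply q hq _ c) _
  simp only [koszul, h.bracket_eq hp, along_form]

lemma connCoeff_eq (a b d : ι) :
    connCoeff (I.prod 𝓘(ℝ, ℝ)) G (fun a => lift (e a)) a b d p = connCoeff I g e a b d p.1 := by
  simp only [connCoeff, h.koszul_eq hp, h.gramInv_eq hp]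

lemma structFun_eq (a b d : ι) :
    structFun (I.prod 𝓘(ℝ, ℝ)) G (fun a => lift (e a)) a b d p = structFun I g e a b d p.1 := by
  simp only [structFun, h.bracket_eq hp, h.gramInv_eq hp]

lemma ric_eq (b c : ι) :
    ric (I.prod 𝓘(ℝ, ℝ)) G (fun a => lift (e a)) b c p = ric I g e b c p.1 := by
  simp only [ric, riem, h.connCoeff_eq hp, h.structFun_eq hp]
  refine Finset.sum_congr rfl fun a _ => ?_
  rw [h.along_eq hp fun q hq => h.connCoeff_eq hq b c a,
    h.along_eq hp fun q hq => h.connCoeff_eq hq a c a]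

lemma scal_eq : scal (I.prod 𝓘(ℝ, ℝ)) G (fun a => lift (e a)) p = scal I g e p.1 := by
  simp only [scal, h.ric_eq hp, h.gramInv_eq hp]

lemma hess_eq (φ : N → ℝ) (a b : ι) :
    hess (I.prod 𝓘(ℝ, ℝ)) G (fun a => lift (e a)) (fun q => φ q.1) a b p =
      hess I g e φ a b p.1 := by
  simp only [hess, h.connCoeff_eq hp, along_lift]
  rw [h.along_eq hp fun q _ => along_lift (e b) φ q]

lemma lap_eq (φ : N → ℝ) :
    lap (I.prod 𝓘(ℝ, ℝ)) G (fun a => lift (e a)) (fun q => φ q.1) p = lap I g e φ p.1 := by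
  simp only [lap, h.hess_eq hp, h.gramInv_eq hp]

end LiftsForm

lemma one_sub_lam_mul_uCoord (lam t₀ t : ℝ) :
    1 - lam * uCoord lam t₀ t = Real.exp (lam * (t - t₀)) := by
  by_cases h : lam = 0
  · simp [h]
  · rw [uCoord, if_neg h]; field_simp; ring

lemma uCoord_nonpos_iff (lam t₀ t : ℝ) : uCoord lam t₀ t ≤ 0 ↔ t₀ ≤ t := by
  rcases lt_trichotomy lam 0 with h | rfl | h
  · rw [uCoord, if_neg h.ne, div_le_iff_of_neg h, zero_mul, sub_nonneg, Real.exp_le_one_iff,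
      ← sub_nonneg (a := t)]
    exact ⟨fun ht => by nlinarith, fun ht => mul_nonpos_of_nonpos_of_nonneg h.le ht⟩
  · simp [uCoord]
  · rw [uCoord, if_neg h.ne', div_le_iff₀ h, zero_mul, sub_nonpos, Real.one_le_exp_iff,
      mul_nonneg_iff_of_pos_left h, sub_nonneg]

lemma contDiff_uCoord (lam t₀ : ℝ) : ContDiff ℝ ∞ (uCoord lam t₀) := by
  unfold uCoord
  split_ifs <;> fun_prop

section LorentzSignature

variable {V : Type*} [AddCommGroup V] [Module ℝ V]

lemma exists_orthonormal_of_posDef [FiniteDimensional ℝ V] {n : ℕ}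
    (hn : Module.finrank ℝ V = n) (B : LinearMap.BilinForm ℝ V) (symm : ∀ X Y, B X Y = B Y X)
    (pos : ∀ X, X ≠ 0 → 0 < B X X) :
    ∃ f : Fin n → V, ∀ a b, B (f a) (f b) = if a = b then 1 else 0 := by
  subst hn
  obtain ⟨v, ortho⟩ := LinearMap.BilinForm.exists_orthogonal_basis (B := B) ⟨symm⟩
  refine ⟨fun a => (√(B (v a) (v a)))⁻¹ • v a, fun a b => ?_⟩
  simp only [map_smul, LinearMap.smul_apply, smul_eq_mul]
  split_ifs with hab
  · subst hab
    have norm_pos := pos (v a) (v.ne_zero a)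
    have sqrt_ne_zero := (Real.sqrt_pos.2 norm_pos).ne'
    field_simp
    rw [Real.sq_sqrt norm_pos.le]
  · have v_ortho : B (v a) (v b) = 0 := ortho hab
    rw [v_ortho, mul_zero, mul_zero]

lemma hasLorentzSignature_of_orthonormal {k : ℕ} (hV : Module.finrank ℝ V = k + 1)
    {B : LinearMap.BilinForm ℝ V} (symm : ∀ X Y, B X Y = B Y X) {f : Fin k → V}
    (hf : ∀ a b, B (f a) (f b) = if a = b then 1 else 0) {Q : V} (hQ : B Q Q = -1)
    (hfQ : ∀ a, B (f a) Q = 0) : HasLorentzSignature k B := by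
  let b : Fin k ⊕ Fin 1 → V := Sum.elim f fun _ => Q
  have hb (i j) : B (b i) (b j) =
      (Matrix.fromBlocks 1 0 0 (-1) : Matrix (Fin k ⊕ Fin 1) (Fin k ⊕ Fin 1) ℝ) i j := by
    rcases i with i | i <;> rcases j with j | j
    · simp [b, hf, Matrix.one_apply]
    · simp [b, hfQ]
    · simp [b, symm Q, hfQ]
    · simp [b, hQ, Subsingleton.elim i j]
  have ortho (i j) (hij : i ≠ j) : B (b i) (b j) = 0 := by
    rw [hb]
    rcases i with i | i <;> rcases j with j | j
    · simpa [Matrix.one_apply] using hij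
    · simp
    · simp
    · exact (hij (by rw [Subsingleton.elim i j])).elim
  have norm_ne_zero (i) : B (b i) (b i) ≠ 0 := by
    rw [hb]
    rcases i with i | i <;> simp
  have linInd := LinearMap.linearIndependent_of_isOrthoᵢ (B := B) ortho norm_ne_zero
  exact ⟨basisOfLinearIndependentOfCardEqFinrank linInd (by simp [hV]), fun i j => by
    simpa using hb i j⟩

-- `T + sV` has square `-ρ - 2sw`, which is `±1` for `s = (-ρ ∓ 1) / (2w)`.
lemma hasLorentzSignature_of_null {k : ℕ} (hV : Module.finrank ℝ V = k + 2)
    {B : LinearMap.BilinForm ℝ V} (symm : ∀ X Y, B X Y = B Y X) {f : Fin k → V}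
    (hf : ∀ a b, B (f a) (f b) = if a = b then 1 else 0) {N T : V} {w ρ : ℝ} (hw : w ≠ 0)
    (hNN : B N N = 0) (hNT : B N T = -w) (hTT : B T T = -ρ) (hNf : ∀ a, B N (f a) = 0)
    (hTf : ∀ a, B T (f a) = 0) : HasLorentzSignature (k + 1) B := by
  have hTN : B T N = -w := symm T N ▸ hNT
  have form_shift (s r : ℝ) : B (T + s • N) (T + r • N) = -ρ - (s + r) * w := by
    simp only [map_add, map_smul, LinearMap.add_apply, LinearMap.smul_apply, smul_eq_mul, hNN,
      hNT, hTN, hTT]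
    ring
  have form_shift_f (s : ℝ) (a : Fin k) : B (T + s • N) (f a) = 0 := by simp [hNf, hTf]
  have form_f_shift (s : ℝ) (a : Fin k) : B (f a) (T + s • N) = 0 := by
    rw [symm, form_shift_f]
  refine hasLorentzSignature_of_orthonormal hV symm
    (f := Fin.cons (T + ((-ρ - 1) / (2 * w)) • N) f) (Q := T + ((-ρ + 1) / (2 * w)) • N)
    (fun i j => ?_) ?_ fun i => ?_
  · induction i using Fin.cases <;> induction j using Fin.cases
    · rw [Fin.cons_zero, form_shift, if_pos rfl]; field_simp; ring
    · rw [Fin.cons_zero, Fin.cons_succ, form_shift_f, if_neg (Fin.succ_ne_zero _).symm]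
    · rw [Fin.cons_zero, Fin.cons_succ, form_f_shift, if_neg (Fin.succ_ne_zero _)]
    · simp [hf]
  · rw [form_shift]; field_simp; ring
  · induction i using Fin.cases
    · rw [Fin.cons_zero, form_shift]; field_simp; ring
    · rw [Fin.cons_succ, form_f_shift]

end LorentzSignature

section AmbientMetric

variable {n : ℕ} {M : Type*} [TopologicalSpace M] [ChartedSpace (EuclideanHalfSpace (n + 1)) M]

namespace GradientRicciFlowSpacetime

lemma dπ_lift (X : VField (𝓡∂ (n + 1)) M) (p : M × ℝ) : dπ p (lift X p) = X p.1 :=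
  mfderiv_fst_lift X p

lemma dπ_vertField (p : M × ℝ) : dπ (n := n) p (vertField p) = 0 :=
  mfderiv_fst_lineField p

lemma dv_lift (X : VField (𝓡∂ (n + 1)) M) (p : M × ℝ) : dv p (lift X p) = 0 :=
  mvfderiv_snd_lift X p

lemma dv_vertField (p : M × ℝ) : dv (n := n) p (vertField p) = 1 :=
  mvfderiv_snd_lineField p

lemma mdifferentiableAt_vertShift (s : ℝ) (p : M × ℝ) :
    MDifferentiableAt (prodModel n) (prodModel n) (vertShift (M := M) s) p :=
  mdifferentiableAt_fst.prodMk
    ((contMDiff_snd.add contMDiff_const).mdifferentiableAt (n := 1) (by simp))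

lemma dπ_mfderiv_vertShift (s : ℝ) (p : M × ℝ) (X : TangentSpace (prodModel n) p) :
    dπ (vertShift s p) (mfderiv (prodModel n) (prodModel n) (vertShift (M := M) s) p X) =
      dπ p X :=
  (mfderiv_comp_apply (I'' := 𝓡∂ (n + 1)) (g := Prod.fst) (f := vertShift (M := M) s) p
    mdifferentiableAt_fst (mdifferentiableAt_vertShift s p) X).symm

lemma dv_mfderiv_vertShift (s : ℝ) (p : M × ℝ) (X : TangentSpace (prodModel n) p) :
    dv (vertShift s p) (mfderiv (prodModel n) (prodModel n) (vertShift (M := M) s) p X) =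
      dv p X := by
  have chain := mvfderiv_comp_apply (I := prodModel n) (g := (Prod.snd : M × ℝ → ℝ))
    (f := vertShift (M := M) s) p mdifferentiableAt_snd (mdifferentiableAt_vertShift s p) X
  have deriv_snd_add := mvfderiv_add (I := prodModel n) (g := (Prod.snd : M × ℝ → ℝ))
    (g' := fun _ => s) (x := p) mdifferentiableAt_snd mdifferentiableAt_const
  rw [mvfderiv_const, add_zero] at deriv_snd_add
  have snd_comp : (Prod.snd : M × ℝ → ℝ) ∘ vertShift s = Prod.snd + fun _ => s := rfl
  rw [snd_comp, deriv_snd_add] at chain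
  exact chain.symm

lemma finrank_tangent_prod (p : M × ℝ) :
    Module.finrank ℝ (TangentSpace (prodModel n) p) = n + 2 := by
  change Module.finrank ℝ (EuclideanSpace ℝ (Fin (n + 1)) × ℝ) = n + 2
  rw [Module.finrank_prod, finrank_euclideanSpace_fin, Module.finrank_self]

lemma mvfderiv_uCoord_comp (lam t₀ : ℝ) {f : M → ℝ} {x : M}
    (hf : MDifferentiableAt (𝓡∂ (n + 1)) 𝓘(ℝ, ℝ) f x) (w : TangentSpace (𝓡∂ (n + 1)) x) :
    mvfderiv (𝓡∂ (n + 1)) (fun y => uCoord lam t₀ (f y)) x w =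
      -(1 - lam * uCoord lam t₀ (f x)) * mvfderiv (𝓡∂ (n + 1)) f x w := by
  have outer (r : ℝ) : mvfderiv 𝓘(ℝ, ℝ) (uCoord lam t₀) (f x) r =
      -(1 - lam * uCoord lam t₀ (f x)) * r := by
    unfold mvfderiv
    rw [mfderiv_eq_fderiv (f := uCoord lam t₀) (x := f x),
      (hasDerivAt_uCoord lam t₀ (f x)).hasFDerivAt.fderiv]
    exact (ContinuousLinearMap.toSpanSingleton_apply (R₁ := ℝ) _ r).trans (mul_comm _ _)
  have chain := mvfderiv_comp_apply (I := 𝓘(ℝ, ℝ)) (I' := 𝓡∂ (n + 1)) x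
    (hasDerivAt_uCoord lam t₀ (f x)).differentiableAt.mdifferentiableAt hf w
  exact chain.trans (outer _)

variable [IsManifold (𝓡∂ (n + 1)) ∞ M] {lam : ℝ} (S : GradientRicciFlowSpacetime n M lam) (t₀ : ℝ)

lemma u_smooth : ContMDiff (prodModel n) 𝓘(ℝ, ℝ) ∞ (S.u t₀) :=
  (contDiff_uCoord lam t₀).contMDiff.comp (S.time_smooth.comp contMDiff_fst)

lemma one_sub_pos (p : M × ℝ) : 0 < 1 - lam * S.u t₀ p := by
  rw [u, one_sub_lam_mul_uCoord]; exact Real.exp_pos _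

lemma du_apply (p : M × ℝ) (w : TangentSpace (prodModel n) p) :
    S.du t₀ p w = -(1 - lam * S.u t₀ p) * mvfderiv (𝓡∂ (n + 1)) S.time p.1 (dπ p w) := by
  have time_diff := S.time_smooth.mdifferentiableAt (x := p.1) (by simp)
  have u_diff := (contDiff_uCoord lam t₀).contMDiff.mdifferentiableAt (x := S.time p.1) (by simp)
  exact (mvfderiv_comp_fst (u_diff.comp p.1 time_diff) w).trans
    (mvfderiv_uCoord_comp lam t₀ time_diff _)

lemma du_vertField (p : M × ℝ) : S.du t₀ p (vertField p) = 0 := by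
  rw [du_apply, dπ_vertField, map_zero, mul_zero]

lemma du_lift (X : VField (𝓡∂ (n + 1)) M) (p : M × ℝ) :
    S.du t₀ p (lift X p) = -(1 - lam * S.u t₀ p) * mvfderiv (𝓡∂ (n + 1)) S.time p.1 (X p.1) := by
  rw [du_apply, dπ_lift]

lemma du_lift_of_mem {X : VField (𝓡∂ (n + 1)) M} {p : M × ℝ} (h : X p.1 ∈ spatial S.time p.1) :
    S.du t₀ p (lift X p) = 0 := by
  rw [du_lift, S.mem_spatial.1 h, mul_zero]

lemma du_lift_dt (p : M × ℝ) : S.du t₀ p (lift S.dt p) = -(1 - lam * S.u t₀ p) := by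
  rw [du_lift, S.mvfderiv_time_dt, mul_one]

lemma ambientMetric_apply (p : M × ℝ) (X Y : TangentSpace (prodModel n) p) :
    S.ambientMetric t₀ p X Y = S.du t₀ p X * dv p Y + dv p X * S.du t₀ p Y
      + S.g p.1 (dπ p X) (dπ p Y)
      - ((1 - lam * S.u t₀ p) ^ 2)⁻¹ * (S.weightedScal p.1 * (S.du t₀ p X * S.du t₀ p Y)) := rfl

lemma ambientMetric_symm (p : M × ℝ) (X Y : TangentSpace (prodModel n) p) :
    S.ambientMetric t₀ p X Y = S.ambientMetric t₀ p Y X := by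
  rw [ambientMetric_apply, ambientMetric_apply, S.g_symm]; ring

lemma ambientMetric_vertField (p : M × ℝ) (Z : TangentSpace (prodModel n) p) :
    S.ambientMetric t₀ p (vertField p) Z = S.du t₀ p Z := by
  rw [ambientMetric_apply, du_vertField, dv_vertField, dπ_vertField]; simp

lemma ambientMetric_lift {X Y : VField (𝓡∂ (n + 1)) M} {p : M × ℝ}
    (h : Y p.1 ∈ spatial S.time p.1) :
    S.ambientMetric t₀ p (lift X p) (lift Y p) = S.g p.1 (X p.1) (Y p.1) := by
  rw [ambientMetric_apply, S.du_lift_of_mem t₀ h, dv_lift, dv_lift, dπ_lift, dπ_lift]; simp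

lemma ambientMetric_dt_dt (p : M × ℝ) :
    S.ambientMetric t₀ p (lift S.dt p) (lift S.dt p) = -S.weightedScal p.1 := by
  have one_sub_ne_zero := (S.one_sub_pos t₀ p).ne'
  rw [ambientMetric_apply, du_lift_dt, dv_lift, dπ_lift, S.g_dt]
  field_simp
  ring

lemma ambientMetric_smooth : SmoothForm (prodModel n) (S.ambientMetric t₀) := by
  intro U X Y hU hX hY
  have du_smooth {X : VField (prodModel n) (M × ℝ)} (hX : SmoothFieldOn (prodModel n) X U) :
      ContMDiffOn (prodModel n) 𝓘(ℝ, ℝ) ∞ (fun p => S.du t₀ p (X p)) U :=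
    hX.along hU (S.u_smooth t₀).contMDiffOn
  have dv_smooth {X : VField (prodModel n) (M × ℝ)} (hX : SmoothFieldOn (prodModel n) X U) :
      ContMDiffOn (prodModel n) 𝓘(ℝ, ℝ) ∞ (fun p => dv p (X p)) U :=
    hX.along hU contMDiffOn_snd
  have g_smooth :
      ContMDiffOn (prodModel n) 𝓘(ℝ, ℝ) ∞ (fun p => S.g p.1 (dπ p (X p)) (dπ p (Y p))) U :=
    S.g_smooth.pullback contMDiff_fst U X Y hU hX hY
  have weight_smooth :
      ContMDiffOn (prodModel n) 𝓘(ℝ, ℝ) ∞ (fun p => ((1 - lam * S.u t₀ p) ^ 2)⁻¹) U :=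
    ContMDiffOn.inv₀ ((contMDiffOn_const.sub
      (contMDiffOn_const.mul (S.u_smooth t₀).contMDiffOn)).pow 2)
      fun p _ => pow_ne_zero 2 (S.one_sub_pos t₀ p).ne'
  have scal_smooth :
      ContMDiffOn (prodModel n) 𝓘(ℝ, ℝ) ∞ (fun p : M × ℝ => S.weightedScal p.1) U :=
    (S.weightedScal_smooth.comp contMDiff_fst).contMDiffOn
  exact ((((du_smooth hX).mul (dv_smooth hY)).add ((dv_smooth hX).mul (du_smooth hY))).add
    g_smooth).sub (weight_smooth.mul (scal_smooth.mul ((du_smooth hX).mul (du_smooth hY))))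

lemma ambientPotential_smooth :
    ContMDiff (prodModel n) 𝓘(ℝ, ℝ) ∞ (S.ambientPotential t₀) :=
  ((S.φ_smooth.comp contMDiff_fst).sub contMDiff_snd).add
    ((contMDiff_const.mul (S.u_smooth t₀)).mul contMDiff_snd)

lemma ambientPotential_dilation (s : ℝ) (p : M × ℝ) :
    S.ambientPotential t₀ (S.dilation t₀ s p) = S.ambientPotential t₀ p + s := by
  have sub_one_ne_zero : lam * S.u t₀ p - 1 ≠ 0 := by
    linarith [S.one_sub_pos t₀ p]
  have u_dilation : S.u t₀ (S.dilation t₀ s p) = S.u t₀ p := rfl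
  rw [ambientPotential, ambientPotential, u_dilation]
  simp only [dilation]
  field_simp
  ring

lemma ambientMetric_vertShift (s : ℝ) (p : M × ℝ) (X Y : TangentSpace (prodModel n) p) :
    S.ambientMetric t₀ (vertShift s p)
      (mfderiv (prodModel n) (prodModel n) (vertShift (M := M) s) p X)
      (mfderiv (prodModel n) (prodModel n) (vertShift (M := M) s) p Y) =
        S.ambientMetric t₀ p X Y := by
  have du_vertShift (X : TangentSpace (prodModel n) p) : S.du t₀ (vertShift s p)
      (mfderiv (prodModel n) (prodModel n) (vertShift (M := M) s) p X) = S.du t₀ p X := by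
    rw [du_apply, du_apply, dπ_mfderiv_vertShift]; rfl
  rw [ambientMetric_apply, ambientMetric_apply, du_vertShift, du_vertShift, dv_mfderiv_vertShift,
    dv_mfderiv_vertShift, dπ_mfderiv_vertShift, dπ_mfderiv_vertShift]
  rfl

lemma ambientMetric_nondegenerate {p : M × ℝ} {X : TangentSpace (prodModel n) p}
    (h : ∀ Y, S.ambientMetric t₀ p X Y = 0) : X = 0 := by
  have one_sub_ne_zero := (S.one_sub_pos t₀ p).ne'
  have du_X : S.du t₀ p X = 0 := by
    rw [← ambientMetric_vertField, ambientMetric_symm, h]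
  have dπ_X_mem : dπ p X ∈ spatial S.time p.1 := by
    rw [du_apply] at du_X
    exact (mul_eq_zero.1 du_X).resolve_left (neg_ne_zero.2 one_sub_ne_zero)
  have dπ_X : dπ p X = 0 := by
    by_contra hne
    obtain ⟨Z, -, -, -, -, hZ⟩ := exists_smoothFieldOn p.1 (dπ p X)
    have form_Z := h (lift Z p)
    rw [ambientMetric_apply, du_X, S.du_lift_of_mem t₀ (hZ ▸ dπ_X_mem), dπ_lift, hZ] at form_Z
    refine (S.g_pos p.1 _ dπ_X_mem hne).ne' ?_
    simpa only [zero_mul, mul_zero, add_zero, zero_add, sub_zero] using form_Z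
  have dv_X : dv p X = 0 := by
    have form_dt := h (lift S.dt p)
    rw [ambientMetric_apply, du_X, dπ_X, S.du_lift_dt] at form_dt
    simp only [zero_mul, map_zero, LinearMap.zero_apply, mul_zero, add_zero, zero_add,
      sub_zero] at form_dt
    exact (mul_eq_zero.1 form_dt).resolve_right (neg_ne_zero.2 one_sub_ne_zero)
  exact tangent_prod_ext (dπ_X.trans (map_zero (dπ p)).symm) (dv_X.trans (map_zero (dv p)).symm)

lemma exists_orthonormal_spatial (x : M) : ∃ f : Fin n → TangentSpace (𝓡∂ (n + 1)) x,
    (∀ a, f a ∈ spatial S.time x) ∧ ∀ a b, S.g x (f a) (f b) = if a = b then 1 else 0 := by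
  have : FiniteDimensional ℝ (TangentSpace (𝓡∂ (n + 1)) x) :=
    inferInstanceAs (FiniteDimensional ℝ (EuclideanSpace ℝ (Fin (n + 1))))
  obtain ⟨f, hf⟩ := exists_orthonormal_of_posDef (V := spatial (n := n) S.time x)
    (S.finrank_spatial x) ((S.g x).restrict (spatial S.time x)) (fun X Y => S.g_symm x X Y)
    (fun X hX => S.g_pos x X X.2 fun h => hX (Subtype.ext h))
  exact ⟨fun a => f a, fun a => (f a).2, hf⟩

theorem ambientMetric_signature (p : M × ℝ) :
    HasLorentzSignature (n + 1) (S.ambientMetric t₀ p) := by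
  obtain ⟨f, hf, f_ortho⟩ := S.exists_orthonormal_spatial p.1
  choose e _ _ _ _ he using fun a => exists_smoothFieldOn p.1 (f a)
  have e_mem (a : Fin n) : e a p.1 ∈ spatial S.time p.1 := by rw [he]; exact hf a
  refine hasLorentzSignature_of_null (N := vertField p) (T := lift S.dt p)
    (f := fun a => lift (e a) p) (finrank_tangent_prod p) (S.ambientMetric_symm t₀ p)
    (fun a b => ?_) (S.one_sub_pos t₀ p).ne' ?_ ?_ (S.ambientMetric_dt_dt t₀ p)
    (fun a => ?_) fun a => ?_
  · rw [S.ambientMetric_lift t₀ (e_mem b), he, he, f_ortho]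
  · rw [ambientMetric_vertField, du_vertField]
  · rw [ambientMetric_vertField, du_lift_dt]
  · rw [ambientMetric_vertField, S.du_lift_of_mem t₀ (e_mem a)]
  · rw [S.ambientMetric_lift t₀ (e_mem a), S.g_dt]

end GradientRicciFlowSpacetime

end AmbientMetric

/-- The full tangent bundle as a distribution. -/
def fullDist {E : Type*} [NormedAddCommGroup E] [NormedSpace ℝ E]
    {H : Type*} [TopologicalSpace H] (I : ModelWithCorners ℝ E H)
    (N : Type*) [TopologicalSpace N] [ChartedSpace H N] [IsManifold I ∞ N] :
    InvolutiveDist I N where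
  dist _ := ⊤
  lie_mem _ _ _ _ _ _ _ _ _ _ := Submodule.mem_top

namespace GradientRicciFlowSpacetime

variable {n : ℕ} {M : Type*} [TopologicalSpace M] [ChartedSpace (EuclideanHalfSpace (n + 1)) M]
  [IsManifold (𝓡∂ (n + 1)) ∞ M] {lam : ℝ} (S : GradientRicciFlowSpacetime n M lam) (t₀ : ℝ)

lemma det_gram_ambientMetric_ne_zero {ι : Type*} [Fintype ι] [DecidableEq ι]
    {e : ι → VField (prodModel n) (M × ℝ)} {U : Set (M × ℝ)}
    (he : IsFrameOn (prodModel n) (fun _ => ⊤) e U) {p : M × ℝ} (hp : p ∈ U) :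
    (gram (prodModel n) (S.ambientMetric t₀) e p).det ≠ 0 := by
  refine det_gram_ne_zero (S.ambientMetric_symm t₀ p) (he.linearIndependent p hp) fun X _ h => ?_
  refine S.ambientMetric_nondegenerate t₀ fun Y => ?_
  have mem_span : Y ∈ Submodule.span ℝ (Set.range fun a => e a p) := by
    rw [he.span_eq p hp]; exact Submodule.mem_top
  obtain ⟨c, rfl⟩ := (Submodule.mem_span_range_iff_exists_fun ℝ).1 mem_span
  simp [h]

/-- A family of fields on `M`, lifted to the ambient space and completed by the time field and the
vertical field. -/
def adaptedFrame (e : Fin n → VField (𝓡∂ (n + 1)) M) :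
    Fin n ⊕ Fin 2 → VField (prodModel n) (M × ℝ) :=
  Sum.elim (fun a => lift (e a)) ![lift S.dt, vertField]

section Frame

variable {e : Fin n → VField (𝓡∂ (n + 1)) M} {U : Set M}
  (he : IsFrameOn (𝓡∂ (n + 1)) (spatial S.time) e U)
include he

lemma liftsForm_ambientMetric : LiftsForm S.g (S.ambientMetric t₀) e U :=
  ⟨he.isOpen, he.smooth, fun _ hp _ a => S.ambientMetric_lift t₀ (he.mem a hp)⟩

lemma linearIndependent_adaptedFrame {p : M × ℝ} (hp : p.1 ∈ U) :
    LinearIndependent ℝ fun i => S.adaptedFrame e i p := by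
  rw [Fintype.linearIndependent_iff]
  intro c hc
  simp only [adaptedFrame, Fintype.sum_sum_type, Sum.elim_inl, Sum.elim_inr, Fin.sum_univ_two,
    Matrix.cons_val_zero, Matrix.cons_val_one] at hc
  have coeff_vert : c (Sum.inr 1) = 0 := by
    simpa [dv_lift, dv_vertField] using congrArg (dv p) hc
  have coeff_time : c (Sum.inr 0) = 0 := by
    have du_sum := congrArg (S.du 0 p) hc
    simp only [map_add, map_sum, map_smul, S.du_lift_of_mem 0 (he.mem _ hp), S.du_lift_dt,
      S.du_vertField, map_zero, Finset.sum_const_zero, zero_add, add_zero, smul_eq_mul,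
      mul_zero] at du_sum
    exact (mul_eq_zero.1 du_sum).resolve_right (neg_ne_zero.2 (S.one_sub_pos 0 p).ne')
  have coeff_slice (a : Fin n) : c (Sum.inl a) = 0 := by
    have dπ_sum := congrArg (dπ p) hc
    simp only [coeff_time, coeff_vert, zero_smul, add_zero, map_sum, map_smul, dπ_lift,
      map_zero] at dπ_sum
    exact Fintype.linearIndependent_iff.1 (he.linearIndependent p.1 hp) _ dπ_sum a
  rintro (a | i)
  · exact coeff_slice a
  · fin_cases i
    exacts [coeff_time, coeff_vert]

lemma isFrameOn_adaptedFrame {W : Set (M × ℝ)} (hW : IsOpen W) (hWU : ∀ p ∈ W, p.1 ∈ U) :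
    IsFrameOn (prodModel n) (fun _ => ⊤) (S.adaptedFrame e) W := by
  refine ⟨hW, ?_, fun p hp => S.linearIndependent_adaptedFrame he (hWU p hp), fun p hp => ?_⟩
  · rintro (a | i)
    · exact (he.smooth a).lift.mono hWU
    · fin_cases i
      · exact S.dt_smooth.lift.mono fun _ _ => Set.mem_univ _
      · exact smoothFieldOn_lineField W
  · have : FiniteDimensional ℝ (TangentSpace (prodModel n) p) :=
      inferInstanceAs (FiniteDimensional ℝ (EuclideanSpace ℝ (Fin (n + 1)) × ℝ))
    refine (S.linearIndependent_adaptedFrame he (hWU p hp)).span_eq_top_of_card_eq_finrank' ?_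
    rw [finrank_tangent_prod]; simp

end Frame

section Sections

open TopologicalSpace (Opens)

variable {e : Fin n → VField (𝓡∂ (n + 1)) M} {U : Set M}
  (he : IsFrameOn (𝓡∂ (n + 1)) (spatial S.time) e U)

/-- The ambient metric as a form on the sections of the tangent bundle over `W`. -/
def ambientForm (W : Opens (M × ℝ)) :
    LinearMap.BilinForm (SmoothFun (prodModel n) W)
      (SmoothSec (fullDist (prodModel n) (M × ℝ)) W) :=
  secForm (S.ambientMetric t₀) (S.ambientMetric_smooth t₀) _ W

/-- The lift of `e a` to `W`, as a section. -/
def sliceSec {W : Opens (M × ℝ)} (hWU : ∀ p ∈ W, p.1 ∈ U) (a : Fin n) :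
    SmoothSec (fullDist (prodModel n) (M × ℝ)) W :=
  SmoothSec.mk (lift (e a)) ((he.smooth a).lift.mono hWU) fun _ _ => Submodule.mem_top

/-- The lift of `∂_t` to `W`, as a section. -/
def timeSec (W : Opens (M × ℝ)) : SmoothSec (fullDist (prodModel n) (M × ℝ)) W :=
  SmoothSec.mk (lift S.dt) (S.dt_smooth.lift.mono fun _ _ => Set.mem_univ _)
    fun _ _ => Submodule.mem_top

variable (n) in
/-- The field `∂_v` on `W`, as a section. -/
def vertSec (W : Opens (M × ℝ)) : SmoothSec (fullDist (prodModel n) (M × ℝ)) W :=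
  SmoothSec.mk vertField (smoothFieldOn_lineField _) fun _ _ => Submodule.mem_top

/-- The function `u` on `W`. -/
def uFun (W : Opens (M × ℝ)) : SmoothFun (prodModel n) W :=
  SmoothFun.mk (S.u t₀) (S.u_smooth t₀).contMDiffOn

variable (n) in
/-- The function `v` on `W`. -/
def vFun (W : Opens (M × ℝ)) : SmoothFun (prodModel n) W := SmoothFun.mk Prod.snd contMDiffOn_snd

/-- The pullback to `W` of the potential of the flow. -/
def φFun (W : Opens (M × ℝ)) : SmoothFun (prodModel n) W :=
  SmoothFun.mk (fun p => S.φ p.1) (S.φ_smooth.comp contMDiff_fst).contMDiffOn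

/-- The pullback to `W` of the weighted scalar curvature of the slices. -/
def scalFun (W : Opens (M × ℝ)) : SmoothFun (prodModel n) W :=
  SmoothFun.mk (fun p => S.weightedScal p.1) (S.weightedScal_smooth.comp contMDiff_fst).contMDiffOn

/-- The function `(1 - lam u)⁻¹` on `W`. -/
def invFun (W : Opens (M × ℝ)) : SmoothFun (prodModel n) W :=
  SmoothFun.mk (fun p => (1 - lam * S.u t₀ p)⁻¹)
    (ContMDiffOn.inv₀ (contMDiffOn_const.sub
      (contMDiffOn_const.mul (S.u_smooth t₀).contMDiffOn)) fun p _ => (S.one_sub_pos t₀ p).ne')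

variable {W : Opens (M × ℝ)} (hWU : ∀ p ∈ W, p.1 ∈ U)

lemma sliceSec_apply (a : Fin n) (x : W) : (S.sliceSec he hWU a).1 x = lift (e a) x := rfl

lemma timeSec_apply (x : W) : (S.timeSec W).1 x = lift S.dt x := rfl

lemma vertSec_apply (x : W) : (vertSec n W).1 x = vertField (x : M × ℝ) := rfl

lemma ev_uFun (x : W) : ev x (S.uFun t₀ W) = S.u t₀ x := rfl

omit [IsManifold (𝓡∂ (n + 1)) ∞ M] in
lemma ev_vFun (x : W) : ev x (vFun n W) = (x : M × ℝ).2 := rfl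

lemma ev_φFun (x : W) : ev x (S.φFun W) = (fun q : M × ℝ => S.φ q.1) x := rfl

lemma ev_scalFun (x : W) : ev x (S.scalFun W) = (fun q : M × ℝ => S.weightedScal q.1) x := rfl

lemma invFun_mul : S.invFun t₀ W * (1 - algebraMap ℝ _ lam * S.uFun t₀ W) = 1 :=
  ext_ev fun x => by
    rw [map_mul, map_sub, map_mul, map_one, ev_uFun]
    exact inv_mul_cancel₀ (S.one_sub_pos t₀ x).ne'

lemma ev_ambientForm (X Y : SmoothSec (fullDist (prodModel n) (M × ℝ)) W) (x : W) :
    ev x (S.ambientForm t₀ W X Y) = S.ambientMetric t₀ x (X.1 x) (Y.1 x) :=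
  secForm_apply (S.ambientMetric t₀) (S.ambientMetric_smooth t₀) X Y x

lemma ambientForm_symm (X Y : SmoothSec (fullDist (prodModel n) (M × ℝ)) W) :
    S.ambientForm t₀ W X Y = S.ambientForm t₀ W Y X :=
  ext_ev fun x => by rw [ev_ambientForm, ev_ambientForm, ambientMetric_symm]

lemma ambientForm_vertSec (Z : SmoothSec (fullDist (prodModel n) (M × ℝ)) W) :
    S.ambientForm t₀ W (vertSec n W) Z = ⁅Z, S.uFun t₀ W⁆ :=
  ext_ev fun x => by
    rw [ev_ambientForm, vertSec_apply, ambientMetric_vertField,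
      ev_lie (extendSec_apply Z x).symm (S.ev_uFun t₀), ← extendSec_apply]
    rfl

lemma ambientForm_timeSec_timeSec :
    S.ambientForm t₀ W (S.timeSec W) (S.timeSec W) = -S.scalFun W :=
  ext_ev fun x => by
    rw [ev_ambientForm, timeSec_apply, S.ambientMetric_dt_dt, map_neg, ev_scalFun]

lemma ambientForm_sliceSec_timeSec (a : Fin n) :
    S.ambientForm t₀ W (S.sliceSec he hWU a) (S.timeSec W) = 0 :=
  ext_ev fun x => by
    rw [ev_ambientForm, map_zero, ambientMetric_symm, timeSec_apply, sliceSec_apply,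
      S.ambientMetric_lift t₀ (he.mem a (hWU x x.2)), S.g_dt]

lemma ev_ambientForm_sliceSec (a b : Fin n) (x : W) :
    ev x (S.ambientForm t₀ W (S.sliceSec he hWU a) (S.sliceSec he hWU b)) =
      (fun q : M × ℝ => S.g q.1 (e a q.1) (e b q.1)) x := by
  rw [ev_ambientForm, sliceSec_apply, sliceSec_apply]
  exact S.ambientMetric_lift t₀ (he.mem b (hWU x x.2))

lemma mem_span_ambientFrame (X : SmoothSec (fullDist (prodModel n) (M × ℝ)) W) :
    X ∈ Submodule.span (SmoothFun (prodModel n) W)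
      (Set.range (ambientFrame (S.sliceSec he hWU) (S.timeSec W) (vertSec n W))) := by
  have frame := S.isFrameOn_adaptedFrame he W.2 hWU
  have frame_eq : ambientFrame (S.sliceSec he hWU) (S.timeSec W) (vertSec n W) =
      IsFrameOn.sec (D := fullDist (prodModel n) (M × ℝ)) (U := W) frame := by
    funext i
    rcases i with a | i
    · rfl
    · fin_cases i <;> rfl
  obtain ⟨gi, hgi, -⟩ := exists_isGramInv (D := fullDist (prodModel n) (M × ℝ)) (U := W)
    (S.ambientMetric_smooth 0) frame.sec_apply (S.ambientMetric_symm 0)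
    fun p hp => S.det_gram_ambientMetric_ne_zero 0 frame hp
  rw [frame_eq]
  exact frame.mem_span_sec hgi X

lemma lie_algebraMap (X : SmoothSec (fullDist (prodModel n) (M × ℝ)) W) (r : ℝ) :
    ⁅X, algebraMap ℝ (SmoothFun (prodModel n) W) r⁆ = 0 :=
  ext_ev fun x => by
    rw [ev_lie (F := fun _ => r) (extendSec_apply X x).symm fun _ => rfl, map_zero]
    simp [along, mvfderiv_const]

lemma lie_sliceSec_uFun (a : Fin n) : ⁅S.sliceSec he hWU a, S.uFun t₀ W⁆ = 0 :=
  ext_ev fun x => by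
    rw [ev_lie (S.sliceSec_apply he hWU a x) (S.ev_uFun t₀), map_zero]
    exact S.du_lift_of_mem t₀ (he.mem a (hWU x x.2))

lemma lie_timeSec_uFun :
    ⁅S.timeSec W, S.uFun t₀ W⁆ = -(1 - algebraMap ℝ _ lam * S.uFun t₀ W) :=
  ext_ev fun x => by
    rw [ev_lie (S.timeSec_apply x) (S.ev_uFun t₀)]
    exact S.du_lift_dt t₀ x

lemma lie_vertSec_uFun : ⁅vertSec n W, S.uFun t₀ W⁆ = 0 :=
  ext_ev fun x => by
    rw [ev_lie (vertSec_apply x) (S.ev_uFun t₀), map_zero]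
    exact S.du_vertField t₀ x

lemma lie_sliceSec_vFun (a : Fin n) : ⁅S.sliceSec he hWU a, vFun n W⁆ = 0 :=
  ext_ev fun x => by
    rw [ev_lie (S.sliceSec_apply he hWU a x) ev_vFun, map_zero]
    exact dv_lift _ _

lemma lie_timeSec_vFun : ⁅S.timeSec W, vFun n W⁆ = 0 :=
  ext_ev fun x => by
    rw [ev_lie (S.timeSec_apply x) ev_vFun, map_zero]
    exact dv_lift _ _

lemma lie_vertSec_vFun : ⁅vertSec n W, vFun n W⁆ = 1 :=
  ext_ev fun x => by
    rw [ev_lie (vertSec_apply x) ev_vFun, map_one]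
    exact dv_vertField _

lemma lie_vertSec_eq_zero {f : SmoothFun (prodModel n) W} {F : M → ℝ}
    (hf : ∀ x : W, ev x f = (fun q : M × ℝ => F q.1) x)
    (hF : ∀ x : W, MDifferentiableAt (𝓡∂ (n + 1)) 𝓘(ℝ, ℝ) F (x : M × ℝ).1) :
    ⁅vertSec n W, f⁆ = 0 :=
  ext_ev fun x => by
    rw [ev_lie (F := fun q : M × ℝ => F q.1) (vertSec_apply x) hf, map_zero]
    exact along_lineField_comp_fst (hF x)

lemma lie_vertSec_ambientForm (a b : Fin n) :
    ⁅vertSec n W, S.ambientForm t₀ W (S.sliceSec he hWU a) (S.sliceSec he hWU b)⁆ = 0 :=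
  lie_vertSec_eq_zero (F := fun y => S.g y (e a y) (e b y))
    (S.ev_ambientForm_sliceSec t₀ he hWU a b)
    fun x => mdiffAt_of_contMDiffOn he.isOpen
      (S.g_smooth U _ _ he.isOpen (he.smooth a) (he.smooth b)) (hWU x x.2)

lemma lie_vertSec_scalFun : ⁅vertSec n W, S.scalFun W⁆ = 0 :=
  lie_vertSec_eq_zero S.ev_scalFun fun _ => S.weightedScal_smooth.mdifferentiableAt (by simp)

lemma lie_vertSec_φFun : ⁅vertSec n W, S.φFun W⁆ = 0 :=
  lie_vertSec_eq_zero S.ev_φFun fun _ => S.φ_smooth.mdifferentiableAt (by simp)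

lemma lie_vertSec_sliceSec (a : Fin n) : ⁅vertSec n W, S.sliceSec he hWU a⁆ = 0 :=
  SmoothSec.ext' fun x => by
    rw [SmoothSec.lie_apply vertSec_apply (S.sliceSec_apply he hWU a)]
    exact mlieBracket_lineField_lift he.isOpen (he.smooth a) (hWU x x.2)

lemma lie_vertSec_timeSec : ⁅vertSec n W, S.timeSec W⁆ = 0 :=
  SmoothSec.ext' fun x => by
    rw [SmoothSec.lie_apply vertSec_apply S.timeSec_apply]
    exact mlieBracket_lineField_lift isOpen_univ S.dt_smooth (Set.mem_univ _)

lemma ambientForm_lie_sliceSec_timeSec (a b : Fin n) :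
    S.ambientForm t₀ W ⁅S.sliceSec he hWU a, S.sliceSec he hWU b⁆ (S.timeSec W) = 0 :=
  ext_ev fun x => by
    have bracket_mem : mlieBracket (𝓡∂ (n + 1)) (e a) (e b) (x : M × ℝ).1 ∈
        spatial S.time (x : M × ℝ).1 :=
      S.spatialDist.lie_mem U _ _ he.isOpen (he.smooth a) (he.smooth b)
        (fun _ hy => he.mem a hy) (fun _ hy => he.mem b hy) _ (hWU x x.2)
    rw [ev_ambientForm, SmoothSec.lie_apply (S.sliceSec_apply he hWU a)
        (S.sliceSec_apply he hWU b), timeSec_apply,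
      mlieBracket_lift he.isOpen (he.smooth a) (he.smooth b) (hWU x x.2), ambientMetric_symm,
      S.ambientMetric_lift t₀ bracket_mem, S.g_dt, map_zero]

lemma ev_ambientForm_lie_timeSec (a b : Fin n) (x : W) :
    ev x (S.ambientForm t₀ W ⁅S.timeSec W, S.sliceSec he hWU a⁆ (S.sliceSec he hWU b)) =
      S.g (x : M × ℝ).1 (mlieBracket (𝓡∂ (n + 1)) S.dt (e a) (x : M × ℝ).1)
        (e b (x : M × ℝ).1) := by
  rw [ev_ambientForm, SmoothSec.lie_apply S.timeSec_apply (S.sliceSec_apply he hWU a),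
    mlieBracket_lift he.isOpen (S.dt_smooth.mono (Set.subset_univ U)) (he.smooth a) (hWU x x.2)]
  exact S.ambientMetric_lift t₀ (he.mem b (hWU x x.2))

lemma ev_lieDeriv_ambientForm (a b : Fin n) (x : W) :
    ev x (⁅S.timeSec W, S.ambientForm t₀ W (S.sliceSec he hWU a) (S.sliceSec he hWU b)⁆
        - S.ambientForm t₀ W ⁅S.timeSec W, S.sliceSec he hWU a⁆ (S.sliceSec he hWU b)
        - S.ambientForm t₀ W (S.sliceSec he hWU a) ⁅S.timeSec W, S.sliceSec he hWU b⁆) =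
      lieDerivForm (𝓡∂ (n + 1)) S.dt S.g (e a) (e b) (x : M × ℝ).1 := by
  rw [S.ambientForm_symm t₀ (S.sliceSec he hWU a) ⁅S.timeSec W, _⁆, map_sub, map_sub,
    ev_lie (F := fun q : M × ℝ => S.g q.1 (e a q.1) (e b q.1)) (S.timeSec_apply x)
      (S.ev_ambientForm_sliceSec t₀ he hWU a b),
    along_lift S.dt (fun y => S.g y (e a y) (e b y)), ev_ambientForm_lie_timeSec,
    ev_ambientForm_lie_timeSec, lieDerivForm, S.g_symm _ (e a _)]

lemma exists_isGramInv_sliceSec : ∃ gi : Matrix (Fin n) (Fin n) (SmoothFun (prodModel n) W),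
    IsGramInv (S.ambientForm t₀ W) (S.sliceSec he hWU) gi ∧ ∀ (x : W) a b, ev x (gi a b) =
      gramInv (prodModel n) (S.ambientMetric t₀) (fun a => lift (e a)) x a b := by
  refine exists_isGramInv (S.ambientMetric_smooth t₀) (S.sliceSec_apply he hWU)
    (S.ambientMetric_symm t₀) fun p hp => ?_
  have gram_eq : gram (prodModel n) (S.ambientMetric t₀) (fun a => lift (e a)) p =
      gram (𝓡∂ (n + 1)) S.g e p.1 := by
    ext a b
    exact S.ambientMetric_lift t₀ (he.mem b (hWU p hp))
  rw [gram_eq]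
  exact S.det_gram_frame_ne_zero he (hWU p hp)

section Curvature

variable {gi : Matrix (Fin n) (Fin n) (SmoothFun (prodModel n) W)}
  (hgi : ∀ (x : W) a b, ev x (gi a b) =
    gramInv (prodModel n) (S.ambientMetric t₀) (fun a => lift (e a)) x a b)
include hgi

lemma ev_frameScal_sliceSec (x : W) :
    ev x (frameScal (S.ambientForm t₀ W) gi (S.sliceSec he hWU)) =
      scal (𝓡∂ (n + 1)) S.g e (x : M × ℝ).1 :=
  (ev_frameScal (S.sliceSec_apply he hWU) hgi x).trans
    ((S.liftsForm_ambientMetric t₀ he).scal_eq (hWU x x.2))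

lemma ev_frameHess_sliceSec (x : W) (a b : Fin n) :
    ev x (frameHess (S.ambientForm t₀ W) gi (S.sliceSec he hWU) (S.φFun W) a b) =
      hess (𝓡∂ (n + 1)) S.g e S.φ a b (x : M × ℝ).1 :=
  (ev_frameHess (S.sliceSec_apply he hWU) hgi S.ev_φFun x a b).trans
    ((S.liftsForm_ambientMetric t₀ he).hess_eq (hWU x x.2) S.φ a b)

lemma ev_frameLap_sliceSec (x : W) :
    ev x (frameLap (S.ambientForm t₀ W) gi (S.sliceSec he hWU) (S.φFun W)) =
      lap (𝓡∂ (n + 1)) S.g e S.φ (x : M × ℝ).1 :=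
  (ev_frameLap (S.sliceSec_apply he hWU) hgi S.ev_φFun x).trans
    ((S.liftsForm_ambientMetric t₀ he).lap_eq (hWU x x.2) S.φ)

lemma lie_timeSec_ambientForm (a b : Fin n) :
    ⁅S.timeSec W, S.ambientForm t₀ W (S.sliceSec he hWU a) (S.sliceSec he hWU b)⁆
        - S.ambientForm t₀ W ⁅S.timeSec W, S.sliceSec he hWU a⁆ (S.sliceSec he hWU b)
        - S.ambientForm t₀ W (S.sliceSec he hWU a) ⁅S.timeSec W, S.sliceSec he hWU b⁆ =
      -2 * (frameRic (S.ambientForm t₀ W) gi (S.sliceSec he hWU) a b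
        + frameHess (S.ambientForm t₀ W) gi (S.sliceSec he hWU) (S.φFun W) a b
        - algebraMap ℝ _ lam
          * S.ambientForm t₀ W (S.sliceSec he hWU a) (S.sliceSec he hWU b)) :=
  ext_ev fun x => by
    have ev_ric : ev x (frameRic (S.ambientForm t₀ W) gi (S.sliceSec he hWU) a b) =
        ric (𝓡∂ (n + 1)) S.g e a b (x : M × ℝ).1 :=
      (ev_frameRic (S.sliceSec_apply he hWU) hgi x a b).trans
        ((S.liftsForm_ambientMetric t₀ he).ric_eq (hWU x x.2) a b)
    rw [S.ev_lieDeriv_ambientForm t₀ he hWU, S.flow_g e U he _ (hWU x x.2) a b, map_mul, map_neg,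
      map_ofNat, map_sub, map_add, map_mul, ev_ric, S.ev_frameHess_sliceSec t₀ he hWU hgi x a b,
      S.ev_ambientForm_sliceSec t₀ he hWU a b x]
    rfl

lemma lie_timeSec_φFun : ⁅S.timeSec W, S.φFun W⁆ =
    -(frameScal (S.ambientForm t₀ W) gi (S.sliceSec he hWU)
      + frameLap (S.ambientForm t₀ W) gi (S.sliceSec he hWU) (S.φFun W)
      - Fintype.card (Fin n) * algebraMap ℝ _ lam) :=
  ext_ev fun x => by
    rw [ev_lie (F := fun q : M × ℝ => S.φ q.1) (S.timeSec_apply x) S.ev_φFun, along_lift S.dt S.φ,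
      S.flow_φ e U he _ (hWU x x.2), map_neg, map_sub, map_add, map_mul, map_natCast,
      S.ev_frameScal_sliceSec t₀ he hWU hgi, S.ev_frameLap_sliceSec t₀ he hWU hgi,
      Fintype.card_fin]
    rfl

lemma scalFun_eq : S.scalFun W = frameScal (S.ambientForm t₀ W) gi (S.sliceSec he hWU)
    + 2 * frameLap (S.ambientForm t₀ W) gi (S.sliceSec he hWU) (S.φFun W)
    - frameGradSq gi (S.sliceSec he hWU) (S.φFun W)
    + 2 * algebraMap ℝ _ lam * (S.φFun W - Fintype.card (Fin n)) :=
  ext_ev fun x => by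
    have ev_gradSq : ev x (frameGradSq gi (S.sliceSec he hWU) (S.φFun W)) =
        gradSq (𝓡∂ (n + 1)) S.g e S.φ (x : M × ℝ).1 :=
      (ev_frameGradSq (S.sliceSec_apply he hWU) hgi S.ev_φFun x).trans
        ((S.liftsForm_ambientMetric t₀ he).gradSq_eq (hWU x x.2) S.φ)
    simp only [map_sub, map_add, map_mul, map_natCast, map_ofNat]
    rw [S.ev_frameScal_sliceSec t₀ he hWU hgi, S.ev_frameLap_sliceSec t₀ he hWU hgi, ev_gradSq]
    exact S.weightedScal_eq he (hWU x x.2)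

end Curvature

theorem exists_isAmbient : ∃ gi : Matrix (Fin n) (Fin n) (SmoothFun (prodModel n) W),
    IsAmbient (S.ambientForm t₀ W) (S.sliceSec he hWU) gi (S.timeSec W) (vertSec n W)
      (S.uFun t₀ W) (vFun n W) (S.φFun W) (S.scalFun W) (algebraMap ℝ _ lam) (S.invFun t₀ W) := by
  obtain ⟨gi, gram, hgi⟩ := S.exists_isGramInv_sliceSec t₀ he hWU
  exact ⟨gi, {
    symm := S.ambientForm_symm t₀
    gram := gram
    span := S.mem_span_ambientFrame he hWU
    form_e_T := S.ambientForm_sliceSec_timeSec t₀ he hWU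
    form_T_T := S.ambientForm_timeSec_timeSec t₀
    form_V := S.ambientForm_vertSec t₀
    lie_e_u := S.lie_sliceSec_uFun t₀ he hWU
    lie_T_u := S.lie_timeSec_uFun t₀
    lie_V_u := S.lie_vertSec_uFun t₀
    wi_mul := S.invFun_mul t₀
    lie_lam := fun X => lie_algebraMap X lam
    lie_V_e := S.lie_vertSec_sliceSec he hWU
    lie_V_T := S.lie_vertSec_timeSec
    lie_V_gram := S.lie_vertSec_ambientForm t₀ he hWU
    lie_V_ρ := S.lie_vertSec_scalFun
    lie_V_φ := S.lie_vertSec_φFun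
    lie_V_v := lie_vertSec_vFun
    lie_e_v := S.lie_sliceSec_vFun he hWU
    lie_T_v := S.lie_timeSec_vFun
    form_lie_e_e_T := S.ambientForm_lie_sliceSec_timeSec t₀ he hWU
    flow_g := S.lie_timeSec_ambientForm t₀ he hWU hgi
    flow_φ := S.lie_timeSec_φFun t₀ he hWU hgi
    ρ_eq := S.scalFun_eq t₀ he hWU hgi }⟩

lemma ev_potential {gi : Matrix (Fin n) (Fin n) (SmoothFun (prodModel n) W)}
    (H : IsAmbient (S.ambientForm t₀ W) (S.sliceSec he hWU) gi (S.timeSec W) (vertSec n W)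
      (S.uFun t₀ W) (vFun n W) (S.φFun W) (S.scalFun W) (algebraMap ℝ _ lam) (S.invFun t₀ W))
    (x : W) : ev x H.potential = S.ambientPotential t₀ x := by
  simp only [IsAmbient.potential, map_add, map_sub, map_mul, ev_φFun, ev_vFun, ev_uFun]
  rfl

end Sections

lemma koszul_vertField_vertField (Z : VField (prodModel n) (M × ℝ)) {U : Set (M × ℝ)}
    (hU : IsOpen U) (hZ : SmoothFieldOn (prodModel n) Z U) {p : M × ℝ} (hp : p ∈ U) :
    koszul (prodModel n) (S.ambientMetric t₀) vertField vertField Z p = 0 := by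
  have along_const (X : VField (prodModel n) (M × ℝ)) :
      along (prodModel n) X (fun _ => (0 : ℝ)) p = 0 := by
    simp [along, mvfderiv_const]
  have vert_u : along (prodModel n) vertField (S.u t₀) = fun _ => 0 :=
    funext fun q => S.du_vertField t₀ q
  have form_vert_Z :
      (fun q => S.ambientMetric t₀ q (vertField q) (Z q)) = along (prodModel n) Z (S.u t₀) :=
    funext fun q => S.ambientMetric_vertField t₀ q (Z q)
  have form_vert_vert :
      (fun q => S.ambientMetric t₀ q (vertField q) (vertField q)) = fun _ => 0 :=
    funext fun q => (S.ambientMetric_vertField t₀ q _).trans (S.du_vertField t₀ q)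
  have form_bracket_vert :
      S.ambientMetric t₀ p (mlieBracket (prodModel n) vertField Z p) (vertField p) =
        along (prodModel n) (mlieBracket (prodModel n) vertField Z) (S.u t₀) p := by
    rw [ambientMetric_symm, ambientMetric_vertField]; rfl
  have vert_smooth : SmoothFieldOn (prodModel n) (vertField (M := M)) U := smoothFieldOn_lineField U
  have bracket_u := along_lieBracket hU vert_smooth hZ (S.u_smooth t₀).contMDiffOn hp
  rw [vert_u, along_const, sub_zero] at bracket_u
  rw [koszul, form_vert_Z, form_vert_vert, along_const, form_bracket_vert, bracket_u]
  simp

lemma exists_isAmbient_nhd {U : Set (M × ℝ)} (hU : IsOpen U) {p : M × ℝ} (hp : p ∈ U) :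
    ∃ W : TopologicalSpace.Opens (M × ℝ), p ∈ W ∧ (W : Set (M × ℝ)) ⊆ U ∧
      ∃ (s : Fin n → SmoothSec (fullDist (prodModel n) (M × ℝ)) W)
        (gi : Matrix (Fin n) (Fin n) (SmoothFun (prodModel n) W))
        (H : IsAmbient (secForm (S.ambientMetric t₀) (S.ambientMetric_smooth t₀) _ W) s gi
          (S.timeSec W) (vertSec n W) (S.uFun t₀ W) (vFun n W) (S.φFun W) (S.scalFun W)
          (algebraMap ℝ _ lam) (S.invFun t₀ W)),
        ∀ x : W, ev x H.potential = S.ambientPotential t₀ x := by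
  obtain ⟨e, U₀, he, hp₀⟩ := S.exists_isFrameOn p.1
  let W : TopologicalSpace.Opens (M × ℝ) :=
    ⟨U ∩ Prod.fst ⁻¹' U₀, hU.inter (he.isOpen.preimage continuous_fst)⟩
  obtain ⟨gi, H⟩ := S.exists_isAmbient t₀ (W := W) he fun q hq => hq.2
  exact ⟨W, ⟨hp, hp₀⟩, Set.inter_subset_left, _, gi, H, S.ev_potential t₀ he _ H⟩

section Equations

variable {e : Fin (n + 2) → VField (prodModel n) (M × ℝ)} {U : Set (M × ℝ)}
  (he : IsFrameOn (prodModel n) (fun _ => ⊤) e U) {p : M × ℝ} (hp : p ∈ U)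
include he hp

theorem wP_ambientMetric_eq_zero (a b : Fin (n + 2)) :
    wP (prodModel n) (S.ambientMetric t₀) e (S.ambientPotential t₀) lam a b p = 0 := by
  obtain ⟨W, hpW, hWU, s, gi, H, ev_potential⟩ := S.exists_isAmbient_nhd t₀ he.isOpen hp
  have heW := he.mono W.2 hWU
  have wP_eq := wP_eq_ev (S.ambientMetric_symm t₀) heW
    (fun q hq => S.det_gram_ambientMetric_ne_zero t₀ heW hq) ev_potential lam
    H.isDualFrames ⟨p, hpW⟩ a b
  have weightedRicci_eq_zero := H.weightedRicci_eq_zero H.isDualFrames.isLeviCivita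
  rw [IsAmbient.weightedRicci] at weightedRicci_eq_zero
  rw [weightedRicci_eq_zero] at wP_eq
  simpa using wP_eq

theorem wF_ambientMetric_eq_zero :
    wF (prodModel n) (S.ambientMetric t₀) e (S.ambientPotential t₀) lam p = 0 := by
  obtain ⟨W, hpW, hWU, s, gi, H, ev_potential⟩ := S.exists_isAmbient_nhd t₀ he.isOpen hp
  have heW := he.mono W.2 hWU
  have card_eq : ((Fintype.card (Fin (n + 2)) : ℕ) : SmoothFun (prodModel n) W) =
      (Fintype.card (Fin n) : SmoothFun (prodModel n) W) + 2 := by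
    simp
  have wF_eq := wF_eq_ev (S.ambientMetric_symm t₀) heW
    (fun q hq => S.det_gram_ambientMetric_ne_zero t₀ heW hq) ev_potential lam
    H.isDualFrames ⟨p, hpW⟩
  rwa [card_eq, H.weightedScalar_eq_zero H.isDualFrames.isLeviCivita, map_zero] at wF_eq

end Equations

end GradientRicciFlowSpacetime

end RicciAmbient

end

theorem theorem1p5 {n : ℕ} {M : Type*} [TopologicalSpace M]
    [ChartedSpace (EuclideanHalfSpace (n + 1)) M] [IsManifold (𝓡∂ (n + 1)) ∞ M] {lam : ℝ}
    (S : RicciAmbient.GradientRicciFlowSpacetime n M lam) (t₀ : ℝ) :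
    S.IsGlobalAmbientHalfSpace t₀ (S.ambientMetric t₀) (S.ambientPotential t₀) where
  half_space p := RicciAmbient.uCoord_nonpos_iff lam t₀ (S.time p.1)
  metric_smooth := S.ambientMetric_smooth t₀
  metric_symm := S.ambientMetric_symm t₀
  signature := S.ambientMetric_signature t₀
  potential_smooth := S.ambientPotential_smooth t₀
  metric_invariant := S.ambientMetric_vertShift t₀
  potential_homogeneous := S.ambientPotential_dilation t₀
  metric_initial p _ X Y hX hY := by
    rw [RicciAmbient.GradientRicciFlowSpacetime.ambientMetric_apply, hX, hY]
    simp
  potential_initial p hp := by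
    simp [RicciAmbient.GradientRicciFlowSpacetime.ambientPotential,
      RicciAmbient.GradientRicciFlowSpacetime.u, hp, RicciAmbient.uCoord_self]
  straight p _ U Z hU hp hZ := S.koszul_vertField_vertField t₀ Z hU hZ hp
  wP_eq_zero _ _ he _ hp a b := S.wP_ambientMetric_eq_zero t₀ he hp a b
  wF_eq_zero _ _ he _ hp := S.wF_ambientMetric_eq_zero t₀ he hp
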